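/- For integers $n\ge 2$ and $0\le d\le n-1$, let $CM^{d,n}(\mathbb C)\subset \mathbb P_{\binom n2-1}(\mathbb C)$ be the Cayley–Menger variety: the Zariski closure of the set of points with homogeneous coordinates $(s_{ij})_{1\le i<j\le n}$, $s_{ij}=|p_i-p_j|^2$, where $(p_1,\dots,p_n)$ runs over all configurations of $n$ points of $\mathbb R^d$ that are not all equal (so $CM^{0,n}(\mathbb C)=\emptyset$). Let $1\le d\le n-1$. Then: 1. If $d\le n-2$, the singular locus of $CM^{d,n}(\mathbb C)$ is $CM^{d-1,n}(\mathbb C)$. 2. $CM^{d,n}(\mathbb C)$ is a projective variety, and there are a nonsingular projective variety $X$, a surjective birational morphism $\pi:X\to CM^{d,n}(\mathbb C)$ that is an isomorphism over the nonsingular locus of $CM^{d,n}(\mathbb C)$ (i.e. a resolution of singularities), and a morphism $p:X\to G(n-d-1,n-1)$ to the Grassmannian of $(n-d-1)$-dimensional (that is, codimension $d$) linear subspaces of $\mathbb C^{n-1}$ that is a Zariski locally trivial bundle with fibre $\mathbb P_{\binom{d+1}2-1}(\mathbb C)$. 3. $CM^{d,n}(\mathbb C)$ is rational, i.e. it is irreducible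 and birational to a projective space $\mathbb P_r(\mathbb C)$ for some $r$. -/

import Mathlib

open scoped Topology LinearAlgebra.Projectivization

noncomputable section

/-! ### Spaces with functions and varieties over `ℂ` -/

/-- A space with functions over `ℂ`: a topological space with a sheaf of `ℂ`-valued functions.
The sheaf is given through its stalks: `RegAt x f` says that `f` is regular in a neighbourhood of
`x`, so that `f` is a regular function on an open set `U` iff `RegAt x f` for all `x ∈ U`. Regular
functions form a `ℂ`-algebra, the set where a regular function does not vanish is open, and its
inverse is regular there. Classical varieties over `ℂ` are spaces with functions. -/
structure FunctionSpace where
  Pt : Type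
  top : TopologicalSpace Pt
  RegAt : Pt → (Pt → ℂ) → Prop
  congr : ∀ {x : Pt} {f g : Pt → ℂ}, f =ᶠ[𝓝 x] g → RegAt x f → RegAt x g
  eventually : ∀ {x : Pt} {f : Pt → ℂ}, RegAt x f → ∀ᶠ y in 𝓝 x, RegAt y f
  const : ∀ (x : Pt) (c : ℂ), RegAt x (fun _ => c)
  add : ∀ {x : Pt} {f g : Pt → ℂ}, RegAt x f → RegAt x g → RegAt x (f + g)
  mul : ∀ {x : Pt} {f g : Pt → ℂ}, RegAt x f → RegAt x g → RegAt x (f * g)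
  ne_zero : ∀ {x : Pt} {f : Pt → ℂ}, RegAt x f → f x ≠ 0 → ∀ᶠ y in 𝓝 x, f y ≠ 0
  inv : ∀ {x : Pt} {f : Pt → ℂ}, RegAt x f → f x ≠ 0 → RegAt x f⁻¹

attribute [instance] FunctionSpace.top

namespace FunctionSpace

/-- A morphism is a continuous map that pulls regular functions back to regular functions. -/
structure IsMorphism (X Y : FunctionSpace) (φ : X.Pt → Y.Pt) : Prop where
  continuous : Continuous φ
  comp : ∀ (x : X.Pt) (g : Y.Pt → ℂ), Y.RegAt (φ x) g → X.RegAt x (g ∘ φ)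

/-- An isomorphism: a morphism with an inverse morphism. -/
def IsIso (X Y : FunctionSpace) (φ : X.Pt → Y.Pt) : Prop :=
  IsMorphism X Y φ ∧ ∃ ψ : Y.Pt → X.Pt, IsMorphism Y X ψ ∧
    Function.LeftInverse ψ φ ∧ Function.RightInverse ψ φ

/-- The local ring of `X` at `x`: the germs at `x` of functions that are regular at `x`. -/
def localRing (X : FunctionSpace) (x : X.Pt) : Subring (Filter.Germ (𝓝 x) ℂ) where
  carrier := {s | ∃ f : X.Pt → ℂ, X.RegAt x f ∧ s = (f : Filter.Germ (𝓝 x) ℂ)}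
  mul_mem' := by
    rintro _ _ ⟨f, hf, rfl⟩ ⟨g, hg, rfl⟩
    exact ⟨f * g, X.mul hf hg, rfl⟩
  one_mem' := ⟨fun _ => 1, X.const x 1, rfl⟩
  add_mem' := by
    rintro _ _ ⟨f, hf, rfl⟩ ⟨g, hg, rfl⟩
    exact ⟨f + g, X.add hf hg, rfl⟩
  zero_mem' := ⟨fun _ => 0, X.const x 0, rfl⟩
  neg_mem' := by
    rintro _ ⟨f, hf, rfl⟩
    refine ⟨(fun _ => -1) * f, X.mul (X.const x (-1)) hf, ?_⟩
    have : (fun _ => (-1 : ℂ)) * f = -f := by ext; simp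
    rw [this]
    rfl

/-- A point is nonsingular if its local ring is a regular local ring. -/
def Nonsingular (X : FunctionSpace) (x : X.Pt) : Prop := IsRegularLocalRing (X.localRing x)

/-- The singular locus: the set of points that are not nonsingular. -/
def singularLocus (X : FunctionSpace) : Set X.Pt := {x | ¬ X.Nonsingular x}

/-! ### Constructions -/

/-- The structure induced along a map `j : S → X`: the induced topology, and regular functions are
locally pulled back from regular functions on `X`. -/
def induced (X : FunctionSpace) {S : Type} (j : S → X.Pt) : FunctionSpace where
  Pt := S
  top := TopologicalSpace.induced j X.top
  RegAt s f := ∃ g, X.RegAt (j s) g ∧ f =ᶠ[@nhds S (TopologicalSpace.induced j X.top) s] g ∘ j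
  congr := by
    rintro x f f' h ⟨g, hg, hf⟩
    exact ⟨g, hg, h.symm.trans hf⟩
  eventually := by
    let _ := TopologicalSpace.induced j X.top
    have hj : Continuous j := continuous_induced_dom
    rintro x f ⟨g, hg, hf⟩
    filter_upwards [hj.continuousAt.eventually (X.eventually hg),
      eventually_eventually_nhds.2 hf] with y h1 h2
    exact ⟨g, h1, h2⟩
  const x c := ⟨fun _ => c, X.const _ c, Filter.EventuallyEq.rfl⟩
  add := by
    rintro x f f' ⟨g, hg, hf⟩ ⟨g', hg', hf'⟩
    exact ⟨g + g', X.add hg hg', hf.add hf'⟩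
  mul := by
    rintro x f f' ⟨g, hg, hf⟩ ⟨g', hg', hf'⟩
    exact ⟨g * g', X.mul hg hg', hf.mul hf'⟩
  ne_zero := by
    let _ := TopologicalSpace.induced j X.top
    have hj : Continuous j := continuous_induced_dom
    rintro x f ⟨g, hg, hf⟩ h0
    have h1 : g (j x) ≠ 0 := by have := hf.self_of_nhds; rw [this] at h0; exact h0
    filter_upwards [hj.continuousAt.eventually (X.ne_zero hg h1), hf] with y h2 h3
    rw [h3]; exact h2
  inv := by
    let _ := TopologicalSpace.induced j X.top
    rintro x f ⟨g, hg, hf⟩ h0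
    have h1 : g (j x) ≠ 0 := by have := hf.self_of_nhds; rw [this] at h0; exact h0
    exact ⟨g⁻¹, X.inv hg h1, hf.inv⟩

/-- A subset of a space with functions, with the induced structure. -/
def restrict (X : FunctionSpace) (S : Set X.Pt) : FunctionSpace :=
  X.induced (Subtype.val : S → X.Pt)

/-- The quotient structure along a surjection `q : X → Q`: a set is open, and a function on it is
regular, iff this holds for its pullback to `X`. -/
def quotient (X : FunctionSpace) {Q : Type} (q : X.Pt → Q) (_hq : Function.Surjective q) :
    FunctionSpace where
  Pt := Q
  top := TopologicalSpace.coinduced q X.top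
  RegAt x f := ∀ᶠ x' in @nhds Q (TopologicalSpace.coinduced q X.top) x,
    ∀ y, q y = x' → X.RegAt y (f ∘ q)
  congr := by
    let _ := TopologicalSpace.coinduced q X.top
    have hc : Continuous q := continuous_coinduced_rng
    intro x f g h hf
    filter_upwards [hf, eventually_eventually_nhds.2 h] with x' h1 h2
    rintro y rfl
    exact X.congr (hc.continuousAt.eventually h2) (h1 y rfl)
  eventually h := (@eventually_eventually_nhds Q (TopologicalSpace.coinduced q X.top) _ _).2 h
  const x c := Filter.Eventually.of_forall fun _ y _ => X.const y c
  add := by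
    intro x f g hf hg
    filter_upwards [hf, hg] with x' h1 h2 y hy
    exact X.add (h1 y hy) (h2 y hy)
  mul := by
    intro x f g hf hg
    filter_upwards [hf, hg] with x' h1 h2 y hy
    exact X.mul (h1 y hy) (h2 y hy)
  ne_zero := by
    let _ := TopologicalSpace.coinduced q X.top
    have hc : Continuous q := continuous_coinduced_rng
    intro x f hf h0
    obtain ⟨U, hU, hUo, hxU⟩ := eventually_nhds_iff.1 hf
    refine eventually_nhds_iff.2 ⟨{x' | x' ∈ U ∧ f x' ≠ 0}, fun y hy => hy.2, ?_, hxU, h0⟩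
    rw [isOpen_coinduced, isOpen_iff_mem_nhds]
    rintro y ⟨hyU, hy0⟩
    filter_upwards [hc.continuousAt.eventually (hUo.mem_nhds hyU),
      X.ne_zero (hU _ hyU y rfl) hy0] with z h1 h2
    exact ⟨h1, h2⟩
  inv := by
    let _ := TopologicalSpace.coinduced q X.top
    have hc : Continuous q := continuous_coinduced_rng
    intro x f hf h0
    obtain ⟨U, hU, hUo, hxU⟩ := eventually_nhds_iff.1 hf
    have hW : IsOpen {x' | x' ∈ U ∧ f x' ≠ 0} := by
      rw [isOpen_coinduced, isOpen_iff_mem_nhds]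
      rintro y ⟨hyU, hy0⟩
      filter_upwards [hc.continuousAt.eventually (hUo.mem_nhds hyU),
        X.ne_zero (hU _ hyU y rfl) hy0] with z h1 h2
      exact ⟨h1, h2⟩
    filter_upwards [hW.mem_nhds ⟨hxU, h0⟩] with x' hx'
    rintro y rfl
    exact X.inv (hU _ hx'.1 y rfl) hx'.2

/-- The Zariski topology on `ℂ^ι`, with the sets `{p ≠ 0}`, `p` a polynomial, as a basis. -/
@[reducible] def zariski (ι : Type) : TopologicalSpace (ι → ℂ) :=
  TopologicalSpace.generateFrom
    (Set.range fun p : MvPolynomial ι ℂ => {x : ι → ℂ | MvPolynomial.eval x p ≠ 0})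

theorem zariski_eventually {ι : Type} {x : ι → ℂ} {p : MvPolynomial ι ℂ}
    (h : MvPolynomial.eval x p ≠ 0) :
    ∀ᶠ y in @nhds _ (zariski ι) x, MvPolynomial.eval y p ≠ 0 := by
  have ho : @IsOpen _ (zariski ι) {x : ι → ℂ | MvPolynomial.eval x p ≠ 0} :=
    TopologicalSpace.isOpen_generateFrom_of_mem ⟨p, rfl⟩
  exact @IsOpen.mem_nhds _ (zariski ι) _ _ ho h

/-- Affine space `ℂ^ι`: regular functions are locally quotients of polynomials. -/
def affineSpace (ι : Type) : FunctionSpace where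
  Pt := ι → ℂ
  top := zariski ι
  RegAt x f := ∃ a b : MvPolynomial ι ℂ, MvPolynomial.eval x b ≠ 0 ∧
    f =ᶠ[@nhds _ (zariski ι) x] fun y => MvPolynomial.eval y a / MvPolynomial.eval y b
  congr := by
    rintro x f g h ⟨a, b, hb, hf⟩
    exact ⟨a, b, hb, h.symm.trans hf⟩
  eventually := by
    rintro x f ⟨a, b, hb, hf⟩
    filter_upwards [zariski_eventually hb,
      (@eventually_eventually_nhds _ (zariski ι) _ _).2 hf] with y h1 h2
    exact ⟨a, b, h1, h2⟩
  const x c := ⟨MvPolynomial.C c, 1, by simp, Filter.Eventually.of_forall fun y => by simp⟩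
  add := by
    rintro x f g ⟨a, b, hb, hf⟩ ⟨a', b', hb', hg⟩
    refine ⟨a * b' + b * a', b * b', by simp [hb, hb'], ?_⟩
    filter_upwards [hf, hg, zariski_eventually hb, zariski_eventually hb'] with y h1 h2 h3 h4
    simp only [Pi.add_apply, h1, h2, map_add, map_mul]
    rw [div_add_div _ _ h3 h4]
  mul := by
    rintro x f g ⟨a, b, hb, hf⟩ ⟨a', b', hb', hg⟩
    refine ⟨a * a', b * b', by simp [hb, hb'], ?_⟩
    filter_upwards [hf, hg] with y h1 h2
    simp only [Pi.mul_apply, h1, h2, map_mul, div_mul_div_comm]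
  ne_zero := by
    rintro x f ⟨a, b, hb, hf⟩ h0
    have h1 : MvPolynomial.eval x a ≠ 0 := by
      intro h
      apply h0
      rw [@Filter.Eventually.self_of_nhds _ (zariski ι) _ _ hf]
      simp [h]
    filter_upwards [hf, zariski_eventually hb, zariski_eventually h1] with y h2 h3 h4
    rw [h2]
    exact div_ne_zero h4 h3
  inv := by
    rintro x f ⟨a, b, hb, hf⟩ h0
    have h1 : MvPolynomial.eval x a ≠ 0 := by
      intro h
      apply h0
      rw [@Filter.Eventually.self_of_nhds _ (zariski ι) _ _ hf]
      simp [h]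
    refine ⟨b, a, h1, ?_⟩
    filter_upwards [hf] with y h2
    simp [h2]

/-- The projective space `P(ℂ^ι)`, as the quotient of `ℂ^ι ∖ {0}`. -/
def projectiveSpace (ι : Type) : FunctionSpace :=
  FunctionSpace.quotient
    ((affineSpace ι).induced (Subtype.val : {v : ι → ℂ // v ≠ 0} → ι → ℂ))
    (Q := ℙ ℂ (ι → ℂ)) (Projectivization.mk' ℂ)
    (fun x => ⟨⟨x.rep, x.rep_nonzero⟩, by simp [Projectivization.mk'_eq_mk]⟩)

/-- The projective space `P_r(ℂ)`. -/
def projectiveSpaceN (r : ℕ) : FunctionSpace := projectiveSpace (Fin (r + 1))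

/-- The set of `k`-dimensional linear subspaces of `ℂ^m`. -/
def Subspaces (k m : ℕ) : Type :=
  {L : Submodule ℂ (Fin m → ℂ) // Module.finrank ℂ L = k}

/-- The set of `k`-frames in `ℂ^m`. -/
def Frames (k m : ℕ) : Type := {v : Fin k → Fin m → ℂ // LinearIndependent ℂ v}

/-- The subspace spanned by a frame. -/
def Frames.span {k m : ℕ} (v : Frames k m) : Subspaces k m :=
  ⟨Submodule.span ℂ (Set.range v.1), by simpa using finrank_span_eq_card v.2⟩

theorem Frames.span_surjective (k m : ℕ) :
    Function.Surjective (Frames.span : Frames k m → Subspaces k m) := by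
  rintro ⟨L, hL⟩
  let b := Module.finBasisOfFinrankEq ℂ L hL
  refine ⟨⟨fun i => (b i : Fin m → ℂ),
    b.linearIndependent.map' L.subtype (Submodule.ker_subtype L)⟩, Subtype.ext ?_⟩
  have h : Set.range (fun i => (b i : Fin m → ℂ)) = L.subtype '' Set.range b := by
    rw [← Set.range_comp]; rfl
  change Submodule.span ℂ (Set.range fun i => (b i : Fin m → ℂ)) = L
  rw [h, Submodule.span_image, b.span_eq, Submodule.map_top, Submodule.range_subtype]

/-- The Grassmannian `G(k, m)` of `k`-dimensional subspaces of `ℂ^m`, as the quotient of the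
space of `k`-frames, which is a subset of the affine space of `k × m` matrices. -/
def grassmannian (k m : ℕ) : FunctionSpace :=
  FunctionSpace.quotient
    ((affineSpace (Fin k × Fin m)).induced
      (fun (v : Frames k m) (e : Fin k × Fin m) => v.1 e.1 e.2))
    (Q := Subspaces k m) Frames.span (Frames.span_surjective k m)

/-- The functions `∑ fᵢ(x) gᵢ(y)` with `fᵢ` regular on `U` and `gᵢ` regular on `V`. -/
def tensorFunctions (X Y : FunctionSpace) (U : Set X.Pt) (V : Set Y.Pt) :
    Subalgebra ℂ (X.Pt × Y.Pt → ℂ) :=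
  Algebra.adjoin ℂ
    ({h | ∃ f : X.Pt → ℂ, (∀ x ∈ U, X.RegAt x f) ∧ h = fun p => f p.1} ∪
     {h | ∃ g : Y.Pt → ℂ, (∀ y ∈ V, Y.RegAt y g) ∧ h = fun p => g p.2})

theorem tensorFunctions_mono {X Y : FunctionSpace} {U U' : Set X.Pt} {V V' : Set Y.Pt}
    (hU : U ⊆ U') (hV : V ⊆ V') : tensorFunctions X Y U' V' ≤ tensorFunctions X Y U V := by
  apply Algebra.adjoin_mono
  rintro h (⟨f, hf, rfl⟩ | ⟨g, hg, rfl⟩)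
  · exact Or.inl ⟨f, fun x hx => hf x (hU hx), rfl⟩
  · exact Or.inr ⟨g, fun y hy => hg y (hV hy), rfl⟩

/-- The Zariski topology on a product: the sets where `∑ fᵢ(x) gᵢ(y) ≠ 0` form a basis. -/
@[reducible] def prodTop (X Y : FunctionSpace) : TopologicalSpace (X.Pt × Y.Pt) :=
  TopologicalSpace.generateFrom
    {W | ∃ (U : Set X.Pt) (V : Set Y.Pt) (h : X.Pt × Y.Pt → ℂ), IsOpen U ∧ IsOpen V ∧
      h ∈ tensorFunctions X Y U V ∧ W = {p | p.1 ∈ U ∧ p.2 ∈ V ∧ h p ≠ 0}}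

theorem prod_eventually {X Y : FunctionSpace} {U : Set X.Pt} {V : Set Y.Pt}
    {h : X.Pt × Y.Pt → ℂ} (hU : IsOpen U) (hV : IsOpen V) (hh : h ∈ tensorFunctions X Y U V)
    {p : X.Pt × Y.Pt} (h1 : p.1 ∈ U) (h2 : p.2 ∈ V) (h3 : h p ≠ 0) :
    ∀ᶠ q in @nhds _ (prodTop X Y) p, q.1 ∈ U ∧ q.2 ∈ V ∧ h q ≠ 0 := by
  have ho : @IsOpen _ (prodTop X Y) {p | p.1 ∈ U ∧ p.2 ∈ V ∧ h p ≠ 0} :=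
    TopologicalSpace.isOpen_generateFrom_of_mem ⟨U, V, h, hU, hV, hh, rfl⟩
  exact @IsOpen.mem_nhds _ (prodTop X Y) _ _ ho ⟨h1, h2, h3⟩

/-- The product of spaces with functions: regular functions are locally quotients of functions
`∑ fᵢ(x) gᵢ(y)`. This is the categorical product, and the usual product for varieties. -/
def prod (X Y : FunctionSpace) : FunctionSpace where
  Pt := X.Pt × Y.Pt
  top := prodTop X Y
  RegAt p h := ∃ (U : Set X.Pt) (V : Set Y.Pt) (a b : X.Pt × Y.Pt → ℂ),
    IsOpen U ∧ IsOpen V ∧ p.1 ∈ U ∧ p.2 ∈ V ∧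
    a ∈ tensorFunctions X Y U V ∧ b ∈ tensorFunctions X Y U V ∧ b p ≠ 0 ∧
    h =ᶠ[@nhds _ (prodTop X Y) p] fun q => a q / b q
  congr := by
    rintro x f g h ⟨U, V, a, b, hU, hV, h1, h2, ha, hb, hb0, hf⟩
    exact ⟨U, V, a, b, hU, hV, h1, h2, ha, hb, hb0, h.symm.trans hf⟩
  eventually := by
    rintro x f ⟨U, V, a, b, hU, hV, h1, h2, ha, hb, hb0, hf⟩
    filter_upwards [prod_eventually hU hV hb h1 h2 hb0,
      (@eventually_eventually_nhds _ (prodTop X Y) _ _).2 hf] with y h3 h4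
    exact ⟨U, V, a, b, hU, hV, h3.1, h3.2.1, ha, hb, h3.2.2, h4⟩
  const x c := ⟨Set.univ, Set.univ, algebraMap ℂ _ c, 1, isOpen_univ, isOpen_univ, trivial, trivial,
    Subalgebra.algebraMap_mem _ c, one_mem _, by simp, Filter.Eventually.of_forall fun y => by simp⟩
  add := by
    rintro x f g ⟨U, V, a, b, hU, hV, h1, h2, ha, hb, hb0, hf⟩
      ⟨U', V', a', b', hU', hV', h1', h2', ha', hb', hb0', hg⟩
    have i := tensorFunctions_mono (X := X) (Y := Y) (Set.inter_subset_left (s := U) (t := U'))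
      (Set.inter_subset_left (s := V) (t := V'))
    have i' := tensorFunctions_mono (X := X) (Y := Y) (Set.inter_subset_right (s := U) (t := U'))
      (Set.inter_subset_right (s := V) (t := V'))
    refine ⟨U ∩ U', V ∩ V', a * b' + b * a', b * b', hU.inter hU', hV.inter hV', ⟨h1, h1'⟩,
      ⟨h2, h2'⟩, add_mem (mul_mem (i ha) (i' hb')) (mul_mem (i hb) (i' ha')),
      mul_mem (i hb) (i' hb'), mul_ne_zero hb0 hb0', ?_⟩
    filter_upwards [hf, hg, prod_eventually hU hV hb h1 h2 hb0,
      prod_eventually hU' hV' hb' h1' h2' hb0'] with y e1 e2 e3 e4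
    simp only [Pi.add_apply, e1, e2, Pi.mul_apply]
    rw [div_add_div _ _ e3.2.2 e4.2.2]
  mul := by
    rintro x f g ⟨U, V, a, b, hU, hV, h1, h2, ha, hb, hb0, hf⟩
      ⟨U', V', a', b', hU', hV', h1', h2', ha', hb', hb0', hg⟩
    have i := tensorFunctions_mono (X := X) (Y := Y) (Set.inter_subset_left (s := U) (t := U'))
      (Set.inter_subset_left (s := V) (t := V'))
    have i' := tensorFunctions_mono (X := X) (Y := Y) (Set.inter_subset_right (s := U) (t := U'))
      (Set.inter_subset_right (s := V) (t := V'))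
    refine ⟨U ∩ U', V ∩ V', a * a', b * b', hU.inter hU', hV.inter hV', ⟨h1, h1'⟩,
      ⟨h2, h2'⟩, mul_mem (i ha) (i' ha'), mul_mem (i hb) (i' hb'), mul_ne_zero hb0 hb0', ?_⟩
    filter_upwards [hf, hg] with y e1 e2
    simp only [Pi.mul_apply, e1, e2, div_mul_div_comm]
  ne_zero := by
    rintro x f ⟨U, V, a, b, hU, hV, h1, h2, ha, hb, hb0, hf⟩ h0
    have ha0 : a x ≠ 0 := by
      intro h
      apply h0
      rw [@Filter.Eventually.self_of_nhds _ (prodTop X Y) _ _ hf]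
      simp [h]
    filter_upwards [hf, prod_eventually hU hV hb h1 h2 hb0,
      prod_eventually hU hV ha h1 h2 ha0] with y e1 e2 e3
    rw [e1]
    exact div_ne_zero e3.2.2 e2.2.2
  inv := by
    rintro x f ⟨U, V, a, b, hU, hV, h1, h2, ha, hb, hb0, hf⟩ h0
    have ha0 : a x ≠ 0 := by
      intro h
      apply h0
      rw [@Filter.Eventually.self_of_nhds _ (prodTop X Y) _ _ hf]
      simp [h]
    refine ⟨U, V, b, a, hU, hV, h1, h2, hb, ha, ha0, ?_⟩
    filter_upwards [hf] with y e1
    simp [e1]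

/-! ### Varieties, resolutions, bundles, rationality -/

/-- A projective variety: an irreducible space with functions that is isomorphic to a Zariski
closed subset of some projective space `P_N(ℂ)`. -/
def IsProjectiveVariety (X : FunctionSpace) : Prop :=
  IrreducibleSpace X.Pt ∧ ∃ (N : ℕ) (Z : Set (projectiveSpaceN N).Pt), IsClosed Z ∧
    ∃ φ : X.Pt → ((projectiveSpaceN N).restrict Z).Pt, IsIso X ((projectiveSpaceN N).restrict Z) φ

/-- `π` restricts to an isomorphism from the preimage of `U` onto `U`. -/
def IsIsoOver (X' X : FunctionSpace) (π : X'.Pt → X.Pt) (U : Set X.Pt) : Prop :=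
  IsIso (X'.restrict (π ⁻¹' U)) (X.restrict U) (U.restrictPreimage π)

/-- `π : X' → X` is a resolution of singularities of the projective variety `X`: a birational
morphism from a nonsingular projective variety `X'` that is an isomorphism over the nonsingular
locus of `X`. (As `X'` is projective, `π` is proper.) -/
structure IsResolution (X' X : FunctionSpace) (π : X'.Pt → X.Pt) : Prop where
  source : IsProjectiveVariety X'
  target : IsProjectiveVariety X
  nonsingular : ∀ x : X'.Pt, X'.Nonsingular x
  morphism : IsMorphism X' X π
  surjective : Function.Surjective π
  birational : ∃ U : Set X.Pt, IsOpen U ∧ U.Nonempty ∧ IsIsoOver X' X π U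
  iso : IsIsoOver X' X π X.singularLocusᶜ

/-- `p : E → B` is a (Zariski locally trivial) bundle with fibre `P_r(ℂ)`: a morphism such that
every point of `B` has an open neighbourhood `U` with `p ⁻¹(U) ≅ U × P_r(ℂ)` over `U`. -/
structure IsProjectiveSpaceBundle (r : ℕ) (E B : FunctionSpace) (p : E.Pt → B.Pt) : Prop where
  morphism : IsMorphism E B p
  locallyTrivial : ∀ b : B.Pt, ∃ U : Set B.Pt, IsOpen U ∧ b ∈ U ∧
    ∃ φ : (E.restrict (p ⁻¹' U)).Pt → ((B.restrict U).prod (projectiveSpaceN r)).Pt,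
      IsIso (E.restrict (p ⁻¹' U)) ((B.restrict U).prod (projectiveSpaceN r)) φ ∧
      ∀ x, (φ x).1 = U.restrictPreimage p x

/-- `X` is rational: it is irreducible and birational to some projective space `P_r(ℂ)`, i.e.
nonempty open subsets of the two are isomorphic. -/
def IsRational (X : FunctionSpace) : Prop :=
  IrreducibleSpace X.Pt ∧ ∃ (r : ℕ) (U : Set X.Pt) (V : Set (projectiveSpaceN r).Pt),
    IsOpen U ∧ U.Nonempty ∧ IsOpen V ∧ V.Nonempty ∧
    ∃ φ : (X.restrict U).Pt → ((projectiveSpaceN r).restrict V).Pt,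
      IsIso (X.restrict U) ((projectiveSpaceN r).restrict V) φ

end FunctionSpace

/-! ### Cayley–Menger varieties -/

/-- The index set of the coordinates `s_{ij}`, `i < j`, of `P_{(n choose 2) - 1}(ℂ)`. -/
abbrev CayleyIndex (n : ℕ) : Type := {e : Fin n × Fin n // e.1 < e.2}

/-- The squared distances `s_{ij} = |p_i - p_j|²` of a configuration of `n` points in `ℝ^d`. -/
def squaredDistances {d n : ℕ} (p : Fin n → EuclideanSpace ℝ (Fin d)) : CayleyIndex n → ℂ :=
  fun e => ((‖p e.1.1 - p e.1.2‖ ^ 2 : ℝ) : ℂ)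

theorem squaredDistances_ne_zero {d n : ℕ} {p : Fin n → EuclideanSpace ℝ (Fin d)}
    (h : ∃ i j, p i ≠ p j) : squaredDistances p ≠ 0 := by
  obtain ⟨i, j, hij⟩ := h
  intro h0
  rcases lt_trichotomy i j with h | h | h
  · have := congrFun h0 ⟨(i, j), h⟩
    simp [squaredDistances, sub_eq_zero, hij] at this
  · exact hij (by rw [h])
  · have := congrFun h0 ⟨(j, i), h⟩
    simp [squaredDistances, sub_eq_zero, hij.symm] at this

/-- The image in `P_{(n choose 2) - 1}(ℂ)` of the space of configurations of `n` points in `ℝ^d`,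
not all equal. (The squared distances, up to proportionality, depend only on the class of the
configuration up to isometries and rescaling.) -/
def configurationImage (d n : ℕ) : Set (ℙ ℂ (CayleyIndex n → ℂ)) :=
  {x | ∃ (p : Fin n → EuclideanSpace ℝ (Fin d)) (h : ∃ i j, p i ≠ p j),
    x = Projectivization.mk ℂ (squaredDistances p) (squaredDistances_ne_zero h)}

/-- The Zariski closure of a subset of a projective space: the vanishing locus of all homogeneous
polynomials which vanish on the given subset. -/
def zariskiClosure {ι : Type} (S : Set (ℙ ℂ (ι → ℂ))) : Set (ℙ ℂ (ι → ℂ)) :=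
  {x | ∀ (k : ℕ) (f : MvPolynomial ι ℂ), f.IsHomogeneous k →
    (∀ y ∈ S, MvPolynomial.eval y.rep f = 0) → MvPolynomial.eval x.rep f = 0}

/-- The set of points of the Cayley–Menger variety `CM^{d,n}(ℂ)`. -/
def cayleyMengerSet (d n : ℕ) : Set (ℙ ℂ (CayleyIndex n → ℂ)) :=
  zariskiClosure (configurationImage d n)

/-- The Cayley–Menger variety `CM^{d,n}(ℂ)`, as a subvariety of `P_{(n choose 2) - 1}(ℂ)`. -/
def cayleyMenger (d n : ℕ) : FunctionSpace :=
  (FunctionSpace.projectiveSpace (CayleyIndex n)).restrict (cayleyMengerSet d n)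

/-- The singular locus of `CM^{d,n}(ℂ)`, as a subset of `P_{(n choose 2) - 1}(ℂ)`. -/
def cayleyMengerSingularSet (d n : ℕ) : Set (ℙ ℂ (CayleyIndex n → ℂ)) :=
  {x | ∃ h : x ∈ cayleyMengerSet d n, (⟨x, h⟩ : (cayleyMenger d n).Pt) ∈
    (cayleyMenger d n).singularLocus}

end

/-! Put m = n - 1 and k = n - d - 1, so k + d = m. With the first point at the origin, polarization
turns the squared distances s into the Gram matrix `gram s`. This is a linear bijection onto
symmetric m × m matrices, with inverse `distOf`. A real configuration in dimension d has Gram matrix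
AᵀA with A real of size d × m. Over ℂ every symmetric matrix of rank at most d is AᵀA with A
complex, and real matrices A are Zariski dense among complex ones. Hence the variety is the
projectivized locus of symmetric matrices of rank at most d (`mem_cayleyMengerSet_iff`).

The resolution X is the incidence variety of pairs (L, [s]) with dim L = k and L contained in the
kernel of `gram s`. Over a fixed L the fibre is the projective space of quadratic forms on ℂ^m / L,
which has (d+1 choose 2) homogeneous coordinates. Over a standard chart of the Grassmannian such a
form is determined by its restriction to the d complementary coordinates, which trivializes the
bundle (`isProjectiveSpaceBundle_incidence`). So X is locally an affine space, hence nonsingular. It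
is irreducible because its charts are irreducible and any two of them meet, and the Plücker and
Segre coordinates embed it as a closed subset of a projective space.

Over a matrix of rank exactly d the subspace L must be the kernel, and Cramer's rule gives a frame
of the kernel with regular entries. So X → CM is a local isomorphism there
(`IsNondegenerate.locIso`). This gives birationality, nonsingularity at rank d, and rationality.

If the rank is less than d and d < m, adding any multiple of a rank-one form stays in the variety
(`singular_of_rank_lt`). Rank-one forms span all symmetric forms, so equations of the variety vanish
to second order at the point. As the variety is a proper subset, its local ring is a proper quotient
of a regular local domain by an ideal inside the square of the maximal ideal, and such a quotient is
never regular (`not_isRegularLocalRing_of_surjective`). Thus the nonsingular locus is the rank d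
locus when k ≥ 1, and everything when k = 0. -/

namespace FunctionSpace

/-! ### Calculus of regular functions -/

section RegAt

variable {X : FunctionSpace} {x : X.Pt}

theorem RegAt.of_eq {f g : X.Pt → ℂ} (h : X.RegAt x f) (he : ∀ y, f y = g y) : X.RegAt x g :=
  (funext he : f = g) ▸ h

theorem RegAt.sum {ι : Type*} (s : Finset ι) {f : ι → X.Pt → ℂ}
    (h : ∀ i ∈ s, X.RegAt x (f i)) : X.RegAt x (fun y => ∑ i ∈ s, f i y) := by
  classical
  induction s using Finset.induction_on with
  | empty => simpa using X.const x 0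
  | insert a s ha ih =>
    have h1 := X.add (h a (by simp)) (ih fun i hi => h i (by simp [hi]))
    exact h1.of_eq fun y => (Finset.sum_insert (f := fun i => f i y) ha).symm

theorem RegAt.prod {ι : Type*} (s : Finset ι) {f : ι → X.Pt → ℂ}
    (h : ∀ i ∈ s, X.RegAt x (f i)) : X.RegAt x (fun y => ∏ i ∈ s, f i y) := by
  classical
  induction s using Finset.induction_on with
  | empty => simpa using X.const x 1
  | insert a s ha ih =>
    have h1 := X.mul (h a (by simp)) (ih fun i hi => h i (by simp [hi]))
    exact h1.of_eq fun y => (Finset.prod_insert (f := fun i => f i y) ha).symm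

theorem RegAt.fun_add {f g : X.Pt → ℂ} (hf : X.RegAt x f) (hg : X.RegAt x g) :
    X.RegAt x (fun y => f y + g y) := X.add hf hg

theorem RegAt.fun_mul {f g : X.Pt → ℂ} (hf : X.RegAt x f) (hg : X.RegAt x g) :
    X.RegAt x (fun y => f y * g y) := X.mul hf hg

theorem RegAt.fun_neg {f : X.Pt → ℂ} (hf : X.RegAt x f) : X.RegAt x (fun y => -f y) := by
  simpa using RegAt.fun_mul (X.const x (-1)) hf

theorem RegAt.fun_sub {f g : X.Pt → ℂ} (hf : X.RegAt x f) (hg : X.RegAt x g) :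
    X.RegAt x (fun y => f y - g y) := by
  simpa only [sub_eq_add_neg] using RegAt.fun_add hf (RegAt.fun_neg hg)

theorem RegAt.fun_inv {f : X.Pt → ℂ} (hf : X.RegAt x f) (h0 : f x ≠ 0) :
    X.RegAt x (fun y => (f y)⁻¹) := X.inv hf h0

theorem RegAt.fun_div {f g : X.Pt → ℂ} (hf : X.RegAt x f) (hg : X.RegAt x g) (h0 : g x ≠ 0) :
    X.RegAt x (fun y => f y / g y) := by
  simpa only [div_eq_mul_inv] using RegAt.fun_mul hf (RegAt.fun_inv hg h0)

theorem RegAt.eval {ι : Type*} (p : MvPolynomial ι ℂ) {f : ι → X.Pt → ℂ}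
    (h : ∀ i, X.RegAt x (f i)) :
    X.RegAt x (fun y => MvPolynomial.eval (fun i => f i y) p) := by
  induction p using MvPolynomial.induction_on with
  | C a => simpa using X.const x a
  | add p q hp hq => simpa using RegAt.fun_add hp hq
  | mul_X p i hp => simpa using RegAt.fun_mul hp (h i)

theorem RegAt.det {ι : Type*} [Fintype ι] [DecidableEq ι] {A : X.Pt → Matrix ι ι ℂ}
    (h : ∀ i j, X.RegAt x (fun y => A y i j)) : X.RegAt x (fun y => (A y).det) := by
  simp only [Matrix.det_apply']
  exact RegAt.sum _ fun s _ => RegAt.fun_mul (X.const x _) (RegAt.prod _ fun i _ => h _ _)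

theorem RegAt.matrix_mul {ι κ l : Type*} [Fintype κ] {A : X.Pt → Matrix ι κ ℂ}
    {B : X.Pt → Matrix κ l ℂ} (hA : ∀ i j, X.RegAt x (fun y => A y i j))
    (hB : ∀ i j, X.RegAt x (fun y => B y i j)) (i : ι) (j : l) :
    X.RegAt x (fun y => (A y * B y) i j) := by
  simp only [Matrix.mul_apply]
  exact RegAt.sum _ fun s _ => RegAt.fun_mul (hA _ _) (hB _ _)

theorem RegAt.adjugate {ι : Type*} [Fintype ι] [DecidableEq ι] {A : X.Pt → Matrix ι ι ℂ}
    (h : ∀ i j, X.RegAt x (fun y => A y i j)) (i j : ι) :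
    X.RegAt x (fun y => (A y).adjugate i j) := by
  simp only [Matrix.adjugate_apply]
  refine RegAt.det fun a b => ?_
  by_cases hab : a = j
  · simpa [Matrix.updateRow_apply, hab] using X.const x _
  · simpa [Matrix.updateRow_apply, hab] using h a b

theorem RegAt.matrix_inv {ι : Type*} [Fintype ι] [DecidableEq ι] {A : X.Pt → Matrix ι ι ℂ}
    (h : ∀ i j, X.RegAt x (fun y => A y i j)) (h0 : (A x).det ≠ 0) (i j : ι) :
    X.RegAt x (fun y => (A y)⁻¹ i j) := by
  simp only [Matrix.inv_def, Ring.inverse_eq_inv', Matrix.smul_apply, smul_eq_mul]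
  exact RegAt.fun_mul (RegAt.fun_inv (RegAt.det h) h0) (RegAt.adjugate h i j)

end RegAt

/-! ### Morphisms at a point -/

/-- `φ` is a morphism at `x`: it is continuous at `x`, and pulls functions regular at `φ x` back to
functions regular at `x`. -/
structure MorphAt (X Y : FunctionSpace) (φ : X.Pt → Y.Pt) (x : X.Pt) : Prop where
  tendsto : Filter.Tendsto φ (𝓝 x) (𝓝 (φ x))
  comp : ∀ g : Y.Pt → ℂ, Y.RegAt (φ x) g → X.RegAt x (g ∘ φ)

variable {X Y Z : FunctionSpace}

theorem isMorphism_iff {φ : X.Pt → Y.Pt} : IsMorphism X Y φ ↔ ∀ x, MorphAt X Y φ x :=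
  ⟨fun h x => ⟨h.continuous.continuousAt, h.comp x⟩,
    fun h => ⟨continuous_iff_continuousAt.2 fun x => (h x).tendsto, fun x => (h x).comp⟩⟩

theorem MorphAt.trans {φ : X.Pt → Y.Pt} {ψ : Y.Pt → Z.Pt} {x : X.Pt}
    (h' : MorphAt Y Z ψ (φ x)) (h : MorphAt X Y φ x) : MorphAt X Z (fun y => ψ (φ y)) x :=
  ⟨h'.tendsto.comp h.tendsto, fun g hg => h.comp _ (h'.comp g hg)⟩

theorem MorphAt.congr {φ ψ : X.Pt → Y.Pt} {x : X.Pt} (h : MorphAt X Y φ x)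
    (he : φ =ᶠ[𝓝 x] ψ) : MorphAt X Y ψ x := by
  have hx : φ x = ψ x := he.self_of_nhds
  refine ⟨hx ▸ h.tendsto.congr' he, fun g hg => X.congr (he.fun_comp g) (h.comp g (hx ▸ hg))⟩

theorem MorphAt.regAt {φ : X.Pt → Y.Pt} {x : X.Pt} (h : MorphAt X Y φ x) {g : Y.Pt → ℂ}
    (hg : Y.RegAt (φ x) g) : X.RegAt x (fun y => g (φ y)) := h.comp g hg

/-! ### Maps to and from the basic constructions -/

/-- Polynomials in regular functions are regular, and nonvanishing of a regular function is an open
condition by the axiom `ne_zero`. So regular coordinates already force continuity for the topology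
generated by the sets where a polynomial is nonzero. -/
theorem morphAt_affineSpace {ι : Type} {f : X.Pt → (affineSpace ι).Pt} {x : X.Pt}
    (h : ∀ i, X.RegAt x (fun y => f y i)) : MorphAt X (affineSpace ι) f x := by
  have key : ∀ p : MvPolynomial ι ℂ, X.RegAt x (fun y => MvPolynomial.eval (f y) p) :=
    fun p => RegAt.eval p h
  have ht : Filter.Tendsto f (𝓝 x) (𝓝 (f x)) := by
    refine TopologicalSpace.tendsto_nhds_generateFrom_iff.2 ?_
    rintro _ ⟨p, rfl⟩ hp
    exact X.ne_zero (key p) hp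
  refine ⟨ht, ?_⟩
  rintro g ⟨a, b, hb, hg⟩
  exact X.congr (Filter.EventuallyEq.symm (ht.eventually hg)) (RegAt.fun_div (key a) (key b) hb)

theorem regAt_affineSpace_eval {ι : Type} (p : MvPolynomial ι ℂ) (x : (affineSpace ι).Pt) :
    (affineSpace ι).RegAt x (fun y => MvPolynomial.eval y p) :=
  ⟨p, 1, by simp, Filter.Eventually.of_forall fun y => by simp⟩

theorem regAt_affineSpace_coord {ι : Type} (i : ι) (x : (affineSpace ι).Pt) :
    (affineSpace ι).RegAt x (fun y => y i) := by
  exact (regAt_affineSpace_eval (MvPolynomial.X i) x).of_eq fun y => MvPolynomial.eval_X i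

theorem morphAt_induced_dom {S : Type} (j : S → X.Pt) (s : S) :
    MorphAt (X.induced j) X j s := by
  let _ := TopologicalSpace.induced j X.top
  have hj : Continuous j := continuous_induced_dom
  exact ⟨hj.continuousAt, fun g hg => ⟨g, hg, Filter.EventuallyEq.rfl⟩⟩

theorem morphAt_induced {S : Type} {j : S → X.Pt} {f : Z.Pt → S} {z : Z.Pt}
    (h : MorphAt Z X (fun y => j (f y)) z) : MorphAt Z (X.induced j) f z := by
  have ht : Filter.Tendsto f (𝓝 z) (@nhds S (TopologicalSpace.induced j X.top) (f z)) := by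
    rw [nhds_induced, Filter.tendsto_comap_iff]
    exact h.tendsto
  refine ⟨ht, ?_⟩
  rintro g ⟨g', hg', hgg⟩
  exact Z.congr (Filter.EventuallyEq.symm (ht.eventually hgg)) (h.comp g' hg')

theorem morphAt_val (S : Set X.Pt) (s : (X.restrict S).Pt) :
    MorphAt (X.restrict S) X (fun y => y.1) s := morphAt_induced_dom Subtype.val s

theorem morphAt_restrict {S : Set X.Pt} {f : Z.Pt → (X.restrict S).Pt} {z : Z.Pt}
    (h : MorphAt Z X (fun y => (f y).1) z) : MorphAt Z (X.restrict S) f z := morphAt_induced h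

theorem morphAt_quotient_mk {Q : Type} (q : X.Pt → Q) (hq : Function.Surjective q) (x : X.Pt) :
    MorphAt X (X.quotient q hq) q x := by
  let _ := TopologicalSpace.coinduced q X.top
  have hc : Continuous q := continuous_coinduced_rng
  exact ⟨hc.continuousAt, fun g hg => Filter.Eventually.self_of_nhds hg x rfl⟩

/-- Regularity of a function on a quotient can be tested on the source. -/
theorem regAt_quotient {Q : Type} {q : X.Pt → Q} {hq : Function.Surjective q}
    {U : Set (X.quotient q hq).Pt} (hU : IsOpen U) {f : (X.quotient q hq).Pt → ℂ}
    (h : ∀ y : X.Pt, q y ∈ U → X.RegAt y (fun z => f (q z))) {x : (X.quotient q hq).Pt}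
    (hx : x ∈ U) : (X.quotient q hq).RegAt x f := by
  refine Filter.mem_of_superset (hU.mem_nhds hx) ?_
  rintro _ hx' y rfl
  exact h y hx'

theorem isOpen_quotient {Q : Type} {q : X.Pt → Q} {hq : Function.Surjective q}
    {U : Set (X.quotient q hq).Pt} (h : ∀ y : X.Pt, q y ∈ U → ∀ᶠ z in 𝓝 y, q z ∈ U) :
    IsOpen U := by
  refine isOpen_coinduced.2 (isOpen_iff_mem_nhds.2 fun y hy => h y hy)

/-! ### Products -/

theorem morphAt_fst (p : (X.prod Y).Pt) : MorphAt (X.prod Y) X (fun q => q.1) p := by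
  have key : ∀ (U : Set X.Pt) (f : X.Pt → ℂ), (∀ x ∈ U, X.RegAt x f) →
      (fun q : X.Pt × Y.Pt => f q.1) ∈ tensorFunctions X Y U Set.univ := fun U f hf =>
    Algebra.subset_adjoin (Or.inl ⟨f, hf, rfl⟩)
  refine ⟨?_, fun g hg => ?_⟩
  · intro s hs
    obtain ⟨U, hUs, hU, hp⟩ := mem_nhds_iff.1 hs
    refine Filter.mem_map.2 ?_
    exact Filter.mem_of_superset (prod_eventually (X := X) (Y := Y) hU isOpen_univ (one_mem _)
      hp trivial one_ne_zero) fun q hq => hUs hq.1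
  · obtain ⟨U, hg', hU, hp⟩ := eventually_nhds_iff.1 (X.eventually hg)
    exact ⟨U, Set.univ, fun q => g q.1, 1, hU, isOpen_univ, hp, trivial, key U g hg', one_mem _,
      one_ne_zero, Filter.Eventually.of_forall fun q => (div_one _).symm⟩

theorem morphAt_snd (p : (X.prod Y).Pt) : MorphAt (X.prod Y) Y (fun q => q.2) p := by
  have key : ∀ (V : Set Y.Pt) (f : Y.Pt → ℂ), (∀ x ∈ V, Y.RegAt x f) →
      (fun q : X.Pt × Y.Pt => f q.2) ∈ tensorFunctions X Y Set.univ V := fun U f hf =>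
    Algebra.subset_adjoin (Or.inr ⟨f, hf, rfl⟩)
  refine ⟨?_, fun g hg => ?_⟩
  · intro s hs
    obtain ⟨U, hUs, hU, hp⟩ := mem_nhds_iff.1 hs
    refine Filter.mem_map.2 ?_
    exact Filter.mem_of_superset (prod_eventually (X := X) (Y := Y) isOpen_univ hU (one_mem _)
      trivial hp one_ne_zero) fun q hq => hUs hq.2.1
  · obtain ⟨U, hg', hU, hp⟩ := eventually_nhds_iff.1 (Y.eventually hg)
    exact ⟨Set.univ, U, fun q => g q.2, 1, isOpen_univ, hU, trivial, hp, key U g hg', one_mem _,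
      one_ne_zero, Filter.Eventually.of_forall fun q => (div_one _).symm⟩

/-- The universal property of the product. Functions in `tensorFunctions` pull back to regular
functions by induction on the generated subalgebra, and these define both the topology and the
regular functions of the product. -/
theorem morphAt_prod {φ : Z.Pt → (X.prod Y).Pt} {z : Z.Pt}
    (h1 : MorphAt Z X (fun y => (φ y).1) z) (h2 : MorphAt Z Y (fun y => (φ y).2) z) :
    MorphAt Z (X.prod Y) φ z := by
  have key : ∀ (U : Set X.Pt) (V : Set Y.Pt) (h : X.Pt × Y.Pt → ℂ),
      (φ z).1 ∈ U → (φ z).2 ∈ V → h ∈ tensorFunctions X Y U V →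
      Z.RegAt z (fun y => h (φ y)) := by
    intro U V h hU hV hh
    induction hh using Algebra.adjoin_induction with
    | mem h hh =>
      rcases hh with ⟨f, hf, rfl⟩ | ⟨f, hf, rfl⟩
      · exact h1.comp f (hf _ hU)
      · exact h2.comp f (hf _ hV)
    | algebraMap r => exact Z.const z r
    | add f g _ _ hf hg => exact Z.add hf hg
    | mul f g _ _ hf hg => exact Z.mul hf hg
  have ht : Filter.Tendsto φ (𝓝 z) (𝓝 (φ z)) := by
    refine TopologicalSpace.tendsto_nhds_generateFrom_iff.2 ?_
    rintro _ ⟨U, V, h, hU, hV, hh, rfl⟩ ⟨hp1, hp2, hp3⟩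
    filter_upwards [h1.tendsto (hU.mem_nhds hp1), h2.tendsto (hV.mem_nhds hp2),
      Z.ne_zero (key U V h hp1 hp2 hh) hp3] with y e1 e2 e3
    exact ⟨e1, e2, e3⟩
  refine ⟨ht, ?_⟩
  rintro g ⟨U, V, a, b, hU, hV, hp1, hp2, ha, hb, hb0, hg⟩
  exact Z.congr (Filter.EventuallyEq.symm (ht.eventually hg))
    (RegAt.fun_div (key U V a hp1 hp2 ha) (key U V b hp1 hp2 hb) hb0)

/-! ### Projective space -/

theorem morphAt_projectiveSpace {ι : Type} {φ : X.Pt → (projectiveSpace ι).Pt} {x : X.Pt}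
    (f : X.Pt → ι → ℂ) (hf : ∀ i, X.RegAt x (fun y => f y i))
    (h : ∀ᶠ y in 𝓝 x, ∃ h : f y ≠ 0, φ y = Projectivization.mk ℂ (f y) h) :
    MorphAt X (projectiveSpace ι) φ x := by
  classical
  obtain ⟨hx, -⟩ := h.self_of_nhds
  -- The value `f x` is a default away from the neighbourhood where `f` is nonzero. It makes the
  -- lift to nonzero vectors total and does not affect germs at `x`.
  let f' : X.Pt → {v : ι → ℂ // v ≠ 0} := fun y => if h : f y ≠ 0 then ⟨f y, h⟩ else ⟨f x, hx⟩
  have h1 : MorphAt X ((affineSpace ι).induced (Subtype.val : {v : ι → ℂ // v ≠ 0} → ι → ℂ))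
      f' x := by
    refine morphAt_induced ((morphAt_affineSpace (ι := ι) hf).congr ?_)
    filter_upwards [h] with y ⟨hy, _⟩
    exact (congrArg Subtype.val (dif_pos hy : f' y = ⟨f y, hy⟩)).symm
  refine MorphAt.congr ((morphAt_quotient_mk _ _ _).trans h1) ?_
  filter_upwards [h] with y ⟨hy, hφ⟩
  exact (congrArg (Projectivization.mk' ℂ) (dif_pos hy : f' y = ⟨f y, hy⟩)).trans hφ.symm

/-- The representative `rep` is an arbitrary choice, so it carries no regularity. Comparing it with
a known vector up to a scalar is enough for homogeneous conditions and for ratios of coordinates. -/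
theorem rep_mk_eq {ι : Type} (v : ι → ℂ) (hv : v ≠ 0) :
    ∃ a : ℂ, a ≠ 0 ∧ (Projectivization.mk ℂ v hv).rep = a • v := by
  obtain ⟨a, ha⟩ := Projectivization.exists_smul_eq_mk_rep ℂ v hv
  exact ⟨a, a.ne_zero, ha.symm⟩

theorem isOpen_coord_ne_zero {ι : Type} (i : ι) :
    IsOpen {x : (projectiveSpace ι).Pt | Projectivization.rep x i ≠ 0} := by
  refine isOpen_quotient fun y hy => ?_
  have h1 := (regAt_affineSpace_coord i y.1)
  have h2 := (morphAt_induced_dom (X := affineSpace ι)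
    (Subtype.val : {v : ι → ℂ // v ≠ 0} → ι → ℂ) y).regAt h1
  have h3 : ∀ z : {v : ι → ℂ // v ≠ 0},
      (Projectivization.mk' ℂ z).rep i ≠ 0 ↔ z.1 i ≠ 0 := by
    intro z
    obtain ⟨a, ha, he⟩ := rep_mk_eq z.1 z.2
    simp [Projectivization.mk'_eq_mk, he, ha]
  filter_upwards [FunctionSpace.ne_zero _ h2 ((h3 y).1 hy)] with z hz
  exact (h3 z).2 hz

theorem regAt_coord_div {ι : Type} (i j : ι) (x : (projectiveSpace ι).Pt)
    (hx : Projectivization.rep x i ≠ 0) :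
    (projectiveSpace ι).RegAt x
      (fun y => Projectivization.rep y j / Projectivization.rep y i) := by
  refine regAt_quotient (isOpen_coord_ne_zero i) (fun y hy => ?_) hx
  have h1 := fun i => (morphAt_induced_dom (X := affineSpace ι)
    (Subtype.val : {v : ι → ℂ // v ≠ 0} → ι → ℂ) y).regAt (regAt_affineSpace_coord i y.1)
  have h3 : ∀ z : {v : ι → ℂ // v ≠ 0}, ∀ j, (Projectivization.mk' ℂ z).rep j /
      (Projectivization.mk' ℂ z).rep i = z.1 j / z.1 i := by
    intro z j
    obtain ⟨a, ha, he⟩ := rep_mk_eq z.1 z.2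
    simp [Projectivization.mk'_eq_mk, he, mul_div_mul_left _ _ ha]
  have hyi : y.1 i ≠ 0 := by
    obtain ⟨a, ha, he⟩ := rep_mk_eq y.1 y.2
    have hy' : (Projectivization.mk ℂ y.1 y.2).rep i ≠ 0 := hy
    rw [he] at hy'
    exact right_ne_zero_of_mul hy'
  exact (RegAt.fun_div (h1 j) (h1 i) hyi).of_eq fun z => (h3 z j).symm

end FunctionSpace

namespace FunctionSpace

variable {X Y Z : FunctionSpace}

/-! ### Isomorphisms of restrictions -/

theorem isIso_restrict {S : Set X.Pt} {T : Set Y.Pt} (φ : X.Pt → Y.Pt) (ψ : Y.Pt → X.Pt)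
    (hφ : ∀ x ∈ S, φ x ∈ T ∧ MorphAt X Y φ x ∧ ψ (φ x) = x)
    (hψ : ∀ y ∈ T, ψ y ∈ S ∧ MorphAt Y X ψ y ∧ φ (ψ y) = y) :
    IsIso (X.restrict S) (Y.restrict T) (fun x => ⟨φ x.1, (hφ x.1 x.2).1⟩) := by
  refine ⟨isMorphism_iff.2 fun x => ?_, fun y => ⟨ψ y.1, (hψ y.1 y.2).1⟩,
    isMorphism_iff.2 fun y => ?_, fun x => ?_, fun y => ?_⟩
  · exact morphAt_restrict (MorphAt.trans (hφ x.1 x.2).2.1 (morphAt_val S x))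
  · exact morphAt_restrict (MorphAt.trans (hψ y.1 y.2).2.1 (morphAt_val T y))
  · exact Subtype.ext (hφ x.1 x.2).2.2
  · exact Subtype.ext (hψ y.1 y.2).2.2

/-! ### Local isomorphisms -/

/-- A neighbourhood of `x` in `X` is isomorphic to a neighbourhood of `y` in `Y`, with `x`
corresponding to `y`. -/
def LocIso (X Y : FunctionSpace) (x : X.Pt) (y : Y.Pt) : Prop :=
  ∃ (φ : X.Pt → Y.Pt) (ψ : Y.Pt → X.Pt), φ x = y ∧ ψ y = x ∧
    (∀ᶠ z in 𝓝 x, MorphAt X Y φ z ∧ ψ (φ z) = z) ∧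
    (∀ᶠ w in 𝓝 y, MorphAt Y X ψ w ∧ φ (ψ w) = w)

theorem LocIso.symm {x : X.Pt} {y : Y.Pt} (h : LocIso X Y x y) : LocIso Y X y x := by
  obtain ⟨φ, ψ, h1, h2, h3, h4⟩ := h
  exact ⟨ψ, φ, h2, h1, h4, h3⟩

theorem LocIso.trans {x : X.Pt} {y : Y.Pt} {z : Z.Pt} (h : LocIso X Y x y)
    (h' : LocIso Y Z y z) : LocIso X Z x z := by
  obtain ⟨φ, ψ, rfl, h2, h3, h4⟩ := h
  obtain ⟨φ', ψ', rfl, h2', h3', h4'⟩ := h'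
  refine ⟨fun x => φ' (φ x), fun z => ψ (ψ' z), rfl, (congrArg ψ h2').trans h2, ?_, ?_⟩
  · filter_upwards [h3, h3.self_of_nhds.1.tendsto.eventually h3'] with w a b
    exact ⟨b.1.trans a.1, by rw [b.2, a.2]⟩
  · have ht := h4'.self_of_nhds.1.tendsto
    rw [h2'] at ht
    filter_upwards [h4', ht.eventually h4] with w a b
    exact ⟨b.1.trans a.1, by rw [b.2, a.2]⟩

theorem LocIso.prod {X' Y' : FunctionSpace} {x : X.Pt} {y : Y.Pt} {x' : X'.Pt} {y' : Y'.Pt}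
    (h : LocIso X Y x y) (h' : LocIso X' Y' x' y') :
    LocIso (X.prod X') (Y.prod Y') (x, x') (y, y') := by
  obtain ⟨φ, ψ, rfl, h2, h3, h4⟩ := h
  obtain ⟨φ', ψ', rfl, h2', h3', h4'⟩ := h'
  refine ⟨fun p => (φ p.1, φ' p.2), fun q => (ψ q.1, ψ' q.2), rfl, Prod.ext h2 h2', ?_, ?_⟩
  · filter_upwards [(morphAt_fst (X := X) (Y := X') (x, x')).tendsto.eventually h3,
      (morphAt_snd (X := X) (Y := X') (x, x')).tendsto.eventually h3'] with w a b
    exact ⟨morphAt_prod (a.1.trans (morphAt_fst w)) (b.1.trans (morphAt_snd w)),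
      Prod.ext a.2 b.2⟩
  · filter_upwards [(morphAt_fst (X := Y) (Y := Y') (φ x, φ' x')).tendsto.eventually h4,
      (morphAt_snd (X := Y) (Y := Y') (φ x, φ' x')).tendsto.eventually h4'] with w a b
    exact ⟨morphAt_prod (a.1.trans (morphAt_fst w)) (b.1.trans (morphAt_snd w)),
      Prod.ext a.2 b.2⟩

theorem locIso_restrict {S : Set X.Pt} {T : Set Y.Pt} (φ : X.Pt → Y.Pt) (ψ : Y.Pt → X.Pt)
    {x : X.Pt} {y : Y.Pt} (hxS : x ∈ S) (hyT : y ∈ T) (hxy : φ x = y) (hyx : ψ y = x)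
    (hφ : ∀ᶠ z in 𝓝 x, MorphAt X Y φ z ∧ ψ (φ z) = z ∧ (z ∈ S → φ z ∈ T))
    (hψ : ∀ᶠ w in 𝓝 y, MorphAt Y X ψ w ∧ φ (ψ w) = w ∧ (w ∈ T → ψ w ∈ S)) :
    LocIso (X.restrict S) (Y.restrict T) ⟨x, hxS⟩ ⟨y, hyT⟩ := by
  classical
  -- `LocIso` asks for total maps. The base points serve as values where `φ` leaves `T` or `ψ`
  -- leaves `S`, which does not happen near `x` and `y`.
  let φ' : (X.restrict S).Pt → (Y.restrict T).Pt := fun z =>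
    if h : φ z.1 ∈ T then ⟨φ z.1, h⟩ else ⟨y, hyT⟩
  let ψ' : (Y.restrict T).Pt → (X.restrict S).Pt := fun z =>
    if h : ψ z.1 ∈ S then ⟨ψ z.1, h⟩ else ⟨x, hxS⟩
  have eφ : ∀ z, φ z.1 ∈ T → (φ' z).1 = φ z.1 := fun z h =>
    congrArg Subtype.val (dif_pos h : φ' z = ⟨φ z.1, h⟩)
  have eψ : ∀ z, ψ z.1 ∈ S → (ψ' z).1 = ψ z.1 := fun z h =>
    congrArg Subtype.val (dif_pos h : ψ' z = ⟨ψ z.1, h⟩)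
  have tS := (morphAt_val S ⟨x, hxS⟩).tendsto
  have tT := (morphAt_val T ⟨y, hyT⟩).tendsto
  refine ⟨φ', ψ', Subtype.ext ((eφ _ (hxy.symm ▸ hyT)).trans hxy),
    Subtype.ext ((eψ _ (hyx.symm ▸ hxS)).trans hyx), ?_, ?_⟩
  · filter_upwards [tS.eventually hφ, eventually_eventually_nhds.2 (tS.eventually hφ)]
      with z h1 h2
    have h3 := h1.2.2 z.2
    refine ⟨morphAt_restrict ((h1.1.trans (morphAt_val S z)).congr ?_), Subtype.ext ?_⟩
    · filter_upwards [h2] with w hw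
      exact (eφ w (hw.2.2 w.2)).symm
    · rw [eψ _ (by rw [eφ _ h3, h1.2.1]; exact z.2), eφ _ h3, h1.2.1]
  · filter_upwards [tT.eventually hψ, eventually_eventually_nhds.2 (tT.eventually hψ)]
      with z h1 h2
    have h3 := h1.2.2 z.2
    refine ⟨morphAt_restrict ((h1.1.trans (morphAt_val T z)).congr ?_), Subtype.ext ?_⟩
    · filter_upwards [h2] with w hw
      exact (eψ w (hw.2.2 w.2)).symm
    · rw [eφ _ (by rw [eψ _ h3, h1.2.1]; exact z.2), eψ _ h3, h1.2.1]

theorem LocIso.exists_isIso {x : X.Pt} {y : Y.Pt} (h : LocIso X Y x y) :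
    ∃ (U : Set X.Pt) (V : Set Y.Pt), IsOpen U ∧ x ∈ U ∧ IsOpen V ∧ y ∈ V ∧
      ∃ φ : (X.restrict U).Pt → (Y.restrict V).Pt, IsIso (X.restrict U) (Y.restrict V) φ := by
  obtain ⟨φ, ψ, rfl, h2, h3, h4⟩ := h
  obtain ⟨U, hU, hUo, hxU⟩ := eventually_nhds_iff.1 h3
  obtain ⟨V, hV, hVo, hyV⟩ := eventually_nhds_iff.1 h4
  -- `U` and `V` need not correspond to each other under `φ` and `ψ`, but U ∩ φ⁻¹(V) and V ∩ ψ⁻¹(U)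
  -- do. They are open although the maps are continuous only at the points of `U` and `V`.
  have hUV : IsOpen (U ∩ φ ⁻¹' V) := ContinuousOn.isOpen_inter_preimage
    (fun z hz => (ContinuousAt.continuousWithinAt (hU z hz).1.tendsto)) hUo hVo
  have hVU : IsOpen (V ∩ ψ ⁻¹' U) := ContinuousOn.isOpen_inter_preimage
    (fun z hz => (ContinuousAt.continuousWithinAt (hV z hz).1.tendsto)) hVo hUo
  refine ⟨_, _, hUV, ⟨hxU, hyV⟩, hVU, ⟨hyV, ?_⟩, _, isIso_restrict φ ψ ?_ ?_⟩
  · change ψ (φ x) ∈ U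
    rwa [h2]
  · rintro z ⟨hz1, hz2⟩
    refine ⟨⟨hz2, ?_⟩, hU z hz1⟩
    change ψ (φ z) ∈ U
    rwa [(hU z hz1).2]
  · rintro z ⟨hz1, hz2⟩
    refine ⟨⟨hz2, ?_⟩, hV z hz1⟩
    change φ (ψ z) ∈ V
    rwa [(hV z hz1).2]

/-! ### Local rings -/

/-- The pullback of germs along a map which is a morphism at `x`. -/
noncomputable def MorphAt.pullback {φ : X.Pt → Y.Pt} {x : X.Pt} {y : Y.Pt}
    (h : MorphAt X Y φ x) (hxy : φ x = y) : Y.localRing y →+* X.localRing x where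
  toFun s := ⟨s.1.compTendsto φ (hxy ▸ h.tendsto), by
    obtain ⟨_, f, hf, rfl⟩ := s
    exact ⟨f ∘ φ, h.comp f (hxy ▸ hf), rfl⟩⟩
  map_one' := rfl
  map_mul' := by
    rintro ⟨_, f, hf, rfl⟩ ⟨_, g, hg, rfl⟩
    rfl
  map_zero' := rfl
  map_add' := by
    rintro ⟨_, f, hf, rfl⟩ ⟨_, g, hg, rfl⟩
    rfl

/-- The germ of a regular function. -/
def germ (X : FunctionSpace) (x : X.Pt) (f : X.Pt → ℂ) (hf : X.RegAt x f) : X.localRing x :=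
  ⟨(f : Filter.Germ (𝓝 x) ℂ), f, hf, rfl⟩

theorem exists_germ {x : X.Pt} (s : X.localRing x) : ∃ f hf, s = X.germ x f hf := by
  obtain ⟨_, f, hf, rfl⟩ := s
  exact ⟨f, hf, rfl⟩

theorem germ_eq_iff {x : X.Pt} {f g : X.Pt → ℂ} {hf : X.RegAt x f} {hg : X.RegAt x g} :
    X.germ x f hf = X.germ x g hg ↔ f =ᶠ[𝓝 x] g :=
  Subtype.ext_iff.trans Filter.Germ.coe_eq

theorem MorphAt.pullback_germ {φ : X.Pt → Y.Pt} {x : X.Pt} {y : Y.Pt}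
    (h : MorphAt X Y φ x) (hxy : φ x = y) (f : Y.Pt → ℂ) (hf : Y.RegAt y f) :
    h.pullback hxy (Y.germ y f hf) = X.germ x (f ∘ φ) (h.comp f (hxy ▸ hf)) := rfl

/-- A local isomorphism induces an isomorphism of local rings. -/
theorem LocIso.nonempty_ringEquiv {x : X.Pt} {y : Y.Pt} (h : LocIso X Y x y) :
    Nonempty (X.localRing x ≃+* Y.localRing y) := by
  obtain ⟨φ, ψ, h1, h2, h3, h4⟩ := h
  refine ⟨RingEquiv.ofRingHom (h4.self_of_nhds.1.pullback h2) (h3.self_of_nhds.1.pullback h1)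
    (RingHom.ext fun s => ?_) (RingHom.ext fun s => ?_)⟩
  · obtain ⟨f, hf, rfl⟩ := exists_germ s
    simp only [RingHom.comp_apply, MorphAt.pullback_germ, RingHom.id_apply, germ_eq_iff]
    filter_upwards [h4] with w hw
    simp [hw.2]
  · obtain ⟨f, hf, rfl⟩ := exists_germ s
    simp only [RingHom.comp_apply, MorphAt.pullback_germ, RingHom.id_apply, germ_eq_iff]
    filter_upwards [h3] with w hw
    simp [hw.2]

theorem LocIso.nonsingular {x : X.Pt} {y : Y.Pt} (h : LocIso X Y x y) (hy : Y.Nonsingular y) :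
    X.Nonsingular x := by
  obtain ⟨e⟩ := h.nonempty_ringEquiv
  have : IsRegularLocalRing (Y.localRing y) := hy
  exact IsRegularLocalRing.of_ringEquiv e.symm

/-- Regular functions on a subset are by definition local restrictions from the ambient space. This
presents the local ring of a subset as a quotient of the ambient local ring. -/
theorem restrict_pullback_surjective (S : Set X.Pt) (s : (X.restrict S).Pt) :
    Function.Surjective ((morphAt_val S s).pullback rfl) := by
  intro t
  obtain ⟨f, hf, rfl⟩ := exists_germ t
  obtain ⟨g, hg, hfg⟩ := hf
  exact ⟨X.germ s.1 g hg, Subtype.ext (Filter.Germ.coe_eq.2 hfg.symm)⟩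

/-! ### Charts -/

theorem locIso_affineSpace_sum {α β : Type}
    (p : ((affineSpace α).prod (affineSpace β)).Pt) :
    LocIso ((affineSpace α).prod (affineSpace β)) (affineSpace (α ⊕ β)) p
      (Sum.elim p.1 p.2) := by
  refine ⟨fun q => Sum.elim q.1 q.2, fun z => (fun a => z (Sum.inl a), fun b => z (Sum.inr b)),
    rfl, rfl, Filter.Eventually.of_forall fun q => ⟨morphAt_affineSpace ?_, rfl⟩,
    Filter.Eventually.of_forall fun z => ⟨morphAt_prod (morphAt_affineSpace fun i => ?_)
      (morphAt_affineSpace fun i => ?_), ?_⟩⟩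
  · rintro (i | i)
    · exact (morphAt_fst q).regAt (regAt_affineSpace_coord i _)
    · exact (morphAt_snd q).regAt (regAt_affineSpace_coord i _)
  · exact regAt_affineSpace_coord (Sum.inl i) z
  · exact regAt_affineSpace_coord (Sum.inr i) z
  · exact funext fun i => by cases i <;> rfl

/-- The point of projective space with given affine coordinates and `e`-th coordinate `1`. -/
def affineLift {ι : Type} [DecidableEq ι] (e : ι) (a : {j : ι // j ≠ e} → ℂ) : ι → ℂ :=
  fun j => if h : j ≠ e then a ⟨j, h⟩ else 1

theorem affineLift_self {ι : Type} [DecidableEq ι] (e : ι) (a : {j : ι // j ≠ e} → ℂ) :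
    affineLift e a e = 1 := by simp [affineLift]

theorem affineLift_of_ne {ι : Type} [DecidableEq ι] (e : ι) (a : {j : ι // j ≠ e} → ℂ)
    (j : {j : ι // j ≠ e}) : affineLift e a j = a j := by simp [affineLift, j.2]

theorem affineLift_ne_zero {ι : Type} [DecidableEq ι] (e : ι) (a : {j : ι // j ≠ e} → ℂ) :
    affineLift e a ≠ 0 := fun h => by
  have := congrFun h e
  rw [affineLift_self] at this
  exact one_ne_zero this

/-- The affine coordinates of a point of projective space whose `e`-th coordinate is nonzero. -/
noncomputable def affineCoord {ι : Type} (e : ι) (x : ℙ ℂ (ι → ℂ)) : {j : ι // j ≠ e} → ℂ :=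
  fun j => x.rep j / x.rep e

theorem affineLift_affineCoord {ι : Type} [DecidableEq ι] (e : ι) (x : ℙ ℂ (ι → ℂ))
    (hx : x.rep e ≠ 0) : affineLift e (affineCoord e x) = (x.rep e)⁻¹ • x.rep := by
  ext j
  by_cases h : j = e
  · subst h; simp [affineLift, hx]
  · simp [affineLift, h, affineCoord, div_eq_inv_mul]

theorem mk_affineLift_affineCoord {ι : Type} [DecidableEq ι] (e : ι) (x : ℙ ℂ (ι → ℂ))
    (hx : x.rep e ≠ 0) :
    Projectivization.mk ℂ (affineLift e (affineCoord e x)) (affineLift_ne_zero _ _) = x := by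
  conv_rhs => rw [← x.mk_rep]
  rw [Projectivization.mk_eq_mk_iff']
  exact ⟨(x.rep e)⁻¹, (affineLift_affineCoord e x hx).symm⟩

theorem affineCoord_mk {ι : Type} [DecidableEq ι] (e : ι) (a : {j : ι // j ≠ e} → ℂ) :
    affineCoord e (Projectivization.mk ℂ (affineLift e a) (affineLift_ne_zero _ _)) = a := by
  obtain ⟨c, hc, h⟩ := rep_mk_eq (affineLift e a) (affineLift_ne_zero _ _)
  ext j
  simp only [affineCoord, h, Pi.smul_apply, affineLift_self, affineLift_of_ne, smul_eq_mul,
    mul_one, mul_div_cancel_left₀ _ hc]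

theorem rep_mk_affineLift_ne_zero {ι : Type} [DecidableEq ι] (e : ι) (a : {j : ι // j ≠ e} → ℂ) :
    (Projectivization.mk ℂ (affineLift e a) (affineLift_ne_zero _ _)).rep e ≠ 0 := by
  obtain ⟨c, hc, h⟩ := rep_mk_eq (affineLift e a) (affineLift_ne_zero _ _)
  simp [h, affineLift_self, hc]

theorem morphAt_affineCoord {ι : Type} (e : ι) (x : (projectiveSpace ι).Pt)
    (hx : Projectivization.rep x e ≠ 0) :
    MorphAt (projectiveSpace ι) (affineSpace {j : ι // j ≠ e}) (affineCoord e) x :=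
  morphAt_affineSpace fun j => regAt_coord_div e j.1 x hx

theorem morphAt_mk_affineLift {ι : Type} [DecidableEq ι] (e : ι)
    (a : (affineSpace {j : ι // j ≠ e}).Pt) :
    MorphAt (affineSpace {j : ι // j ≠ e}) (projectiveSpace ι)
      (fun a => Projectivization.mk ℂ (affineLift e a) (affineLift_ne_zero _ _)) a := by
  refine morphAt_projectiveSpace (fun a => affineLift e a) (fun i => ?_)
    (Filter.Eventually.of_forall fun a => ⟨affineLift_ne_zero _ _, rfl⟩)
  by_cases h : i = e
  · subst h
    exact (FunctionSpace.const _ a 1).of_eq fun y => (affineLift_self i y).symm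
  · exact (regAt_affineSpace_coord ⟨i, h⟩ a).of_eq fun y => (affineLift_of_ne e y ⟨i, h⟩).symm

theorem locIso_projectiveSpace {ι : Type} (e : ι) (x : (projectiveSpace ι).Pt)
    (hx : Projectivization.rep x e ≠ 0) :
    LocIso (projectiveSpace ι) (affineSpace {j : ι // j ≠ e}) x (affineCoord e x) := by
  classical
  refine ⟨affineCoord e, fun a => Projectivization.mk ℂ (affineLift e a) (affineLift_ne_zero _ _),
    rfl, mk_affineLift_affineCoord e x hx, ?_, Filter.Eventually.of_forall fun a =>
      ⟨morphAt_mk_affineLift e a, affineCoord_mk e a⟩⟩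
  filter_upwards [(isOpen_coord_ne_zero e).mem_nhds hx] with y hy
  exact ⟨morphAt_affineCoord e y hy, mk_affineLift_affineCoord e y hy⟩

theorem exists_rep_ne_zero {ι : Type} (x : ℙ ℂ (ι → ℂ)) : ∃ e, x.rep e ≠ 0 :=
  Function.ne_iff.1 x.rep_nonzero

/-! ### Reindexing coordinates -/

/-- The map of projective spaces which permutes the coordinates. -/
noncomputable def reindex {ι κ : Type} (e : ι ≃ κ) (x : ℙ ℂ (ι → ℂ)) : ℙ ℂ (κ → ℂ) :=
  Projectivization.mk ℂ (x.rep ∘ e.symm) fun h => x.rep_nonzero <| funext fun i => by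
    simpa using congrFun h (e i)

theorem reindex_symm_reindex {ι κ : Type} (e : ι ≃ κ) (x : ℙ ℂ (ι → ℂ)) :
    reindex e.symm (reindex e x) = x := by
  conv_rhs => rw [← x.mk_rep]
  obtain ⟨a, ha, h⟩ := rep_mk_eq (x.rep ∘ e.symm) fun h => x.rep_nonzero <| funext fun i => by
    simpa using congrFun h (e i)
  rw [reindex, Projectivization.mk_eq_mk_iff']
  refine ⟨a, ?_⟩
  rw [reindex, h]
  ext i
  simp

theorem morphAt_reindex {ι κ : Type} (e : ι ≃ κ) (x : (projectiveSpace ι).Pt) :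
    MorphAt (projectiveSpace ι) (projectiveSpace κ) (reindex e) x := by
  obtain ⟨i, hi⟩ := exists_rep_ne_zero x
  refine morphAt_projectiveSpace
    (fun y j => Projectivization.rep y (e.symm j) / Projectivization.rep y i)
    (fun j => regAt_coord_div i _ x hi) ?_
  filter_upwards [(isOpen_coord_ne_zero i).mem_nhds hi] with y hy
  refine ⟨fun h => hy ?_, ?_⟩
  · have := congrFun h (e i)
    rw [Equiv.symm_apply_apply, div_self hy] at this
    exact absurd this one_ne_zero
  · refine Eq.symm ((Projectivization.mk_eq_mk_iff' ℂ _ _ _ _).2 ⟨(Projectivization.rep y i)⁻¹, ?_⟩)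
    ext j
    simp [div_eq_inv_mul]

theorem continuous_reindex {ι κ : Type} (e : ι ≃ κ) :
    @Continuous _ _ (projectiveSpace ι).top (projectiveSpace κ).top (reindex e) :=
  (isMorphism_iff.2 (morphAt_reindex e)).continuous

/-- `IsProjectiveVariety` requires coordinates numbered by `Fin (N + 1)`. Renumbering the finite
index set reduces this to an injective map with closed range into any finite-dimensional projective
space. -/
theorem isProjectiveVariety_induced {ι S : Type} [Fintype ι] [Nonempty ι]
    (j : S → (projectiveSpace ι).Pt) (hj : Function.Injective j) (hc : IsClosed (Set.range j))
    (hi : IrreducibleSpace ((projectiveSpace ι).induced j).Pt) :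
    IsProjectiveVariety ((projectiveSpace ι).induced j) := by
  have hcard : 0 < Fintype.card ι := Fintype.card_pos
  let N := Fintype.card ι - 1
  let e : ι ≃ Fin (N + 1) := Fintype.equivFinOfCardEq (by omega)
  let r : (projectiveSpace ι).Pt → (projectiveSpaceN N).Pt := reindex e
  let r' : (projectiveSpaceN N).Pt → (projectiveSpace ι).Pt := reindex e.symm
  have hr : ∀ x, r' (r x) = x := reindex_symm_reindex e
  have hr' : ∀ x, r (r' x) = x := reindex_symm_reindex e.symm
  let ψ : ((projectiveSpaceN N).restrict (r' ⁻¹' Set.range j)).Pt → S := fun z => z.2.choose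
  have hψ : ∀ z, j (ψ z) = r' z.1 := fun z => z.2.choose_spec
  refine ⟨hi, N, r' ⁻¹' Set.range j, hc.preimage (continuous_reindex e.symm),
    fun s => ⟨r (j s), s, (hr _).symm⟩, isMorphism_iff.2 fun s => morphAt_restrict ?_, ψ,
    isMorphism_iff.2 fun z => morphAt_induced ?_, fun s => hj ?_, fun z => Subtype.ext ?_⟩
  · exact (morphAt_reindex e _).trans (morphAt_induced_dom j s)
  · refine ((morphAt_reindex e.symm _).trans (morphAt_val _ z)).congr ?_
    exact Filter.Eventually.of_forall fun z => (hψ z).symm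
  · exact (hψ _).trans (hr _)
  · exact (congrArg r (hψ z)).trans (hr' _)

end FunctionSpace

namespace FunctionSpace

/-! ### Local rings of affine space -/

section Affine

variable {ι : Type}

theorem isOpen_eval_ne_zero (p : MvPolynomial ι ℂ) :
    IsOpen {x : (affineSpace ι).Pt | MvPolynomial.eval x p ≠ 0} :=
  TopologicalSpace.isOpen_generateFrom_of_mem ⟨p, rfl⟩

theorem isTopologicalBasis_affineSpace : TopologicalSpace.IsTopologicalBasis
    (Set.range fun p : MvPolynomial ι ℂ => {x : (affineSpace ι).Pt | MvPolynomial.eval x p ≠ 0}) where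
  exists_subset_inter := by
    rintro _ ⟨p, rfl⟩ _ ⟨q, rfl⟩ x ⟨hp, hq⟩
    refine ⟨_, ⟨p * q, rfl⟩, ?_, ?_⟩
    · change MvPolynomial.eval x (p * q) ≠ 0
      rw [map_mul]
      exact mul_ne_zero hp hq
    · intro y hy
      have hy' : MvPolynomial.eval y (p * q) ≠ 0 := hy
      rw [map_mul] at hy'
      exact ⟨left_ne_zero_of_mul hy', right_ne_zero_of_mul hy'⟩
  sUnion_eq := Set.eq_univ_of_forall fun x =>
    ⟨_, ⟨1, rfl⟩, show MvPolynomial.eval x 1 ≠ 0 by simp⟩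
  eq_generateFrom := rfl

theorem exists_eval_ne_zero_subset {x : (affineSpace ι).Pt} {U : Set (affineSpace ι).Pt}
    (hU : U ∈ 𝓝 x) : ∃ p : MvPolynomial ι ℂ, MvPolynomial.eval x p ≠ 0 ∧
      ∀ y : ι → ℂ, MvPolynomial.eval y p ≠ 0 → y ∈ U := by
  obtain ⟨_, ⟨p, rfl⟩, hx, hp⟩ := isTopologicalBasis_affineSpace.mem_nhds_iff.1 hU
  exact ⟨p, hx, fun y hy => hp hy⟩

theorem exists_eval_ne_zero {p : MvPolynomial ι ℂ} (hp : p ≠ 0) :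
    ∃ x : ι → ℂ, MvPolynomial.eval x p ≠ 0 := by
  by_contra! h
  exact hp (MvPolynomial.funext fun x => by simp [h x])

/-- Two nonempty basic open sets meet because the product of their polynomials is a nonzero
polynomial, hence nonzero at some point of the infinite field ℂ. -/
instance : IrreducibleSpace (affineSpace ι).Pt where
  toNonempty := ⟨(0 : ι → ℂ)⟩
  isPreirreducible_univ := by
    rintro U V hU hV ⟨x, -, hx⟩ ⟨y, -, hy⟩
    obtain ⟨p, hp, hpU⟩ := exists_eval_ne_zero_subset (hU.mem_nhds hx)
    obtain ⟨q, hq, hqV⟩ := exists_eval_ne_zero_subset (hV.mem_nhds hy)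
    have hp0 : p ≠ 0 := by rintro rfl; simp at hp
    have hq0 : q ≠ 0 := by rintro rfl; simp at hq
    obtain ⟨z, hz⟩ := exists_eval_ne_zero (mul_ne_zero hp0 hq0)
    rw [map_mul] at hz
    exact ⟨z, trivial, hpU z (left_ne_zero_of_mul hz), hqV z (right_ne_zero_of_mul hz)⟩

/-- Identity principle: if p vanishes where q does not, then pq vanishes everywhere, so pq = 0 and p
= 0. -/
theorem eval_eventuallyEq_zero_iff {p : MvPolynomial ι ℂ} {x : (affineSpace ι).Pt} :
    (∀ᶠ y : (affineSpace ι).Pt in 𝓝 x, MvPolynomial.eval y p = 0) ↔ p = 0 := by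
  refine ⟨fun h => ?_, fun h => Filter.Eventually.of_forall fun y => by simp [h]⟩
  obtain ⟨q, hq, hqU⟩ := exists_eval_ne_zero_subset (ι := ι) (x := x) h
  have hq0 : q ≠ 0 := by rintro rfl; simp at hq
  have : p * q = 0 := by
    by_contra h0
    obtain ⟨z, hz⟩ := exists_eval_ne_zero h0
    rw [map_mul] at hz
    exact left_ne_zero_of_mul hz (hqU z (right_ne_zero_of_mul hz))
  exact (mul_eq_zero.1 this).resolve_right hq0

/-- The maximal ideal of a point of affine space. -/
noncomputable def pointIdeal (a : (affineSpace ι).Pt) : Ideal (MvPolynomial ι ℂ) :=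
  RingHom.ker (MvPolynomial.eval a)

instance (a : (affineSpace ι).Pt) : (pointIdeal a).IsPrime := RingHom.ker_isPrime _

theorem mem_pointIdeal {a : (affineSpace ι).Pt} {p : MvPolynomial ι ℂ} :
    p ∈ pointIdeal a ↔ MvPolynomial.eval a p = 0 := Iff.rfl

/-- The germ of a polynomial. -/
noncomputable def polyGerm (a : (affineSpace ι).Pt) :
    MvPolynomial ι ℂ →+* (affineSpace ι).localRing a where
  toFun p := germ _ a (fun y => MvPolynomial.eval y p) (regAt_affineSpace_eval p a)
  map_one' := Subtype.ext (Filter.Germ.coe_eq.2 (Filter.Eventually.of_forall fun y => by simp))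
  map_zero' := Subtype.ext (Filter.Germ.coe_eq.2 (Filter.Eventually.of_forall fun y => by simp))
  map_mul' p q := Subtype.ext (Filter.Germ.coe_eq.2 (Filter.Eventually.of_forall fun y => by simp))
  map_add' p q := Subtype.ext (Filter.Germ.coe_eq.2 (Filter.Eventually.of_forall fun y => by simp))

theorem polyGerm_injective (a : (affineSpace ι).Pt) : Function.Injective (polyGerm a) := by
  refine (injective_iff_map_eq_zero _).2 fun p hp => ?_
  exact eval_eventuallyEq_zero_iff.1 (Filter.Germ.coe_eq.1 (congrArg Subtype.val hp))

theorem isUnit_germ {X : FunctionSpace} {x : X.Pt} {f : X.Pt → ℂ} (hf : X.RegAt x f)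
    (h0 : f x ≠ 0) : IsUnit (X.germ x f hf) := by
  refine IsUnit.of_mul_eq_one (X.germ x f⁻¹ (X.inv hf h0)) ?_
  refine (germ_eq_iff (hf := X.mul hf (X.inv hf h0)) (hg := X.const x 1)).2 ?_
  filter_upwards [X.ne_zero hf h0] with y hy
  simp [hy]

theorem exists_polyGerm_mul_eq {a : (affineSpace ι).Pt} (s : (affineSpace ι).localRing a) :
    ∃ p q : MvPolynomial ι ℂ, MvPolynomial.eval a q ≠ 0 ∧ s * polyGerm a q = polyGerm a p := by
  obtain ⟨f, hf, rfl⟩ := exists_germ s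
  obtain ⟨p, q, hq, hfe⟩ := id hf
  refine ⟨p, q, hq, Subtype.ext (Filter.Germ.coe_eq.2 ?_)⟩
  filter_upwards [hfe, (isOpen_eval_ne_zero q).mem_nhds hq] with y h1 h2
  have h2' : MvPolynomial.eval y q ≠ 0 := h2
  have h1' : f y = MvPolynomial.eval y p / MvPolynomial.eval y q := h1
  change f y * MvPolynomial.eval y q = MvPolynomial.eval y p
  rw [h1', div_mul_cancel₀ _ h2']

/-- Germs are fractions of polynomials by definition, and a polynomial is determined by its germ.
The regularity of polynomial rings over a field thus passes to `affineSpace`. -/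
theorem isLocalization_localRing (a : (affineSpace ι).Pt) :
    letI := (polyGerm a).toAlgebra
    IsLocalization.AtPrime ((affineSpace ι).localRing a) (pointIdeal a) := by
  let _ := (polyGerm a).toAlgebra
  refine (isLocalization_iff _ _).2 ⟨?_, ?_, ?_⟩
  · rintro ⟨p, hp⟩
    exact isUnit_germ (regAt_affineSpace_eval p a) hp
  · intro s
    obtain ⟨p, q, hq, h⟩ := exists_polyGerm_mul_eq s
    exact ⟨⟨p, q, hq⟩, h⟩
  · intro p q h
    exact ⟨1, by rw [polyGerm_injective a h]⟩

theorem nonsingular_affineSpace [Finite ι] (a : (affineSpace ι).Pt) :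
    (affineSpace ι).Nonsingular a := by
  let _ := (polyGerm a).toAlgebra
  have := isLocalization_localRing a
  exact IsRegularLocalRing.of_ringEquiv
    (IsLocalization.algEquiv (pointIdeal a).primeCompl (Localization.AtPrime (pointIdeal a))
      ((affineSpace ι).localRing a)).toRingEquiv

theorem isDomain_localRing_affineSpace (a : (affineSpace ι).Pt) :
    IsDomain ((affineSpace ι).localRing a) := by
  let _ := (polyGerm a).toAlgebra
  have := isLocalization_localRing a
  exact IsLocalization.isDomain_of_le_nonZeroDivisors (M := (pointIdeal a).primeCompl) _
    (Ideal.primeCompl_le_nonZeroDivisors (pointIdeal a))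

end Affine

/-! ### A criterion for singularity -/

open IsLocalRing in
/-- A proper quotient of a regular local domain by an ideal contained in the square of the maximal
ideal is not regular. -/
theorem not_isRegularLocalRing_of_surjective {A B : Type*} [CommRing A] [CommRing B] [IsDomain A]
    [IsRegularLocalRing A] (f : A →+* B) (hf : Function.Surjective f)
    (h2 : RingHom.ker f ≤ maximalIdeal A ^ 2) (h0 : RingHom.ker f ≠ ⊥) :
    ¬ IsRegularLocalRing B := by
  intro hB
  have hloc : IsLocalHom f := hf.isLocalHom
  have hmap : (maximalIdeal B).comap f = maximalIdeal A := IsLocalRing.maximalIdeal_comap f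
  obtain ⟨x, hx, hx0⟩ := Submodule.exists_mem_ne_zero_of_ne_bot h0
  -- A nonzero element `x` of the kernel is a nonzerodivisor of the domain `A`, so dividing by it
  -- lowers the dimension, and `B` is a quotient of `A ⧸ (x)`.
  have hdim : ringKrullDim B + 1 ≤ ringKrullDim A := by
    have h1 := ringKrullDim_quotient_succ_le_of_nonZeroDivisor
      (mem_nonZeroDivisors_of_ne_zero hx0)
    let g : A ⧸ Ideal.span {x} →+* B := Ideal.Quotient.lift _ f fun a ha =>
      (Ideal.span_singleton_le_iff_mem (I := RingHom.ker f)).2 hx ha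
    have h3 := ringKrullDim_le_of_surjective g (Ideal.Quotient.lift_surjective_of_surjective _ _ hf)
    exact (add_le_add_left h3 1).trans h1
  obtain ⟨t, ht, hts⟩ := Submodule.FG.exists_span_set_encard_eq_spanFinrank
    (p := maximalIdeal B) (IsNoetherian.noetherian _)
  have htf : t.Finite := Set.finite_of_encard_eq_coe ht
  choose g hg using hf
  -- Lifts of generators of the maximal ideal of `B` generate that of `A` up to the kernel, which
  -- lies in the square. Nakayama's lemma then removes the square.
  have hle : maximalIdeal A ≤ Ideal.span (g '' t) ⊔ maximalIdeal A • maximalIdeal A := by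
    intro a ha
    have hfa : f a ∈ Ideal.map f (Ideal.span (g '' t)) := by
      rw [Ideal.map_span, ← Set.image_comp, (funext hg : f ∘ g = id), Set.image_id]
      change f a ∈ Submodule.span B t
      rw [hts]
      exact (hmap ▸ ha : a ∈ (maximalIdeal B).comap f)
    obtain ⟨b, hb, hbf⟩ := (Ideal.mem_map_iff_of_surjective f fun y => ⟨g y, hg y⟩).1 hfa
    have hk : a - b ∈ maximalIdeal A ^ 2 := h2 (by rw [RingHom.mem_ker, map_sub, hbf, sub_self])
    rw [smul_eq_mul, ← pow_two, ← add_sub_cancel b a]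
    exact Submodule.add_mem_sup hb hk
  have hle' : Ideal.span (g '' t) ≤ maximalIdeal A := by
    rw [Ideal.span_le]
    rintro _ ⟨y, hy, rfl⟩
    refine (SetLike.ext_iff.1 hmap _).1 (Ideal.mem_comap.2 ?_)
    rw [hg, ← hts]
    exact Submodule.subset_span hy
  have hspan : maximalIdeal A ≤ Ideal.span (g '' t) :=
    Submodule.le_of_le_smul_of_le_jacobson_bot (IsNoetherian.noetherian _)
      (IsLocalRing.maximalIdeal_le_jacobson _) hle
  have heq := le_antisymm hspan hle'
  -- The embedding dimension of `A` is at most that of `B`. If both rings were regular, these would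
  -- be their dimensions, against `hdim`.
  have hcard : (maximalIdeal A).spanFinrank ≤ (maximalIdeal B).spanFinrank := by
    rw [heq]
    refine (Submodule.spanFinrank_span_le_ncard_of_finite (htf.image g)).trans ?_
    refine (Set.ncard_image_le htf).trans ?_
    rw [Set.ncard, ht]
    simp
  have hA := IsRegularLocalRing.spanFinrank_maximalIdeal (R := A)
  have hB' := IsRegularLocalRing.spanFinrank_maximalIdeal (R := B)
  rw [← hA, ← hB'] at hdim
  have : (maximalIdeal B).spanFinrank + 1 ≤ (maximalIdeal A).spanFinrank := by exact_mod_cast hdim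
  omega

section Affine

variable {ι : Type}

/-- A subset of affine space is singular at a point where its equations have no linear part, unless
it is the whole space near the point. -/
theorem singular_restrict_affineSpace [Finite ι] {S : Set (affineSpace ι).Pt}
    (a : ((affineSpace ι).restrict S).Pt)
    (h2 : ∀ p : MvPolynomial ι ℂ,
      (∀ᶠ y : (affineSpace ι).Pt in 𝓝 a.1, y ∈ S → MvPolynomial.eval y p = 0) → p ∈ pointIdeal a.1 ^ 2)
    (h0 : ∃ p : MvPolynomial ι ℂ, p ≠ 0 ∧ ∀ y ∈ S, MvPolynomial.eval y p = 0) :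
    ¬ ((affineSpace ι).restrict S).Nonsingular a := by
  have : IsRegularLocalRing ((affineSpace ι).localRing a.1) := nonsingular_affineSpace a.1
  have := isDomain_localRing_affineSpace a.1
  refine not_isRegularLocalRing_of_surjective _ (restrict_pullback_surjective S a) ?_ ?_
  · intro s hs
    -- The denominator `q` is a unit of the local ring, so membership of `s` in the square of the
    -- maximal ideal can be tested on the numerator `p`.
    obtain ⟨p, q, hq, h⟩ := exists_polyGerm_mul_eq s
    have hq' : IsUnit (polyGerm a.1 q) :=
      isUnit_germ (regAt_affineSpace_eval q a.1) hq
    have hp : p ∈ pointIdeal a.1 ^ 2 := by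
      refine h2 p ?_
      have h3 : (morphAt_val S a).pullback rfl (polyGerm a.1 p) = 0 := by
        rw [← h, map_mul, RingHom.mem_ker.1 hs, zero_mul]
      have h4 := Filter.Germ.coe_eq.1 (congrArg Subtype.val h3)
      have h5 := nhds_induced (Subtype.val : S → (affineSpace ι).Pt) a
      have h6 : ∀ᶠ y in Filter.comap (Subtype.val : S → (affineSpace ι).Pt) (𝓝 a.1),
          MvPolynomial.eval y.1 p = 0 := by
        rw [← h5]
        exact h4
      rw [Filter.eventually_comap] at h6
      filter_upwards [h6] with y hy hyS
      exact hy ⟨y, hyS⟩ rfl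
    -- The germ of a polynomial vanishing at the point is no unit: evaluating its product with an
    -- inverse at the point would give 0 = 1.
    have hle : Ideal.map (polyGerm a.1) (pointIdeal a.1) ≤
        IsLocalRing.maximalIdeal ((affineSpace ι).localRing a.1) := by
      rw [Ideal.map_le_iff_le_comap]
      intro r hr
      rw [Ideal.mem_comap, IsLocalRing.mem_maximalIdeal, mem_nonunits_iff]
      intro hu
      obtain ⟨t, ht⟩ := hu.exists_right_inv
      obtain ⟨f, hf, rfl⟩ := exists_germ t
      have h7 := ((germ_eq_iff (hf := FunctionSpace.mul _ (regAt_affineSpace_eval r a.1) hf)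
        (hg := FunctionSpace.const _ _ 1)).1 ht).self_of_nhds
      rw [Pi.mul_apply, mem_pointIdeal.1 hr, zero_mul] at h7
      exact zero_ne_one h7
    have h8 : polyGerm a.1 p ∈ IsLocalRing.maximalIdeal ((affineSpace ι).localRing a.1) ^ 2 := by
      refine Ideal.pow_right_mono hle 2 ?_
      rw [← Ideal.map_pow]
      exact Ideal.mem_map_of_mem _ hp
    rw [← h] at h8
    exact (Ideal.mul_unit_mem_iff_mem _ hq').1 h8
  · obtain ⟨p, hp0, hp⟩ := h0
    intro hbot
    have h1 : polyGerm a.1 p ∈ RingHom.ker ((morphAt_val S a).pullback rfl) := by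
      rw [RingHom.mem_ker]
      refine Subtype.ext (Filter.Germ.coe_eq.2 ?_)
      exact Filter.Eventually.of_forall fun y => hp y.1 y.2
    rw [hbot, Ideal.mem_bot] at h1
    exact hp0 (polyGerm_injective a.1 (h1.trans (map_zero _).symm))

end Affine

end FunctionSpace

/-! ### Minors and frames -/

theorem exists_linearIndependent_comp {K V ι : Type*} [Field K] [AddCommGroup V] [Module K V]
    [Finite ι] (v : ι → V) {r : ℕ} (hr : r ≤ Module.finrank K (Submodule.span K (Set.range v))) :
    ∃ a : Fin r → ι, Function.Injective a ∧ LinearIndependent K (v ∘ a) := by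
  obtain ⟨κ, a, ha, hs, hl⟩ := exists_linearIndependent' K v
  have : Finite κ := Finite.of_injective a ha
  have := Fintype.ofFinite κ
  rw [← hs, finrank_span_eq_card hl, ← Fintype.card_fin r] at hr
  obtain ⟨f⟩ := Function.Embedding.nonempty_of_card_le hr
  exact ⟨a ∘ f, ha.comp f.injective, hl.comp f f.injective⟩

theorem exists_submatrix_det_ne_zero {K : Type*} [Field K] {k m : ℕ}
    (v : Matrix (Fin k) (Fin m) K) (hv : LinearIndependent K v.row) :
    ∃ c : Fin k → Fin m, Function.Injective c ∧ (v.submatrix id c).det ≠ 0 := by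
  have h1 : v.rank = k := by simpa using hv.rank_matrix
  rw [Matrix.rank_eq_finrank_span_cols] at h1
  obtain ⟨c, hc, hl⟩ := exists_linearIndependent_comp v.col h1.ge
  refine ⟨c, hc, IsUnit.ne_zero ?_⟩
  rw [← Matrix.isUnit_iff_isUnit_det, ← Matrix.linearIndependent_cols_iff_isUnit]
  exact hl

/-- Choose r independent rows, then r independent columns of the submatrix formed by these rows. -/
theorem exists_minor_ne_zero_of_lt_rank {K : Type*} [Field K] {l m r : ℕ}
    (Q : Matrix (Fin l) (Fin m) K) (hr : r ≤ Q.rank) :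
    ∃ (a : Fin r → Fin l) (b : Fin r → Fin m), (Q.submatrix a b).det ≠ 0 := by
  rw [Matrix.rank_eq_finrank_span_row] at hr
  obtain ⟨a, -, ha⟩ := exists_linearIndependent_comp Q.row hr
  obtain ⟨b, -, hb⟩ := exists_submatrix_det_ne_zero (Q.submatrix a id) ha
  exact ⟨a, b, hb⟩

theorem linearIndependent_of_submatrix_det_ne_zero {K : Type*} [Field K] {k m : ℕ}
    {v : Matrix (Fin k) (Fin m) K} {c : Fin k → Fin m} (h : (v.submatrix id c).det ≠ 0) :
    LinearIndependent K v.row := by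
  have h1 : LinearIndependent K (v.submatrix id c).row := by
    rw [Matrix.linearIndependent_rows_iff_isUnit, Matrix.isUnit_iff_isUnit_det]
    exact h.isUnit
  exact LinearIndependent.of_comp (LinearMap.funLeft K K c) h1

/-- The splitting σ of the coordinates into k pivots (`inl`) and d complementary ones (`inr`)
indexes all later charts. -/
theorem exists_equiv_comp_inl_eq {k d m : ℕ} (h : k + d = m) {c : Fin k → Fin m}
    (hc : Function.Injective c) : ∃ σ : Fin k ⊕ Fin d ≃ Fin m, ∀ i, σ (Sum.inl i) = c i := by
  classical
  have hcard : Fintype.card ↥(Set.range c)ᶜ = d := by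
    rw [Fintype.card_compl_set, Set.card_range_of_injective hc, Fintype.card_fin, Fintype.card_fin]
    omega
  refine ⟨((Equiv.ofInjective c hc).sumCongr (Fintype.equivFinOfCardEq hcard).symm).trans
    (Equiv.Set.sumCompl (Set.range c)), fun i => ?_⟩
  simp

theorem span_range_mul {K : Type*} [Field K] {k m : ℕ} (g : Matrix (Fin k) (Fin k) K)
    (hg : IsUnit g.det) (v : Matrix (Fin k) (Fin m) K) :
    Submodule.span K (Set.range (g * v).row) = Submodule.span K (Set.range v.row) := by
  have key : ∀ (g : Matrix (Fin k) (Fin k) K) (v : Matrix (Fin k) (Fin m) K),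
      Submodule.span K (Set.range (g * v).row) ≤ Submodule.span K (Set.range v.row) := by
    intro g v
    rw [Submodule.span_le]
    rintro _ ⟨i, rfl⟩
    have : (g * v).row i = ∑ j, g i j • v.row j := by
      ext l
      simp [Matrix.mul_apply]
    rw [this]
    exact Submodule.sum_mem _ fun j _ => Submodule.smul_mem _ _ (Submodule.subset_span ⟨j, rfl⟩)
  refine le_antisymm (key g v) ?_
  have := key g⁻¹ (g * v)
  rwa [← Matrix.mul_assoc, Matrix.nonsing_inv_mul _ hg, Matrix.one_mul] at this

theorem exists_eq_mul_of_span_le {K : Type*} [Field K] {k m : ℕ}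
    {v w : Matrix (Fin k) (Fin m) K} (h : ∀ i, w.row i ∈ Submodule.span K (Set.range v.row)) :
    ∃ g : Matrix (Fin k) (Fin k) K, w = g * v := by
  choose g hg using fun i => (Submodule.mem_span_range_iff_exists_fun K).1 (h i)
  refine ⟨Matrix.of g, ?_⟩
  ext i j
  have := congrFun (hg i) j
  simpa [Matrix.mul_apply] using this.symm

/-! ### Normalized frames and the charts of the Grassmannian -/

namespace FunctionSpace

variable {k m : ℕ}

/-- Some frame of a subspace, as a matrix. -/
noncomputable def frame (L : Subspaces k m) : Matrix (Fin k) (Fin m) ℂ :=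
  (Function.surjInv (Frames.span_surjective k m) L).1

theorem span_frame (L : Subspaces k m) : Submodule.span ℂ (Set.range (frame L).row) = L.1 :=
  congrArg Subtype.val (Function.surjInv_eq (Frames.span_surjective k m) L)

theorem linearIndependent_frame (L : Subspaces k m) : LinearIndependent ℂ (frame L).row :=
  (Function.surjInv (Frames.span_surjective k m) L).2

/-- Every row of `frame L` is a combination of the rows of `v`. The coefficient matrix is invertible
because a nonzero maximal minor of `frame L` equals `g.det` times a minor of `v`. -/
theorem exists_frame_eq_mul {L : Subspaces k m} {v : Matrix (Fin k) (Fin m) ℂ}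
    (hL : Submodule.span ℂ (Set.range v.row) = L.1) :
    ∃ g : Matrix (Fin k) (Fin k) ℂ, g.det ≠ 0 ∧ frame L = g * v := by
  obtain ⟨g, hg⟩ := exists_eq_mul_of_span_le (v := v) (w := frame L) fun i => by
    rw [hL, ← span_frame]
    exact Submodule.subset_span ⟨i, rfl⟩
  refine ⟨g, fun h0 => ?_, hg⟩
  obtain ⟨c, -, hc⟩ := exists_submatrix_det_ne_zero _ (linearIndependent_frame L)
  rw [hg, ← Matrix.submatrix_mul_equiv g v id (Equiv.refl _) c, Matrix.det_mul] at hc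
  simp [h0] at hc

theorem submatrix_mul_id (g : Matrix (Fin k) (Fin k) ℂ) (v : Matrix (Fin k) (Fin m) ℂ)
    {l : ℕ} (c : Fin l → Fin m) : (g * v).submatrix id c = g * v.submatrix id c := rfl

/-- The subspace meets the coordinate subspace of the complement of `c` trivially. -/
def InChart (c : Fin k → Fin m) (L : Subspaces k m) : Prop := ((frame L).submatrix id c).det ≠ 0

theorem inChart_iff {L : Subspaces k m} {c : Fin k → Fin m} {v : Matrix (Fin k) (Fin m) ℂ}
    (hL : Submodule.span ℂ (Set.range v.row) = L.1) :
    InChart c L ↔ (v.submatrix id c).det ≠ 0 := by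
  obtain ⟨g, hg, h⟩ := exists_frame_eq_mul hL
  rw [InChart, h, submatrix_mul_id, Matrix.det_mul]
  simp [hg]

theorem exists_inChart (L : Subspaces k m) : ∃ c, Function.Injective c ∧ InChart c L :=
  exists_submatrix_det_ne_zero _ (linearIndependent_frame L)

/-- The frame of a subspace whose `c`-columns form the identity matrix. -/
noncomputable def normalFrame (c : Fin k → Fin m) (L : Subspaces k m) : Matrix (Fin k) (Fin m) ℂ :=
  ((frame L).submatrix id c)⁻¹ * frame L

/-- The change of frame cancels, so the normal frame can be computed from any frame. This is why its
entries are regular functions although `frame` is an arbitrary choice. -/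
theorem normalFrame_eq {L : Subspaces k m} (c : Fin k → Fin m) {v : Matrix (Fin k) (Fin m) ℂ}
    (hL : Submodule.span ℂ (Set.range v.row) = L.1) :
    normalFrame c L = (v.submatrix id c)⁻¹ * v := by
  obtain ⟨g, hg, h⟩ := exists_frame_eq_mul hL
  rw [normalFrame, h, submatrix_mul_id, Matrix.mul_inv_rev, Matrix.mul_assoc,
    ← Matrix.mul_assoc g⁻¹, Matrix.nonsing_inv_mul _ hg.isUnit, Matrix.one_mul]

theorem normalFrame_submatrix {L : Subspaces k m} {c : Fin k → Fin m} (h : InChart c L) :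
    (normalFrame c L).submatrix id c = 1 := by
  rw [normalFrame, submatrix_mul_id, Matrix.nonsing_inv_mul _ (IsUnit.mk0 _ h)]

theorem span_normalFrame {L : Subspaces k m} {c : Fin k → Fin m} (h : InChart c L) :
    Submodule.span ℂ (Set.range (normalFrame c L).row) = L.1 := by
  rw [normalFrame, span_range_mul _ _, span_frame]
  exact Matrix.isUnit_nonsing_inv_det _ (IsUnit.mk0 _ h)

theorem linearIndependent_of_submatrix_eq_one {v : Matrix (Fin k) (Fin m) ℂ} {c : Fin k → Fin m}
    (h : v.submatrix id c = 1) : LinearIndependent ℂ v.row :=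
  linearIndependent_of_submatrix_det_ne_zero (c := c) (by simp [h])

theorem normalFrame_eq_of_submatrix_eq_one {L : Subspaces k m} {v : Matrix (Fin k) (Fin m) ℂ}
    {c : Fin k → Fin m} (h : v.submatrix id c = 1)
    (hL : Submodule.span ℂ (Set.range v.row) = L.1) : normalFrame c L = v := by
  rw [normalFrame_eq c hL, h, inv_one, Matrix.one_mul]

theorem inChart_of_submatrix_eq_one {L : Subspaces k m} {v : Matrix (Fin k) (Fin m) ℂ}
    {c : Fin k → Fin m} (h : v.submatrix id c = 1)
    (hL : Submodule.span ℂ (Set.range v.row) = L.1) : InChart c L :=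
  (inChart_iff hL).2 (by simp [h])

/-- The subspace spanned by the rows of a matrix with linearly independent rows. -/
def rowSpace (v : Matrix (Fin k) (Fin m) ℂ) (hv : LinearIndependent ℂ v.row) : Subspaces k m :=
  Frames.span ⟨v, hv⟩

theorem rowSpace_normalFrame {L : Subspaces k m} {c : Fin k → Fin m} (h : InChart c L) :
    rowSpace (normalFrame c L)
      (linearIndependent_of_submatrix_eq_one (normalFrame_submatrix h)) = L :=
  Subtype.ext (span_normalFrame h)

theorem morphAt_grassmannian {X : FunctionSpace} {φ : X.Pt → (grassmannian k m).Pt} {x : X.Pt}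
    (f : X.Pt → Matrix (Fin k) (Fin m) ℂ) (hf : ∀ i j, X.RegAt x (fun y => f y i j))
    (h : ∀ᶠ y in 𝓝 x, ∃ h : LinearIndependent ℂ (f y).row, φ y = rowSpace (f y) h) :
    MorphAt X (grassmannian k m) φ x := by
  classical
  obtain ⟨hx, -⟩ := h.self_of_nhds
  let f' : X.Pt → Frames k m := fun y =>
    if h : LinearIndependent ℂ (f y).row then ⟨f y, h⟩ else ⟨f x, hx⟩
  have h1 : MorphAt X ((affineSpace (Fin k × Fin m)).induced
      (fun (v : Frames k m) (e : Fin k × Fin m) => v.1 e.1 e.2)) f' x := by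
    refine morphAt_induced ((morphAt_affineSpace (ι := Fin k × Fin m)
      (f := fun y e => f y e.1 e.2) fun e => hf e.1 e.2).congr ?_)
    filter_upwards [h] with y ⟨hy, _⟩
    have : f' y = ⟨f y, hy⟩ := dif_pos hy
    exact congrArg (fun (v : Frames k m) (e : Fin k × Fin m) => v.1 e.1 e.2) this.symm
  refine MorphAt.congr ((morphAt_quotient_mk _ _ _).trans h1) ?_
  filter_upwards [h] with y ⟨hy, hφ⟩
  exact (congrArg Frames.span (dif_pos hy : f' y = ⟨f y, hy⟩)).trans hφ.symm

/-- A frame as a matrix. -/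
def Frames.toMatrix (v : Frames k m) : Matrix (Fin k) (Fin m) ℂ := v.1

theorem regAt_frames_coord (v : Frames k m) (i : Fin k) (j : Fin m) :
    ((affineSpace (Fin k × Fin m)).induced
      (fun (v : Frames k m) (e : Fin k × Fin m) => v.1 e.1 e.2)).RegAt v (fun v => v.1 i j) :=
  (morphAt_induced_dom (X := affineSpace (Fin k × Fin m))
    (fun (v : Frames k m) (e : Fin k × Fin m) => v.1 e.1 e.2) v).regAt
    (regAt_affineSpace_coord (i, j) _)

theorem isOpen_inChart (c : Fin k → Fin m) :
    IsOpen {L : (grassmannian k m).Pt | InChart c L} := by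
  refine isOpen_quotient fun v hv => ?_
  have h3 : ∀ w : Frames k m, InChart c w.span ↔
      (w.toMatrix.submatrix id c).det ≠ 0 := fun w =>
    inChart_iff (v := w.toMatrix) rfl
  have h2 := RegAt.det (A := fun w : Frames k m =>
    w.toMatrix.submatrix id c) (x := v)
    fun i j => regAt_frames_coord v i (c j)
  filter_upwards [FunctionSpace.ne_zero _ h2 ((h3 v).1 hv)] with w hw
  exact (h3 w).2 hw

theorem regAt_normalFrame {c : Fin k → Fin m} {L : (grassmannian k m).Pt} (hL : InChart c L)
    (i : Fin k) (j : Fin m) :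
    (grassmannian k m).RegAt L (fun L => normalFrame c L i j) := by
  refine regAt_quotient (isOpen_inChart c) (fun v hv => ?_) hL
  have h3 : ∀ w : Frames k m, normalFrame c w.span =
      (w.toMatrix.submatrix id c)⁻¹ * w.toMatrix := fun w =>
    normalFrame_eq c (v := w.toMatrix) rfl
  have h4 : ((Frames.toMatrix v).submatrix id c).det ≠ 0 :=
    (inChart_iff (v := Frames.toMatrix v) rfl).1 hv
  have h2 := RegAt.matrix_mul (A := fun w : Frames k m =>
      (w.toMatrix.submatrix id c)⁻¹)
    (B := Frames.toMatrix) (x := v)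
    (RegAt.matrix_inv (fun i j => regAt_frames_coord v i (c j)) h4)
    (fun i j => regAt_frames_coord v i j) i j
  exact h2.of_eq fun w => (congrFun (congrFun (h3 w) i) j).symm

/-- The matrix with the identity matrix in the columns `σ (inl i)` and `b` in the others. -/
def chartFrame {d : ℕ} (σ : Fin k ⊕ Fin d ≃ Fin m) (b : Fin k × Fin d → ℂ) :
    Matrix (Fin k) (Fin m) ℂ :=
  Matrix.of fun i j => Sum.elim (fun i' => (1 : Matrix (Fin k) (Fin k) ℂ) i i')
    (fun a => b (i, a)) (σ.symm j)

theorem chartFrame_submatrix {d : ℕ} (σ : Fin k ⊕ Fin d ≃ Fin m) (b : Fin k × Fin d → ℂ) :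
    (chartFrame σ b).submatrix id (fun i => σ (Sum.inl i)) = 1 := by
  ext i j
  simp [chartFrame]

theorem chartFrame_inr {d : ℕ} (σ : Fin k ⊕ Fin d ≃ Fin m) (b : Fin k × Fin d → ℂ) (i : Fin k)
    (a : Fin d) : chartFrame σ b i (σ (Sum.inr a)) = b (i, a) := by
  simp [chartFrame]

theorem chartFrame_eq {d : ℕ} (σ : Fin k ⊕ Fin d ≃ Fin m) {v : Matrix (Fin k) (Fin m) ℂ}
    (h : v.submatrix id (fun i => σ (Sum.inl i)) = 1) :
    chartFrame σ (fun e => v e.1 (σ (Sum.inr e.2))) = v := by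
  ext i j
  obtain ⟨j, rfl⟩ := σ.surjective j
  rcases j with j | j
  · have := congrFun (congrFun h i) j
    simpa [chartFrame] using this.symm
  · simp [chartFrame]

/-- A subspace in the chart is the graph of a linear map from the pivot coordinates to the others.
The entries of the normal frame outside the pivot columns are the k · d coordinates. -/
theorem locIso_grassmannian {d : ℕ} (σ : Fin k ⊕ Fin d ≃ Fin m) {L : (grassmannian k m).Pt}
    (hL : InChart (fun i => σ (Sum.inl i)) L) :
    ∃ b, LocIso (grassmannian k m) (affineSpace (Fin k × Fin d)) L b := by
  let c : Fin k → Fin m := fun i => σ (Sum.inl i)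
  let φ : (grassmannian k m).Pt → (affineSpace (Fin k × Fin d)).Pt :=
    fun L e => normalFrame c L e.1 (σ (Sum.inr e.2))
  let ψ : (affineSpace (Fin k × Fin d)).Pt → (grassmannian k m).Pt :=
    fun b => rowSpace (chartFrame σ b)
      (linearIndependent_of_submatrix_eq_one (chartFrame_submatrix σ b))
  have h1 : ∀ L, InChart c L → ψ (φ L) = L := by
    intro L hL
    have h2 : chartFrame σ (φ L) = normalFrame c L := chartFrame_eq σ (normalFrame_submatrix hL)
    refine Subtype.ext ?_
    change Submodule.span ℂ (Set.range (chartFrame σ (φ L)).row) = L.1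
    rw [h2, span_normalFrame hL]
  refine ⟨φ L, φ, ψ, rfl, h1 L hL, ?_, Filter.Eventually.of_forall fun b => ⟨?_, ?_⟩⟩
  · filter_upwards [(isOpen_inChart c).mem_nhds hL] with L' hL'
    exact ⟨morphAt_affineSpace fun e => regAt_normalFrame hL' _ _, h1 L' hL'⟩
  · refine morphAt_grassmannian (fun b => chartFrame σ b) (fun i j => ?_)
      (Filter.Eventually.of_forall fun b => ⟨_, rfl⟩)
    obtain ⟨j, rfl⟩ := σ.surjective j
    rcases j with j | j
    · exact (FunctionSpace.const _ _ ((1 : Matrix (Fin k) (Fin k) ℂ) i j)).of_eq fun b => by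
        simp [chartFrame]
    · exact (regAt_affineSpace_coord (i, j) _).of_eq fun b => (chartFrame_inr σ b i j).symm
  · have h2 : normalFrame c (ψ b) = chartFrame σ b :=
      normalFrame_eq_of_submatrix_eq_one (chartFrame_submatrix σ b) rfl
    refine funext fun e => ?_
    change normalFrame c (ψ b) e.1 (σ (Sum.inr e.2)) = b e
    rw [h2]
    exact chartFrame_inr σ b e.1 e.2

end FunctionSpace

/-! ### Gram matrices -/

section Gram

variable {m : ℕ}

/-- The symmetric function on pairs of points given by its values on ordered pairs. -/
def symmExtend {n : ℕ} (s : CayleyIndex n → ℂ) (i j : Fin n) : ℂ :=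
  if h : i < j then s ⟨(i, j), h⟩ else if h : j < i then s ⟨(j, i), h⟩ else 0

theorem symmExtend_comm {n : ℕ} (s : CayleyIndex n → ℂ) (i j : Fin n) :
    symmExtend s i j = symmExtend s j i := by
  rcases lt_trichotomy i j with h | h | h
  · simp [symmExtend, h, h.not_gt]
  · rw [h]
  · simp [symmExtend, h, h.not_gt]

theorem symmExtend_self {n : ℕ} (s : CayleyIndex n → ℂ) (i : Fin n) : symmExtend s i i = 0 := by
  simp [symmExtend]

theorem symmExtend_apply {n : ℕ} (s : CayleyIndex n → ℂ) (e : CayleyIndex n) :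
    symmExtend s e.1.1 e.1.2 = s e := by
  simp [symmExtend, e.2]

/-- The matrix of inner products `⟨p_i - p_0, p_j - p_0⟩` in terms of the squared distances. -/
noncomputable def gram (s : CayleyIndex (m + 1) → ℂ) : Matrix (Fin m) (Fin m) ℂ :=
  Matrix.of fun i j =>
    (symmExtend s 0 i.succ + symmExtend s 0 j.succ - symmExtend s i.succ j.succ) / 2

theorem gram_transpose (s : CayleyIndex (m + 1) → ℂ) : (gram s).transpose = gram s := by
  ext i j
  simp only [gram, Matrix.transpose_apply, Matrix.of_apply, symmExtend_comm s j.succ i.succ]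
  ring

theorem symmExtend_add {n : ℕ} (s t : CayleyIndex n → ℂ) (i j : Fin n) :
    symmExtend (s + t) i j = symmExtend s i j + symmExtend t i j := by
  simp only [symmExtend, Pi.add_apply]
  split_ifs <;> simp

theorem symmExtend_smul {n : ℕ} (a : ℂ) (s : CayleyIndex n → ℂ) (i j : Fin n) :
    symmExtend (a • s) i j = a * symmExtend s i j := by
  simp only [symmExtend, Pi.smul_apply, smul_eq_mul]
  split_ifs <;> simp

theorem gram_add (s t : CayleyIndex (m + 1) → ℂ) : gram (s + t) = gram s + gram t := by
  ext i j
  simp only [gram, Matrix.of_apply, Matrix.add_apply, symmExtend_add]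
  ring

theorem gram_smul (a : ℂ) (s : CayleyIndex (m + 1) → ℂ) : gram (a • s) = a • gram s := by
  ext i j
  simp only [gram, Matrix.of_apply, Matrix.smul_apply, symmExtend_smul, smul_eq_mul]
  ring

/-- A square matrix extended by a zero row and a zero column. -/
def padZero (Q : Matrix (Fin m) (Fin m) ℂ) : Matrix (Fin (m + 1)) (Fin (m + 1)) ℂ :=
  Matrix.of fun i j => Fin.cases 0 (fun i => Fin.cases 0 (fun j => Q i j) j) i

@[simp] theorem padZero_zero_left (Q : Matrix (Fin m) (Fin m) ℂ) (j : Fin (m + 1)) :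
    padZero Q 0 j = 0 := rfl

@[simp] theorem padZero_zero_right (Q : Matrix (Fin m) (Fin m) ℂ) (i : Fin (m + 1)) :
    padZero Q i 0 = 0 := by
  refine Fin.cases rfl (fun i => rfl) i

@[simp] theorem padZero_succ (Q : Matrix (Fin m) (Fin m) ℂ) (i j : Fin m) :
    padZero Q i.succ j.succ = Q i j := rfl

/-- The squared distances of the points `0, e_1, …, e_m` with respect to a quadratic form. -/
def distOf (Q : Matrix (Fin m) (Fin m) ℂ) : CayleyIndex (m + 1) → ℂ := fun e =>
  padZero Q e.1.1 e.1.1 + padZero Q e.1.2 e.1.2 - padZero Q e.1.1 e.1.2 - padZero Q e.1.2 e.1.1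

theorem symmExtend_distOf (Q : Matrix (Fin m) (Fin m) ℂ) (i j : Fin (m + 1)) :
    symmExtend (distOf Q) i j =
      padZero Q i i + padZero Q j j - padZero Q i j - padZero Q j i := by
  rcases lt_trichotomy i j with h | h | h
  · simp [symmExtend, h, distOf]
  · subst h
    rw [symmExtend_self]
    ring
  · simp only [symmExtend, h, h.not_gt, distOf, dif_pos, dif_neg, not_false_eq_true]
    ring

/-- Polarization. `distOf` sees only the symmetric part of `Q`, so symmetry is needed here, whereas
`distOf_gram` holds for all s. -/
theorem gram_distOf {Q : Matrix (Fin m) (Fin m) ℂ} (hQ : Q.transpose = Q) :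
    gram (distOf Q) = Q := by
  ext i j
  have : Q j i = Q i j := congrFun (congrFun hQ i) j
  simp only [gram, Matrix.of_apply, symmExtend_distOf, padZero_zero_left, padZero_zero_right,
    padZero_succ, this]
  ring

theorem distOf_gram (s : CayleyIndex (m + 1) → ℂ) : distOf (gram s) = s := by
  ext ⟨⟨i, j⟩, h⟩
  have h1 := symmExtend_apply s ⟨(i, j), h⟩
  simp only [distOf]
  rw [← h1]
  dsimp only at h ⊢
  induction j using Fin.cases with
  | zero => exact absurd h (Fin.not_lt_zero i)
  | succ j =>
    induction i using Fin.cases with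
    | zero =>
      simp only [gram, padZero_zero_left, padZero_zero_right, padZero_succ, Matrix.of_apply,
        symmExtend_self]
      ring
    | succ i =>
      simp only [gram, padZero_succ, Matrix.of_apply, symmExtend_self,
        symmExtend_comm s j.succ i.succ]
      ring

theorem gram_injective : Function.Injective (gram (m := m)) :=
  Function.LeftInverse.injective distOf_gram

theorem gram_zero : gram (0 : CayleyIndex (m + 1) → ℂ) = 0 := by
  have := gram_smul (0 : ℂ) (0 : CayleyIndex (m + 1) → ℂ)
  simpa using this

theorem gram_ne_zero {s : CayleyIndex (m + 1) → ℂ} (hs : s ≠ 0) : gram s ≠ 0 := fun h =>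
  hs (gram_injective (h.trans gram_zero.symm))

theorem distOf_smul (a : ℂ) (Q : Matrix (Fin m) (Fin m) ℂ) : distOf (a • Q) = a • distOf Q := by
  have h : ∀ i j, padZero (a • Q) i j = a * padZero Q i j := by
    intro i j
    refine Fin.cases (by simp) (fun i => ?_) i
    refine Fin.cases (by simp) (fun j => ?_) j
    simp
  ext e
  simp only [distOf, h, Pi.smul_apply, smul_eq_mul]
  ring

/-- Makes the rank of the Gram matrix a function of the projective point. -/
theorem rank_gram_smul {a : ℂ} (ha : a ≠ 0) (s : CayleyIndex (m + 1) → ℂ) :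
    (gram (a • s)).rank = (gram s).rank := by
  rw [gram_smul]
  have h : a • gram s = (a • (1 : Matrix (Fin m) (Fin m) ℂ)) * gram s := by simp
  rw [h, Matrix.rank_mul_eq_right_of_isUnit_det]
  simp [ha]

/-- Coordinates of the configuration with the first point at the origin. -/
def configMatrix {d : ℕ} (p : Fin (m + 1) → EuclideanSpace ℝ (Fin d)) :
    Matrix (Fin d) (Fin m) ℂ :=
  Matrix.of fun a i => ((p i.succ a - p 0 a : ℝ) : ℂ)

theorem squaredDistances_eq_sum {d n : ℕ} (p : Fin n → EuclideanSpace ℝ (Fin d))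
    (i j : Fin n) :
    symmExtend (squaredDistances p) i j = ∑ a, ((p i a : ℂ) - p j a) ^ 2 := by
  have h : ∀ i j : Fin n, ((‖p i - p j‖ ^ 2 : ℝ) : ℂ) = ∑ a, ((p i a : ℂ) - p j a) ^ 2 := by
    intro i j
    rw [EuclideanSpace.real_norm_sq_eq]
    push_cast
    simp
  rcases lt_trichotomy i j with hij | hij | hij
  · simp only [symmExtend, hij, dif_pos, squaredDistances]
    exact h i j
  · subst hij
    simp [symmExtend_self]
  · simp only [symmExtend, hij, hij.not_gt, dif_pos, squaredDistances, dif_neg,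
      not_false_eq_true]
    rw [h j i]
    exact Finset.sum_congr rfl fun a _ => by ring

theorem gram_squaredDistances {d : ℕ} (p : Fin (m + 1) → EuclideanSpace ℝ (Fin d)) :
    gram (squaredDistances p) = (configMatrix p).transpose * configMatrix p := by
  ext i j
  simp only [gram, Matrix.of_apply, squaredDistances_eq_sum, Matrix.mul_apply, configMatrix,
    Matrix.transpose_apply]
  rw [← Finset.sum_add_distrib, ← Finset.sum_sub_distrib, Finset.sum_div]
  refine Finset.sum_congr rfl fun a _ => ?_
  push_cast
  ring

/-- A complex symmetric matrix of rank at most `d` is `AᵀA` with `A` of size `d × m`. -/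
theorem exists_eq_transpose_mul {d : ℕ} {Q : Matrix (Fin m) (Fin m) ℂ} (hQ : Q.transpose = Q)
    (hr : Q.rank ≤ d) : ∃ A : Matrix (Fin d) (Fin m) ℂ, Q = A.transpose * A := by
  classical
  have hsymm : LinearMap.IsSymm (Matrix.toBilin' Q) := ⟨fun x y => by
    simp only [Matrix.toBilin'_apply', RingHom.id_apply]
    rw [Matrix.dotProduct_mulVec, ← Matrix.mulVec_transpose, hQ, dotProduct_comm]⟩
  obtain ⟨b, hb⟩ := LinearMap.BilinForm.exists_orthogonal_basis hsymm
  have hfr : Module.finrank ℂ (Fin m → ℂ) = m := by simp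
  let b' := b.reindex (finCongr hfr)
  let P : Matrix (Fin m) (Fin m) ℂ := (Pi.basisFun ℂ (Fin m)).toMatrix b'
  let R : Matrix (Fin m) (Fin m) ℂ := b'.toMatrix (Pi.basisFun ℂ (Fin m))
  have hPR : P * R = 1 := Module.Basis.toMatrix_mul_toMatrix_flip _ _
  let w : Fin m → ℂ := fun i => Matrix.toBilin' Q (b' i) (b' i)
  have hD : P.transpose * Q * P = Matrix.diagonal w := by
    ext i j
    have h1 : (P.transpose * Q * P) i j = Matrix.toBilin' Q (b' i) (b' j) := by
      rw [Matrix.toBilin'_apply]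
      simp only [Matrix.mul_apply, Matrix.transpose_apply, Finset.sum_mul]
      rw [Finset.sum_comm]
      rfl
    rw [h1]
    by_cases hij : i = j
    · subst hij
      simp [w]
    · rw [Matrix.diagonal_apply_ne _ hij]
      have h2 := hb (i := (finCongr hfr).symm i) (j := (finCongr hfr).symm j)
        (fun h => hij ((finCongr hfr).symm.injective h))
      simpa [b'] using h2
  have hQD : Q = R.transpose * Matrix.diagonal w * R := by
    rw [← hD]
    have h1 : R.transpose * P.transpose = 1 := by
      rw [← Matrix.transpose_mul, hPR, Matrix.transpose_one]
    calc Q = (R.transpose * P.transpose) * Q * (P * R) := by rw [h1, hPR]; simp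
      _ = _ := by simp only [Matrix.mul_assoc]
  -- The number of nonzero diagonal entries is the rank of the diagonalized form, so these entries
  -- can be assigned to distinct rows of a matrix with d rows.
  have hcard : Fintype.card {i // w i ≠ 0} ≤ Fintype.card (Fin d) := by
    rw [← Matrix.rank_diagonal, ← hD, Fintype.card_fin]
    exact (Matrix.rank_mul_le_left _ _).trans ((Matrix.rank_mul_le_right _ _).trans hr)
  obtain ⟨f⟩ := Function.Embedding.nonempty_of_card_le hcard
  choose r hr using fun z : ℂ => IsAlgClosed.exists_pow_nat_eq z (n := 2) two_pos
  -- Row `f l` of A is a square root of `w l` times row `l` of `R`, and rows outside the range of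
  -- `f` are zero.
  refine ⟨Matrix.of fun a j => Function.extend f (fun l => r (w l) * R l j) 0 a, ?_⟩
  clear_value R
  rw [hQD]
  ext i j
  have h1 : ∑ l : {l // w l ≠ 0}, R l i * w l * R l j = ∑ l, R l i * w l * R l j := by
    refine Fintype.sum_of_injective Subtype.val Subtype.val_injective _ _ (fun l hl => ?_)
      fun _ => rfl
    have : w l = 0 := by
      by_contra h
      exact hl ⟨⟨l, h⟩, rfl⟩
    simp [this]
  rw [Matrix.mul_apply, Matrix.mul_apply]
  simp only [Matrix.mul_diagonal, Matrix.transpose_apply, Matrix.of_apply]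
  rw [← h1]
  refine Fintype.sum_of_injective f f.injective _ _ (fun a ha => ?_) fun l => ?_
  · rw [Function.extend_apply' _ _ _ (by simpa using ha)]
    simp
  · simp only [f.injective.extend_apply]
    have := hr (w l)
    linear_combination (-(R l i * R l j)) * this

theorem det_submatrix_eq_zero_of_rank_le {l m d : ℕ} {Q : Matrix (Fin l) (Fin m) ℂ}
    (hr : Q.rank ≤ d) (a : Fin (d + 1) → Fin l) (b : Fin (d + 1) → Fin m) :
    (Q.submatrix a b).det = 0 := by
  by_contra h
  have h1 : (Q.submatrix a b).rank = d + 1 := by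
    rw [Matrix.rank_of_isUnit _ ((Matrix.isUnit_iff_isUnit_det _).2 (IsUnit.mk0 _ h)),
      Fintype.card_fin]
  -- Selecting rows and columns is multiplication by 0-1 matrices, which does not raise the rank.
  have h2 : Q.submatrix a b = (1 : Matrix (Fin l) (Fin l) ℂ).submatrix a id * Q *
      (1 : Matrix (Fin m) (Fin m) ℂ).submatrix id b := by
    ext i j
    simp [Matrix.mul_apply, Matrix.one_apply]
  have h3 := (Matrix.rank_mul_le_left ((1 : Matrix (Fin l) (Fin l) ℂ).submatrix a id * Q)
    ((1 : Matrix (Fin m) (Fin m) ℂ).submatrix id b)).trans (Matrix.rank_mul_le_right _ _)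
  rw [← h2] at h3
  omega

/-! ### The Cayley–Menger variety as a symmetric determinantal variety -/

/-- The polynomial whose values are the entries of the Gram matrix. -/
noncomputable def gramPoly (i j : Fin m) : MvPolynomial (CayleyIndex (m + 1)) ℂ :=
  let X' : Fin (m + 1) → Fin (m + 1) → MvPolynomial (CayleyIndex (m + 1)) ℂ := fun i j =>
    if h : i < j then MvPolynomial.X ⟨(i, j), h⟩
    else if h : j < i then MvPolynomial.X ⟨(j, i), h⟩ else 0
  MvPolynomial.C (1 / 2) * (X' 0 i.succ + X' 0 j.succ - X' i.succ j.succ)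

theorem eval_gramPoly (s : CayleyIndex (m + 1) → ℂ) (i j : Fin m) :
    MvPolynomial.eval s (gramPoly i j) = gram s i j := by
  have h : ∀ i j : Fin (m + 1), MvPolynomial.eval s (if h : i < j then MvPolynomial.X ⟨(i, j), h⟩
      else if h : j < i then MvPolynomial.X ⟨(j, i), h⟩ else 0) = symmExtend s i j := by
    intro i j
    unfold symmExtend
    split_ifs <;> simp
  simp only [gramPoly, map_mul, map_add, map_sub, h, MvPolynomial.eval_C, gram, Matrix.of_apply]
  ring

theorem isHomogeneous_gramPoly (i j : Fin m) : (gramPoly i j).IsHomogeneous 1 := by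
  have h : ∀ i j : Fin (m + 1), MvPolynomial.IsHomogeneous
      (if h : i < j then MvPolynomial.X ⟨(i, j), h⟩
        else if h : j < i then MvPolynomial.X ⟨(j, i), h⟩ else 0 :
        MvPolynomial (CayleyIndex (m + 1)) ℂ) 1 := by
    intro i j
    split_ifs
    · exact MvPolynomial.isHomogeneous_X _ _
    · exact MvPolynomial.isHomogeneous_X _ _
    · exact MvPolynomial.isHomogeneous_zero _ _ _
  have h2 := ((h 0 i.succ).add (h 0 j.succ)).sub (h i.succ j.succ)
  have h3 := (MvPolynomial.isHomogeneous_C (CayleyIndex (m + 1)) (1 / 2 : ℂ)).mul h2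
  rwa [zero_add] at h3

theorem isHomogeneous_det {ι : Type*} {r : ℕ} {A : Matrix (Fin r) (Fin r) (MvPolynomial ι ℂ)}
    (h : ∀ i j, (A i j).IsHomogeneous 1) : A.det.IsHomogeneous r := by
  rw [Matrix.det_apply']
  refine MvPolynomial.IsHomogeneous.sum _ _ _ fun σ _ => ?_
  have h1 := MvPolynomial.IsHomogeneous.prod Finset.univ (fun i => A (σ i) i) (fun _ => 1)
    fun i _ => h _ _
  have h2 := (MvPolynomial.isHomogeneous_C ι ((Equiv.Perm.sign σ : ℤ) : ℂ)).mul h1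
  simpa using h2

theorem eval_det_gramPoly {r : ℕ} (a b : Fin r → Fin m) (s : CayleyIndex (m + 1) → ℂ) :
    MvPolynomial.eval s (Matrix.det (Matrix.of fun i j => gramPoly (a i) (b j))) =
      ((gram s).submatrix a b).det := by
  rw [RingHom.map_det]
  congr 1
  ext i j
  simp [eval_gramPoly]

/-- Lets a polynomial in the squared distances be pulled back to a polynomial in the coordinates B
of a configuration. -/
theorem exists_eval_eq_distOf (d : ℕ) (e : CayleyIndex (m + 1)) :
    ∃ P : MvPolynomial (Fin d × Fin m) ℂ, ∀ B : Fin d × Fin m → ℂ, MvPolynomial.eval B P =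
      distOf ((Matrix.of fun a i => B (a, i)).transpose * (Matrix.of fun a i => B (a, i))) e := by
  have h : ∀ i j : Fin (m + 1), ∃ P : MvPolynomial (Fin d × Fin m) ℂ, ∀ B : Fin d × Fin m → ℂ,
      MvPolynomial.eval B P = padZero ((Matrix.of fun a i => B (a, i)).transpose *
        (Matrix.of fun a i => B (a, i))) i j := by
    intro i j
    refine Fin.cases ⟨0, fun B => by simp⟩ (fun i => ?_) i
    refine Fin.cases ⟨0, fun B => by simp⟩ (fun j => ?_) j
    exact ⟨∑ a, MvPolynomial.X (a, i) * MvPolynomial.X (a, j), fun B => by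
      simp [Matrix.mul_apply]⟩
  choose P hP using h
  exact ⟨P e.1.1 e.1.1 + P e.1.2 e.1.2 - P e.1.1 e.1.2 - P e.1.2 e.1.1, fun B => by
    simp only [map_add, map_sub, hP, distOf]⟩

theorem eval_smul_of_isHomogeneous {ι : Type*} {f : MvPolynomial ι ℂ} {k : ℕ}
    (hf : f.IsHomogeneous k) (a : ℂ) (v : ι → ℂ) :
    MvPolynomial.eval (a • v) f = a ^ k * MvPolynomial.eval v f := by
  rw [MvPolynomial.eval_eq, MvPolynomial.eval_eq, Finset.mul_sum]
  refine Finset.sum_congr rfl fun d hd => ?_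
  have h1 : ∑ i ∈ d.support, d i = k := by
    have := hf (MvPolynomial.mem_support_iff.1 hd)
    simpa [Finsupp.weight_apply, Finsupp.sum] using this
  simp only [Pi.smul_apply, smul_eq_mul, mul_pow, Finset.prod_mul_distrib,
    Finset.prod_pow_eq_pow_sum, h1]
  ring

theorem eval_rep_eq_zero_iff {ι : Type} {f : MvPolynomial ι ℂ} {k : ℕ} (hf : f.IsHomogeneous k)
    {v : ι → ℂ} (hv : v ≠ 0) :
    MvPolynomial.eval (Projectivization.mk ℂ v hv).rep f = 0 ↔ MvPolynomial.eval v f = 0 := by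
  obtain ⟨a, ha, h⟩ := FunctionSpace.rep_mk_eq v hv
  rw [h, eval_smul_of_isHomogeneous hf]
  simp [ha]

/-- The (d+1)-minors of the Gram matrix vanish on real configurations, hence on the closure.
Conversely write the Gram matrix as AᵀA with A complex: an equation valid for all real matrices A is
a polynomial identity in A, so it holds for the complex ones too. -/
theorem mem_cayleyMengerSet_iff {d : ℕ} {x : ℙ ℂ (CayleyIndex (m + 1) → ℂ)} :
    x ∈ cayleyMengerSet d (m + 1) ↔ (gram x.rep).rank ≤ d := by
  constructor
  · intro hx
    by_contra! h
    obtain ⟨a, b, hab⟩ := exists_minor_ne_zero_of_lt_rank (gram x.rep) (r := d + 1) h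
    refine hab ?_
    rw [← eval_det_gramPoly]
    refine hx (d + 1) _ (isHomogeneous_det fun i j => isHomogeneous_gramPoly _ _) ?_
    rintro _ ⟨p, hp, rfl⟩
    refine (eval_rep_eq_zero_iff (f := Matrix.det (Matrix.of fun i j => gramPoly (a i) (b j)))
      (isHomogeneous_det fun i j => isHomogeneous_gramPoly _ _) _).2 ?_
    rw [eval_det_gramPoly, gram_squaredDistances]
    refine det_submatrix_eq_zero_of_rank_le ?_ a b
    exact (Matrix.rank_mul_le_right _ _).trans ((Matrix.rank_le_card_height _).trans (by simp))
  · intro hx k f hf hS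
    obtain ⟨A, hA⟩ := exists_eq_transpose_mul (gram_transpose x.rep) hx
    obtain ⟨a₀, i₀, hA0⟩ : ∃ a i, A a i ≠ 0 := by
      by_contra! h
      have : A = 0 := by ext a i; exact h a i
      rw [this, Matrix.mul_zero] at hA
      exact gram_ne_zero x.rep_nonzero hA
    choose D hD using exists_eval_eq_distOf (m := m) d
    let F : MvPolynomial (Fin d × Fin m) ℂ := MvPolynomial.bind₁ D f
    have hF : ∀ B : Fin d × Fin m → ℂ, MvPolynomial.eval B F = MvPolynomial.eval
        (distOf ((Matrix.of fun a i => B (a, i)).transpose * (Matrix.of fun a i => B (a, i)))) f := by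
      intro B
      have h1 : (fun e => MvPolynomial.eval B (D e)) = distOf
        ((Matrix.of fun a i => B (a, i)).transpose * (Matrix.of fun a i => B (a, i))) :=
        funext fun e => hD e B
      rw [← h1]
      exact MvPolynomial.eval₂Hom_bind₁ (RingHom.id ℂ) B D f
    -- The factor excludes the configuration with all points equal, on which nothing is assumed:
    -- where B(a₀, i₀) = 0 the product vanishes trivially, and elsewhere the configuration is not
    -- constant. Real B suffice because ℝ is infinite.
    have hzero : MvPolynomial.X (a₀, i₀) * F = 0 := by
      refine MvPolynomial.funext_set (fun _ => Set.range ((↑) : ℝ → ℂ))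
        (fun _ => Set.infinite_range_of_injective Complex.ofReal_injective) fun B hB => ?_
      choose b hb using fun i => hB i trivial
      rw [map_mul, MvPolynomial.eval_X, map_zero]
      by_cases h0 : B (a₀, i₀) = 0
      · rw [h0, zero_mul]
      rw [hF]
      let p : Fin (m + 1) → EuclideanSpace ℝ (Fin d) := fun j =>
        Fin.cases 0 (fun i => WithLp.toLp 2 fun a => b (a, i)) j
      have hp : ∃ i j, p i ≠ p j := by
        refine ⟨i₀.succ, 0, fun h => h0 ?_⟩
        have : b (a₀, i₀) = 0 := congrArg (fun v : EuclideanSpace ℝ (Fin d) => v a₀) h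
        rw [← hb, this, Complex.ofReal_zero]
      have hc : configMatrix p = Matrix.of fun a i => B (a, i) := by
        ext a i
        simp [configMatrix, p, ← hb]
      have h1 := (eval_rep_eq_zero_iff hf (squaredDistances_ne_zero hp)).1 (hS _ ⟨p, hp, rfl⟩)
      rw [← hc, ← gram_squaredDistances, distOf_gram, h1, mul_zero]
    have hF0 : F = 0 := (mul_eq_zero.1 hzero).resolve_left (MvPolynomial.X_ne_zero _)
    have h2 := hF fun e => A e.1 e.2
    have h3 : (Matrix.of fun a i => (fun e : Fin d × Fin m => A e.1 e.2) (a, i)) = A := rfl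
    rw [hF0, map_zero, h3, ← hA, distOf_gram] at h2
    exact h2.symm

end Gram

namespace FunctionSpace

/-! ### First order expansions of polynomials -/

section Taylor

variable {ι : Type} [Fintype ι]

/-- First-order Taylor expansion, by induction on p. In the product with a variable the coefficients
follow the Leibniz rule, and the product of two linear terms falls into the square of the ideal. -/
theorem exists_linear_part (a : ι → ℂ) (p : MvPolynomial ι ℂ) : ∃ c : ι → ℂ,
    p - MvPolynomial.C (MvPolynomial.eval a p) -
      ∑ j, MvPolynomial.C (c j) * (MvPolynomial.X j - MvPolynomial.C (a j)) ∈
        RingHom.ker (MvPolynomial.eval a) ^ 2 := by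
  classical
  have hX : ∀ j, (MvPolynomial.X j - MvPolynomial.C (a j) : MvPolynomial ι ℂ) ∈ RingHom.ker (MvPolynomial.eval a) :=
    fun j => by rw [RingHom.mem_ker]; simp
  induction p using MvPolynomial.induction_on with
  | C z => exact ⟨0, by simp⟩
  | add p q hp hq =>
    obtain ⟨c, hc⟩ := hp
    obtain ⟨c', hc'⟩ := hq
    refine ⟨c + c', ?_⟩
    have := Ideal.add_mem _ hc hc'
    convert this using 1
    simp only [map_add, Pi.add_apply, add_mul, Finset.sum_add_distrib]
    ring
  | mul_X p i hp =>
    obtain ⟨c, hc⟩ := hp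
    refine ⟨fun j => c j * a i + if j = i then MvPolynomial.eval a p else 0, ?_⟩
    have h1 : (∑ j, MvPolynomial.C (c j) * (MvPolynomial.X j - MvPolynomial.C (a j))) *
        (MvPolynomial.X i - MvPolynomial.C (a i)) ∈ RingHom.ker (MvPolynomial.eval a) ^ 2 := by
      rw [pow_two]
      exact Ideal.mul_mem_mul (Ideal.sum_mem _ fun j _ => Ideal.mul_mem_left _ _ (hX j)) (hX i)
    have h2 := Ideal.add_mem _ (Ideal.mul_mem_right (MvPolynomial.X i) _ hc) h1
    convert h2 using 1
    have h3 : ∑ j, MvPolynomial.C (c j * a i + if j = i then MvPolynomial.eval a p else 0) *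
        (MvPolynomial.X j - MvPolynomial.C (a j)) =
        (∑ j, MvPolynomial.C (c j) * (MvPolynomial.X j - MvPolynomial.C (a j))) *
          MvPolynomial.C (a i) +
        MvPolynomial.C (MvPolynomial.eval a p) * (MvPolynomial.X i - MvPolynomial.C (a i)) := by
      have h4 : ∑ j, (if j = i then MvPolynomial.C (MvPolynomial.eval a p) *
          (MvPolynomial.X j - MvPolynomial.C (a j)) else 0) =
          MvPolynomial.C (MvPolynomial.eval a p) * (MvPolynomial.X i - MvPolynomial.C (a i)) := by
        simp
      rw [Finset.sum_mul, ← h4, ← Finset.sum_add_distrib]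
      refine Finset.sum_congr rfl fun j _ => ?_
      split_ifs <;> simp only [map_add, map_mul, map_zero] <;> ring
    rw [h3]
    simp only [map_mul, MvPolynomial.eval_X]
    ring

/-- If a set contains sufficiently many lines through `a`, then polynomials which vanish on it near
`a` vanish to second order at `a`. -/
theorem mem_pointIdeal_sq_of_lines {a : (affineSpace ι).Pt} {S : Set (affineSpace ι).Pt}
    {W : Set (ι → ℂ)} (haS : a ∈ S)
    (hW : ∀ w ∈ W, ∀ u : ℂ, ((fun j => a j + u * w j : ι → ℂ) : (affineSpace ι).Pt) ∈ S)
    (hspan : ∀ c : ι → ℂ, (∀ w ∈ W, ∑ j, c j * w j = 0) → c = 0) {p : MvPolynomial ι ℂ}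
    (hp : ∀ᶠ y : (affineSpace ι).Pt in 𝓝 a, y ∈ S → MvPolynomial.eval y p = 0) :
    p ∈ pointIdeal a ^ 2 := by
  obtain ⟨c, hc⟩ := exists_linear_part (ι := ι) a p
  have hpa : MvPolynomial.eval a p = 0 := hp.self_of_nhds haS
  obtain ⟨q, hqa, hq⟩ := exists_eval_ne_zero_subset hp
  -- Restrict p to the line u ↦ a + u w. The restriction is a polynomial in u, and its linear
  -- coefficient is the pairing of c with w.
  have hc0 : c = 0 := by
    refine hspan c fun w hw => ?_
    let Φ : MvPolynomial ι ℂ →ₐ[ℂ] Polynomial ℂ := MvPolynomial.aeval fun j =>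
      Polynomial.C (a j) + Polynomial.X * Polynomial.C (w j)
    have hΦ : ∀ (u : ℂ) (r : MvPolynomial ι ℂ),
        (Φ r).eval u = MvPolynomial.eval (fun j => a j + u * w j) r := by
      intro u r
      induction r using MvPolynomial.induction_on with
      | C z => simp [Φ]
      | add r r' h h' => simp [h, h']
      | mul_X r i h => simp only [map_mul, Polynomial.eval_mul, h]; simp [Φ, mul_comm u]
    have hΦ0 : ∀ r : MvPolynomial ι ℂ, (Φ r).eval 0 = MvPolynomial.eval a r := fun r => by
      rw [hΦ]; simp
    -- On the line, p vanishes where q does not. Since q is nonzero at u = 0, the restriction of p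
    -- is identically zero.
    have hpq : Φ p * Φ q = 0 := by
      refine Polynomial.funext fun u => ?_
      rw [Polynomial.eval_mul, hΦ, hΦ, Polynomial.eval_zero]
      by_cases h0 : MvPolynomial.eval (fun j => a j + u * w j) q = 0
      · rw [h0, mul_zero]
      · have h1 : MvPolynomial.eval (fun j => a j + u * w j) p = 0 := hq _ h0 (hW w hw u)
        rw [h1, zero_mul]
    have hq0 : Φ q ≠ 0 := fun h => hqa (by rw [← hΦ0, h, Polynomial.eval_zero])
    have hp0 := (mul_eq_zero.1 hpq).resolve_right hq0
    have hle : Ideal.map Φ (pointIdeal a) ≤ Ideal.span {Polynomial.X} := by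
      rw [Ideal.map_le_iff_le_comap]
      intro r hr
      rw [Ideal.mem_comap, Ideal.mem_span_singleton, Polynomial.X_dvd_iff,
        Polynomial.coeff_zero_eq_eval_zero]
      exact (hΦ0 r).trans hr
    -- The second-order remainder restricts to a multiple of X², so only the linear part contributes
    -- to the coefficient of X.
    have h2 : Φ (p - MvPolynomial.C (MvPolynomial.eval a p) -
        ∑ j, MvPolynomial.C (c j) * (MvPolynomial.X j - MvPolynomial.C (a j))) ∈
        Ideal.span {(Polynomial.X : Polynomial ℂ)} ^ 2 := by
      refine Ideal.pow_right_mono hle 2 ?_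
      rw [← Ideal.map_pow]
      exact Ideal.mem_map_of_mem _ hc
    rw [Ideal.span_singleton_pow, Ideal.mem_span_singleton, hpa, map_sub, map_sub, hp0] at h2
    have h3 := Polynomial.X_pow_dvd_iff.1 h2 1 one_lt_two
    have h4 : Φ (∑ j, MvPolynomial.C (c j) * (MvPolynomial.X j - MvPolynomial.C (a j))) =
        Polynomial.X * Polynomial.C (∑ j, c j * w j) := by
      simp only [map_sum, map_mul, map_sub, Φ, MvPolynomial.aeval_X, MvPolynomial.aeval_C,
        Finset.mul_sum, Polynomial.algebraMap_eq]
      exact Finset.sum_congr rfl fun j _ => by ring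
    rw [h4] at h3
    simpa using h3
  rw [hc0, hpa] at hc
  have hc' : p ∈ RingHom.ker (MvPolynomial.eval a) ^ 2 := by simpa using hc
  exact hc'

end Taylor

end FunctionSpace

open FunctionSpace

/-! ### Singular points -/

section Singular

variable {m : ℕ}

/-- The squared distances of points on a line. -/
def collinear {n : ℕ} (v : Fin n → ℂ) : CayleyIndex n → ℂ := fun e => (v e.1.1 - v e.1.2) ^ 2

theorem symmExtend_collinear {n : ℕ} (v : Fin n → ℂ) (i j : Fin n) :
    symmExtend (collinear v) i j = (v i - v j) ^ 2 := by
  rcases lt_trichotomy i j with h | h | h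
  · simp [symmExtend, h, collinear]
  · subst h; simp [symmExtend_self]
  · simp only [symmExtend, h, h.not_gt, collinear, dif_pos, dif_neg, not_false_eq_true]
    ring

theorem gram_collinear (v : Fin (m + 1) → ℂ) : gram (collinear v) =
    Matrix.vecMulVec (fun i : Fin m => v i.succ - v 0) (fun i : Fin m => v i.succ - v 0) := by
  ext i j
  simp only [gram, Matrix.of_apply, symmExtend_collinear, Matrix.vecMulVec_apply]
  ring

/-- Polarization of the squares (v_a - v_b)². It shows that squared distances of collinear points,
whose Gram matrices have rank at most one, span all coordinate vectors. -/
theorem single_eq_collinear {n : ℕ} (e : CayleyIndex n) :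
    (Pi.single e 1 : CayleyIndex n → ℂ) = (1 / 2 : ℂ) • (collinear (Pi.single e.1.1 1) +
      collinear (Pi.single e.1.2 1) -
      collinear (Pi.single e.1.1 1 + Pi.single e.1.2 1)) := by
  obtain ⟨⟨i, j⟩, hij⟩ := e
  ext ⟨⟨a, b⟩, hab⟩
  dsimp only at hij hab ⊢
  simp only [Pi.smul_apply, Pi.sub_apply, Pi.add_apply, collinear, Pi.single_apply, smul_eq_mul,
    Subtype.mk.injEq, Prod.mk.injEq]
  have hne : ¬ i = j := hij.ne
  have hne' : ¬ j = i := hij.ne'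
  by_cases h1 : a = i <;> by_cases h2 : b = j <;> by_cases h3 : a = j <;> by_cases h4 : b = i <;>
    simp only [h1, h2, h3, h4, hne, hne', if_true, if_false, and_true, and_false, and_self] <;>
    first
      | (exfalso; omega)
      | norm_num

/-- The squared distances of 0, e_1, …, e_m are 1 or 2, so this nondegenerate form lies in every
coordinate chart of projective space. -/
theorem distOf_one_ne_zero (e : CayleyIndex (m + 1)) :
    distOf (1 : Matrix (Fin m) (Fin m) ℂ) e ≠ 0 := by
  obtain ⟨⟨i, j⟩, h⟩ := e
  dsimp only [distOf] at h ⊢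
  induction j using Fin.cases with
  | zero => exact absurd h (Fin.not_lt_zero i)
  | succ j =>
    induction i using Fin.cases with
    | zero => simp
    | succ i =>
      have : i ≠ j := fun h' => by simp [h'] at h
      simp [this, this.symm]

theorem affineLift_div {ι : Type} [DecidableEq ι] (e : ι) {s : ι → ℂ} (hs : s e ≠ 0) :
    affineLift e (fun j => s j / s e) = (s e)⁻¹ • s := by
  ext j
  by_cases h : j = e
  · subst h; simp [affineLift, hs]
  · simp [affineLift, h, div_eq_inv_mul]

theorem rank_gram_rep_mk (s : CayleyIndex (m + 1) → ℂ) (hs : s ≠ 0) :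
    (gram (Projectivization.mk ℂ s hs).rep).rank = (gram s).rank := by
  obtain ⟨a, ha, h⟩ := rep_mk_eq s hs
  rw [h, rank_gram_smul ha]

theorem matrix_rank_add_le (P Q : Matrix (Fin m) (Fin m) ℂ) :
    (P + Q).rank ≤ P.rank + Q.rank := by
  have h : LinearMap.range (P + Q).mulVecLin ≤
      LinearMap.range P.mulVecLin ⊔ LinearMap.range Q.mulVecLin := by
    rintro _ ⟨v, rfl⟩
    rw [Matrix.mulVecLin_apply, Matrix.add_mulVec]
    exact Submodule.add_mem_sup ⟨v, rfl⟩ ⟨v, rfl⟩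
  exact (Submodule.finrank_mono h).trans (Submodule.finrank_add_le_finrank_add_finrank _ _)

theorem rank_smul_le (u : ℂ) (Q : Matrix (Fin m) (Fin m) ℂ) : (u • Q).rank ≤ Q.rank := by
  have h : u • Q = (u • (1 : Matrix (Fin m) (Fin m) ℂ)) * Q := by simp
  rw [h]
  exact Matrix.rank_mul_le_right _ _

/-- The variety of matrices of rank at most `d` is singular at the matrices of smaller rank. -/
theorem singular_of_rank_lt {d : ℕ} (hdm : d < m) (x : (cayleyMenger d (m + 1)).Pt)
    (hx : (gram (Projectivization.rep x.1)).rank < d) :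
    ¬ (cayleyMenger d (m + 1)).Nonsingular x := by
  classical
  intro hns
  obtain ⟨e, he⟩ := exists_rep_ne_zero x.1
  let T : Set (affineSpace {j : CayleyIndex (m + 1) // j ≠ e}).Pt :=
    {a | (gram (affineLift e a)).rank ≤ d}
  let a₀ : (affineSpace {j : CayleyIndex (m + 1) // j ≠ e}).Pt := affineCoord e x.1
  have hlift : affineLift e a₀ = (Projectivization.rep x.1 e)⁻¹ • Projectivization.rep x.1 :=
    affineLift_affineCoord e x.1 he
  have hrk : (gram (affineLift e a₀)).rank < d := by
    rw [hlift, rank_gram_smul (inv_ne_zero he)]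
    exact hx
  have ha₀ : a₀ ∈ T := hrk.le
  have hloc : LocIso ((affineSpace {j : CayleyIndex (m + 1) // j ≠ e}).restrict T)
      (cayleyMenger d (m + 1)) ⟨a₀, ha₀⟩ x := by
    refine locIso_restrict (X := affineSpace {j : CayleyIndex (m + 1) // j ≠ e})
      (Y := projectiveSpace (CayleyIndex (m + 1)))
      (fun a => Projectivization.mk ℂ (affineLift e a) (affineLift_ne_zero _ _))
      (affineCoord e) ha₀ x.2 (mk_affineLift_affineCoord e x.1 he) rfl
      (Filter.Eventually.of_forall fun a => ⟨morphAt_mk_affineLift e a, affineCoord_mk e a,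
        fun ha => ?_⟩) ?_
    · refine mem_cayleyMengerSet_iff.2 ?_
      rw [rank_gram_rep_mk]
      exact ha
    · filter_upwards [(isOpen_coord_ne_zero e).mem_nhds he] with y hy
      refine ⟨morphAt_affineCoord e y hy, mk_affineLift_affineCoord e y hy, fun hyS => ?_⟩
      have h1 := mem_cayleyMengerSet_iff.1 hyS
      change (gram (affineLift e (affineCoord e y))).rank ≤ d
      rw [affineLift_affineCoord e y hy, rank_gram_smul (inv_ne_zero hy)]
      exact h1
  refine singular_restrict_affineSpace _ ?_ ?_ (hloc.nonsingular hns)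
  · intro p hp
    -- These are the directions obtained by adding u · `collinear v` to the point and subtracting
    -- the multiple of the point that keeps the e-th coordinate equal to 1.
    let W : Set ({j : CayleyIndex (m + 1) // j ≠ e} → ℂ) := Set.range fun v : Fin (m + 1) → ℂ =>
      fun j => collinear v j.1 - collinear v e * a₀ j
    refine mem_pointIdeal_sq_of_lines (W := W) ha₀ ?_ ?_ hp
    · rintro _ ⟨v, rfl⟩ u
      have h1 : affineLift e (fun j => a₀ j + u * (collinear v j.1 - collinear v e * a₀ j)) =
          (1 - u * collinear v e) • affineLift e a₀ + u • collinear v := by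
        ext j
        by_cases h : j = e
        · subst h
          simp [affineLift]
        · simp [affineLift, h]
          ring
      change (gram (affineLift e _)).rank ≤ d
      rw [h1, gram_add, gram_smul, gram_smul]
      -- A form of rank less than d plus a form of rank at most one has rank at most d.
      refine (matrix_rank_add_le _ _).trans ?_
      have h2 := rank_smul_le (1 - u * collinear v e) (gram (affineLift e a₀))
      have h3 := rank_smul_le u (gram (collinear v))
      have h4 : (gram (collinear v)).rank ≤ 1 := by
        rw [gram_collinear]
        exact Matrix.rank_vecMulVec_le _ _
      omega
    · intro c hc
      -- The hypothesis on c says that `ℓ` kills every `collinear v`, hence every coordinate vector.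
      -- Its value at the j-th one, j ≠ e, is `c j`.
      let ℓ : (CayleyIndex (m + 1) → ℂ) →ₗ[ℂ] ℂ :=
        ∑ j : {j : CayleyIndex (m + 1) // j ≠ e},
          c j • (LinearMap.proj j.1 - a₀ j • LinearMap.proj e)
      have hℓ : ∀ σ, ℓ σ = ∑ j : {j : CayleyIndex (m + 1) // j ≠ e},
          c j * (σ j.1 - σ e * a₀ j) := by
        intro σ
        simp only [ℓ, LinearMap.sum_apply, LinearMap.smul_apply, LinearMap.sub_apply,
          LinearMap.proj_apply, smul_eq_mul]
        exact Finset.sum_congr rfl fun j _ => by ring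
      have h0 : ∀ v, ℓ (collinear v) = 0 := fun v => (hℓ _).trans (hc _ ⟨v, rfl⟩)
      ext j
      have h1 : ℓ (Pi.single j.1 1) = 0 := by
        rw [single_eq_collinear, map_smul, map_sub, map_add, h0, h0, h0]
        simp
      rw [hℓ, Finset.sum_eq_single j] at h1
      · simpa [Pi.single_apply, j.2.symm] using h1
      · intro i _ hij
        have : i.1 ≠ j.1 := fun h => hij (Subtype.ext h)
        simp [this, j.2.symm]
      · simp
  -- The dehomogenized determinant vanishes on `T` because d < m, and is nonzero at the identity
  -- form.
  · let D : MvPolynomial (CayleyIndex (m + 1)) ℂ :=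
      Matrix.det (Matrix.of fun i j : Fin m => gramPoly (id i) (id j))
    let lift : CayleyIndex (m + 1) → MvPolynomial {j : CayleyIndex (m + 1) // j ≠ e} ℂ :=
      fun j => if h : j ≠ e then MvPolynomial.X ⟨j, h⟩ else 1
    have hD : ∀ a : {j : CayleyIndex (m + 1) // j ≠ e} → ℂ,
        MvPolynomial.eval a (MvPolynomial.bind₁ lift D) = (gram (affineLift e a)).det := by
      intro a
      have h1 : (fun j => MvPolynomial.eval a (lift j)) = affineLift e a := by
        ext j
        by_cases h : j = e
        · simp [lift, affineLift, h]
        · simp [lift, affineLift, h]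
      refine (MvPolynomial.eval₂Hom_bind₁ (RingHom.id ℂ) a lift D).trans ?_
      have h2 := eval_det_gramPoly (id : Fin m → Fin m) id (affineLift e a)
      rw [Matrix.submatrix_id_id, ← h1] at h2
      rw [← h1]
      exact h2
    refine ⟨MvPolynomial.bind₁ lift D, fun h => ?_, fun y hy => ?_⟩
    · have h1 := hD fun j => distOf 1 j.1 / distOf 1 e
      rw [h, map_zero, affineLift_div e (distOf_one_ne_zero e), gram_smul,
        gram_distOf Matrix.transpose_one, Matrix.det_smul, Matrix.det_one, mul_one] at h1
      exact pow_ne_zero _ (inv_ne_zero (distOf_one_ne_zero e)) h1.symm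
    · refine (hD y).trans ?_
      by_contra h0
      have h1 := Matrix.rank_of_isUnit _ ((Matrix.isUnit_iff_isUnit_det _).2 (IsUnit.mk0 _ h0))
      rw [Fintype.card_fin] at h1
      have h2 : (gram (affineLift e y)).rank ≤ d := hy
      omega

end Singular

/-! ### The incidence variety -/

section Incidence

variable {k d m : ℕ}

/-- Pairs of a `k`-dimensional subspace `L` and a point `[s]` such that `L` is contained in the
kernel of the Gram matrix of `s`. -/
def IncidencePt (k m : ℕ) : Type :=
  {q : Subspaces k m × ℙ ℂ (CayleyIndex (m + 1) → ℂ) // ∀ v ∈ q.1.1, (gram q.2.rep).mulVec v = 0}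

/-- The index set of the coordinates of the ambient projective space of the incidence variety. -/
abbrev PluckerIndex (k m : ℕ) : Type := (Fin k → Fin m) × CayleyIndex (m + 1)

/-- The products of the maximal minors of `v` with the coordinates of `s`. -/
def segreVec (v : Matrix (Fin k) (Fin m) ℂ) (s : CayleyIndex (m + 1) → ℂ) :
    PluckerIndex k m → ℂ := fun z => (v.submatrix id z.1).det * s z.2

theorem segreVec_ne_zero {v : Matrix (Fin k) (Fin m) ℂ} (hv : LinearIndependent ℂ v.row)
    {s : CayleyIndex (m + 1) → ℂ} (hs : s ≠ 0) : segreVec v s ≠ 0 := by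
  obtain ⟨c, -, hc⟩ := exists_submatrix_det_ne_zero v hv
  obtain ⟨e, he⟩ := Function.ne_iff.1 hs
  exact fun h => mul_ne_zero hc he (congrFun h (c, e))

/-- The embedding of the incidence variety by Plücker and Segre coordinates. -/
noncomputable def incidenceEmbed (q : IncidencePt k m) :
    (projectiveSpace (PluckerIndex k m)).Pt :=
  Projectivization.mk ℂ (segreVec (frame q.1.1) q.1.2.rep)
    (segreVec_ne_zero (linearIndependent_frame _) q.1.2.rep_nonzero)

theorem linearIndependent_of_span_eq {L : Subspaces k m} {v : Matrix (Fin k) (Fin m) ℂ}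
    (hL : Submodule.span ℂ (Set.range v.row) = L.1) : LinearIndependent ℂ v.row := by
  obtain ⟨g, -, h⟩ := exists_frame_eq_mul hL
  obtain ⟨c, -, hc⟩ := exists_submatrix_det_ne_zero _ (linearIndependent_frame L)
  rw [h, submatrix_mul_id, Matrix.det_mul] at hc
  exact linearIndependent_of_submatrix_det_ne_zero (right_ne_zero_of_mul hc)

theorem mk_segreVec_eq {L : Subspaces k m} {v : Matrix (Fin k) (Fin m) ℂ}
    (hL : Submodule.span ℂ (Set.range v.row) = L.1) {s t : CayleyIndex (m + 1) → ℂ} {a : ℂ}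
    (ht : t = a • s) (h1 : segreVec (frame L) t ≠ 0) (h2 : segreVec v s ≠ 0) :
    Projectivization.mk ℂ (segreVec (frame L) t) h1 = Projectivization.mk ℂ (segreVec v s) h2 := by
  obtain ⟨g, hg, h⟩ := exists_frame_eq_mul hL
  rw [Projectivization.mk_eq_mk_iff']
  refine ⟨g.det * a, ?_⟩
  ext z
  simp only [segreVec, h, ht, submatrix_mul_id, Matrix.det_mul, Pi.smul_apply, smul_eq_mul]
  ring

/-- A change of frame multiplies all maximal minors by one determinant, so the embedding can be
computed from any frame and any representative. -/
theorem incidenceEmbed_eq (q : IncidencePt k m) {v : Matrix (Fin k) (Fin m) ℂ}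
    (hL : Submodule.span ℂ (Set.range v.row) = q.1.1.1)
    {s : CayleyIndex (m + 1) → ℂ} (hs : s ≠ 0) (hx : q.1.2 = Projectivization.mk ℂ s hs) :
    incidenceEmbed q = Projectivization.mk ℂ (segreVec v s)
      (segreVec_ne_zero (linearIndependent_of_span_eq hL) hs) := by
  obtain ⟨a, -, h⟩ := rep_mk_eq s hs
  exact mk_segreVec_eq hL (by rw [hx, h]) _ _

/-- The incidence variety. -/
noncomputable def incidence (k m : ℕ) : FunctionSpace :=
  (projectiveSpace (PluckerIndex k m)).induced incidenceEmbed

/-- The matrix of quotients of Plücker coordinates. -/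
noncomputable def coordFrame (c : Fin k → Fin m) (e : CayleyIndex (m + 1))
    (z : ℙ ℂ (PluckerIndex k m → ℂ)) : Matrix (Fin k) (Fin m) ℂ :=
  Matrix.of fun i j => z.rep (Function.update c i j, e) / z.rep (c, e)

/-- The quotients of the coordinates of the second factor. -/
noncomputable def coordDist (c : Fin k → Fin m) (e : CayleyIndex (m + 1))
    (z : ℙ ℂ (PluckerIndex k m → ℂ)) : CayleyIndex (m + 1) → ℂ :=
  fun e' => z.rep (c, e') / z.rep (c, e)

theorem coordDist_ne_zero {c : Fin k → Fin m} {e : CayleyIndex (m + 1)}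
    {z : ℙ ℂ (PluckerIndex k m → ℂ)} (h : z.rep (c, e) ≠ 0) : coordDist c e z ≠ 0 := fun h0 =>
  one_ne_zero ((div_self h).symm.trans (congrFun h0 e))

theorem incidenceEmbed_rep_ne_zero_iff (q : IncidencePt k m) (c : Fin k → Fin m)
    (e : CayleyIndex (m + 1)) :
    Projectivization.rep (incidenceEmbed q) (c, e) ≠ 0 ↔ InChart c q.1.1 ∧ q.1.2.rep e ≠ 0 := by
  obtain ⟨a, ha, h⟩ := rep_mk_eq (segreVec (frame q.1.1) q.1.2.rep)
    (segreVec_ne_zero (linearIndependent_frame _) q.1.2.rep_nonzero)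
  rw [incidenceEmbed, h]
  simp [segreVec, ha, InChart]

/-- Cramer's rule for the identity matrix. It reads the entries of a normalized frame off its
Plücker coordinates, which justifies the form of `coordFrame`. -/
theorem det_submatrix_update {v : Matrix (Fin k) (Fin m) ℂ} {c : Fin k → Fin m}
    (h : v.submatrix id c = 1) (i : Fin k) (j : Fin m) :
    (v.submatrix id (Function.update c i j)).det = v i j := by
  have h1 : v.submatrix id (Function.update c i j) =
      (v.submatrix id c).updateCol i (fun l => v l j) := by
    ext a b
    by_cases hb : b = i
    · subst hb; simp
    · simp [hb]
  rw [h1, h, ← Matrix.cramer_apply, Matrix.cramer_one]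
  rfl

theorem incidenceEmbed_eq_normalFrame (q : IncidencePt k m) {c : Fin k → Fin m}
    (hc : InChart c q.1.1) : incidenceEmbed q =
      Projectivization.mk ℂ (segreVec (normalFrame c q.1.1) q.1.2.rep) (segreVec_ne_zero
        (linearIndependent_of_submatrix_eq_one (normalFrame_submatrix hc)) q.1.2.rep_nonzero) :=
  incidenceEmbed_eq q (span_normalFrame hc) _ q.1.2.mk_rep.symm

theorem coordFrame_incidenceEmbed (q : IncidencePt k m) {c : Fin k → Fin m}
    {e : CayleyIndex (m + 1)} (hc : InChart c q.1.1) (he : q.1.2.rep e ≠ 0) :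
    coordFrame c e (incidenceEmbed q) = normalFrame c q.1.1 := by
  have hn := normalFrame_submatrix hc
  obtain ⟨a, ha, h⟩ := rep_mk_eq (segreVec (normalFrame c q.1.1) q.1.2.rep) (segreVec_ne_zero
        (linearIndependent_of_submatrix_eq_one hn) q.1.2.rep_nonzero)
  rw [incidenceEmbed_eq_normalFrame q hc]
  ext i j
  simp only [coordFrame, Matrix.of_apply, h, Pi.smul_apply, smul_eq_mul, segreVec,
    det_submatrix_update hn, hn, Matrix.det_one]
  field_simp

theorem coordDist_incidenceEmbed (q : IncidencePt k m) {c : Fin k → Fin m}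
    {e : CayleyIndex (m + 1)} (hc : InChart c q.1.1) :
    coordDist c e (incidenceEmbed q) = (q.1.2.rep e)⁻¹ • q.1.2.rep := by
  have hn := normalFrame_submatrix hc
  obtain ⟨a, ha, h⟩ := rep_mk_eq (segreVec (normalFrame c q.1.1) q.1.2.rep) (segreVec_ne_zero
        (linearIndependent_of_submatrix_eq_one hn) q.1.2.rep_nonzero)
  rw [incidenceEmbed_eq_normalFrame q hc]
  ext e'
  simp only [coordDist, h, Pi.smul_apply, smul_eq_mul, segreVec, hn, Matrix.det_one, one_mul]
  rw [mul_div_mul_left _ _ ha, div_eq_inv_mul]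

theorem mk_coordDist_incidenceEmbed (q : IncidencePt k m) {c : Fin k → Fin m}
    {e : CayleyIndex (m + 1)} (h : Projectivization.rep (incidenceEmbed q) (c, e) ≠ 0) :
    Projectivization.mk ℂ (coordDist c e (incidenceEmbed q)) (coordDist_ne_zero h) = q.1.2 := by
  obtain ⟨hc, -⟩ := (incidenceEmbed_rep_ne_zero_iff q c e).1 h
  conv_rhs => rw [← q.1.2.mk_rep]
  rw [Projectivization.mk_eq_mk_iff']
  exact ⟨_, (coordDist_incidenceEmbed q hc).symm⟩

theorem incidenceEmbed_injective : Function.Injective (incidenceEmbed (k := k) (m := m)) := by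
  intro q q' h
  obtain ⟨⟨c, e⟩, hz⟩ := exists_rep_ne_zero (incidenceEmbed q)
  have hz' : Projectivization.rep (incidenceEmbed q') (c, e) ≠ 0 := h ▸ hz
  obtain ⟨hc, he⟩ := (incidenceEmbed_rep_ne_zero_iff q c e).1 hz
  obtain ⟨hc', he'⟩ := (incidenceEmbed_rep_ne_zero_iff q' c e).1 hz'
  have h1 : normalFrame c q.1.1 = normalFrame c q'.1.1 := by
    rw [← coordFrame_incidenceEmbed q hc he, ← coordFrame_incidenceEmbed q' hc' he', h]
  refine Subtype.ext (Prod.ext (Subtype.ext ?_) ?_)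
  · rw [← span_normalFrame hc, ← span_normalFrame hc', h1]
  · rw [← mk_coordDist_incidenceEmbed q hz, ← mk_coordDist_incidenceEmbed q' hz']
    congr 2

theorem regAt_coordFrame {c : Fin k → Fin m} {e : CayleyIndex (m + 1)}
    {z : (projectiveSpace (PluckerIndex k m)).Pt} (hz : Projectivization.rep z (c, e) ≠ 0)
    (i : Fin k) (j : Fin m) :
    (projectiveSpace (PluckerIndex k m)).RegAt z (fun w => coordFrame c e w i j) :=
  regAt_coord_div (c, e) (Function.update c i j, e) z hz

theorem regAt_coordDist {c : Fin k → Fin m} {e : CayleyIndex (m + 1)}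
    {z : (projectiveSpace (PluckerIndex k m)).Pt} (hz : Projectivization.rep z (c, e) ≠ 0)
    (e' : CayleyIndex (m + 1)) :
    (projectiveSpace (PluckerIndex k m)).RegAt z (fun w => coordDist c e w e') :=
  regAt_coord_div (c, e) (c, e') z hz

theorem regAt_symmExtend {X : FunctionSpace} {x : X.Pt} {n : ℕ} {s : X.Pt → CayleyIndex n → ℂ}
    (h : ∀ e, X.RegAt x (fun y => s y e)) (i j : Fin n) :
    X.RegAt x (fun y => symmExtend (s y) i j) := by
  unfold symmExtend
  split_ifs
  · exact h _
  · exact h _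
  · exact X.const x 0

theorem regAt_gram {X : FunctionSpace} {x : X.Pt} {s : X.Pt → CayleyIndex (m + 1) → ℂ}
    (h : ∀ e, X.RegAt x (fun y => s y e)) (i j : Fin m) :
    X.RegAt x (fun y => gram (s y) i j) :=
  RegAt.fun_div (RegAt.fun_sub (RegAt.fun_add (regAt_symmExtend h _ _) (regAt_symmExtend h _ _))
    (regAt_symmExtend h _ _)) (X.const x 2) two_ne_zero

theorem regAt_distOf {X : FunctionSpace} {x : X.Pt} {Q : X.Pt → Matrix (Fin m) (Fin m) ℂ}
    (h : ∀ i j, X.RegAt x (fun y => Q y i j)) (e : CayleyIndex (m + 1)) :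
    X.RegAt x (fun y => distOf (Q y) e) := by
  have h1 : ∀ i j, X.RegAt x (fun y => padZero (Q y) i j) := by
    intro i j
    refine Fin.cases (X.const x 0) (fun i => ?_) i
    refine Fin.cases (X.const x 0) (fun j => ?_) j
    exact h i j
  exact RegAt.fun_sub (RegAt.fun_sub (RegAt.fun_add (h1 _ _) (h1 _ _)) (h1 _ _)) (h1 _ _)

/-- The image of the incidence variety is described by equations on each coordinate chart. -/
theorem mem_range_incidenceEmbed_iff {c : Fin k → Fin m} {e : CayleyIndex (m + 1)}
    {z : (projectiveSpace (PluckerIndex k m)).Pt} (hz : Projectivization.rep z (c, e) ≠ 0) :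
    z ∈ Set.range (incidenceEmbed (k := k) (m := m)) ↔
      (∀ w, Projectivization.rep z w / Projectivization.rep z (c, e) -
        segreVec (coordFrame c e z) (coordDist c e z) w = 0) ∧
      ∀ i j, (gram (coordDist c e z) * (coordFrame c e z).transpose) i j = 0 := by
  constructor
  · rintro ⟨q, rfl⟩
    obtain ⟨hc, he⟩ := (incidenceEmbed_rep_ne_zero_iff q c e).1 hz
    have hn := normalFrame_submatrix hc
    rw [coordFrame_incidenceEmbed q hc he, coordDist_incidenceEmbed q hc]
    constructor
    · intro w
      obtain ⟨a, ha, h⟩ := rep_mk_eq (segreVec (normalFrame c q.1.1) q.1.2.rep) (segreVec_ne_zero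
        (linearIndependent_of_submatrix_eq_one hn) q.1.2.rep_nonzero)
      rw [incidenceEmbed_eq_normalFrame q hc, h]
      simp only [segreVec, Pi.smul_apply, smul_eq_mul, hn, Matrix.det_one]
      field_simp
      ring
    · intro i j
      have h1 : (normalFrame c q.1.1).row j ∈ q.1.1.1 := by
        rw [← span_normalFrame hc]
        exact Submodule.subset_span ⟨j, rfl⟩
      have h2 := congrFun (q.2 _ h1) i
      rw [gram_smul, Matrix.smul_mul, Matrix.smul_apply]
      have h3 : (gram q.1.2.rep * (normalFrame c q.1.1).transpose) i j = 0 := h2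
      rw [h3, smul_zero]
  · rintro ⟨h1, h2⟩
    -- The equation for the index (c, e) itself says that the pivot minor is 1, which makes the rows
    -- independent.
    have hdet : ((coordFrame c e z).submatrix id c).det = 1 := by
      have := h1 (c, e)
      simp only [segreVec, coordDist, div_self hz] at this
      linear_combination -this
    have hli : LinearIndependent ℂ (coordFrame c e z).row :=
      linearIndependent_of_submatrix_det_ne_zero (c := c) (by rw [hdet]; exact one_ne_zero)
    have hs := coordDist_ne_zero hz
    obtain ⟨a, ha, h⟩ := rep_mk_eq (coordDist c e z) hs
    let q : IncidencePt k m := ⟨(rowSpace (coordFrame c e z) hli,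
      Projectivization.mk ℂ (coordDist c e z) hs), by
      intro v hv
      have hv' : v ∈ Submodule.span ℂ (Set.range (coordFrame c e z).row) := hv
      dsimp only
      rw [h, gram_smul, Matrix.smul_mulVec]
      have hle : Submodule.span ℂ (Set.range (coordFrame c e z).row) ≤
          LinearMap.ker (gram (coordDist c e z)).mulVecLin := by
        rw [Submodule.span_le]
        rintro _ ⟨j, rfl⟩
        exact funext fun i => h2 i j
      have h3 : (gram (coordDist c e z)).mulVec v = 0 := hle hv'
      rw [h3, smul_zero]⟩
    refine ⟨q, ?_⟩
    refine (incidenceEmbed_eq q (v := coordFrame c e z) rfl hs rfl).trans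
      (Eq.trans ?_ (Projectivization.mk_rep z))
    refine (Projectivization.mk_eq_mk_iff' ℂ _ _ _ _).2 ⟨(Projectivization.rep z (c, e))⁻¹, ?_⟩
    ext w
    have := h1 w
    rw [Pi.smul_apply, smul_eq_mul, ← div_eq_inv_mul]
    exact sub_eq_zero.1 this

/-- On each coordinate chart the range is the common zero set of regular functions, so a violated
equation stays violated nearby. -/
theorem isClosed_range_incidenceEmbed :
    IsClosed (Set.range (incidenceEmbed (k := k) (m := m))) := by
  rw [← isOpen_compl_iff, isOpen_iff_mem_nhds]
  intro z hz
  obtain ⟨⟨c, e⟩, hze⟩ := exists_rep_ne_zero z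
  have hnear := (isOpen_coord_ne_zero (c, e)).mem_nhds hze
  rw [Set.mem_compl_iff, mem_range_incidenceEmbed_iff hze, not_and_or] at hz
  rcases hz with hz | hz
  · push Not at hz
    obtain ⟨w, hw⟩ := hz
    have hreg : (projectiveSpace (PluckerIndex k m)).RegAt z (fun z =>
        Projectivization.rep z w / Projectivization.rep z (c, e) -
        segreVec (coordFrame c e z) (coordDist c e z) w) :=
      RegAt.fun_sub (regAt_coord_div _ _ z hze) (RegAt.fun_mul
        (RegAt.det fun i j => regAt_coordFrame hze _ _) (regAt_coordDist hze _))
    filter_upwards [FunctionSpace.ne_zero _ hreg hw, hnear] with y hy hye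
    rw [Set.mem_compl_iff, mem_range_incidenceEmbed_iff hye]
    exact fun h => hy (h.1 w)
  · push Not at hz
    obtain ⟨i, j, hij⟩ := hz
    have hreg : (projectiveSpace (PluckerIndex k m)).RegAt z (fun z =>
        (gram (coordDist c e z) * (coordFrame c e z).transpose) i j) :=
      RegAt.matrix_mul (A := fun z : (projectiveSpace (PluckerIndex k m)).Pt =>
          gram (coordDist c e z))
        (B := fun z : (projectiveSpace (PluckerIndex k m)).Pt => (coordFrame c e z).transpose)
        (regAt_gram (regAt_coordDist hze)) (fun i j => regAt_coordFrame hze j i) i j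
    filter_upwards [FunctionSpace.ne_zero _ hreg hij, hnear] with y hy hye
    rw [Set.mem_compl_iff, mem_range_incidenceEmbed_iff hye]
    exact fun h => hy (h.2 i j)

/-! ### Maps to and from the incidence variety -/

theorem morphAt_incidence {Z : FunctionSpace} {φ : Z.Pt → (incidence k m).Pt} {z : Z.Pt}
    (v : Z.Pt → Matrix (Fin k) (Fin m) ℂ) (s : Z.Pt → CayleyIndex (m + 1) → ℂ)
    (hv : ∀ i j, Z.RegAt z (fun y => v y i j)) (hs : ∀ e, Z.RegAt z (fun y => s y e))
    (h : ∀ᶠ y in 𝓝 z, Submodule.span ℂ (Set.range (v y).row) = (φ y).1.1.1 ∧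
      ∃ h : s y ≠ 0, (φ y).1.2 = Projectivization.mk ℂ (s y) h) :
    MorphAt Z (incidence k m) φ z := by
  refine morphAt_induced (morphAt_projectiveSpace (fun y => segreVec (v y) (s y)) (fun w => ?_) ?_)
  · exact RegAt.fun_mul (RegAt.det fun i j => hv _ _) (hs _)
  · filter_upwards [h] with y hy
    obtain ⟨h1, h2, h3⟩ := hy
    exact ⟨_, incidenceEmbed_eq _ h1 h2 h3⟩

theorem incidence_eventually {c : Fin k → Fin m} {e : CayleyIndex (m + 1)}
    {q : (incidence k m).Pt} (hq : Projectivization.rep (incidenceEmbed q) (c, e) ≠ 0) :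
    ∀ᶠ y : (incidence k m).Pt in 𝓝 q, Projectivization.rep (incidenceEmbed y) (c, e) ≠ 0 :=
  (morphAt_induced_dom incidenceEmbed q).tendsto.eventually
    ((isOpen_coord_ne_zero (c, e)).mem_nhds hq)

/-- The projection of the incidence variety to the Grassmannian. -/
def incidenceBase (q : (incidence k m).Pt) : (grassmannian k m).Pt := q.1.1

/-- The projection of the incidence variety to projective space. -/
def incidencePoint (q : (incidence k m).Pt) : (projectiveSpace (CayleyIndex (m + 1))).Pt := q.1.2

theorem morphAt_incidenceBase (q : (incidence k m).Pt) :
    MorphAt (incidence k m) (grassmannian k m) incidenceBase q := by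
  obtain ⟨⟨c, e⟩, hz⟩ := exists_rep_ne_zero (incidenceEmbed q)
  refine morphAt_grassmannian (fun y => coordFrame c e (incidenceEmbed y))
    (fun i j => (morphAt_induced_dom incidenceEmbed q).regAt (regAt_coordFrame hz i j)) ?_
  filter_upwards [incidence_eventually hz] with y hy
  obtain ⟨hc, he⟩ := (incidenceEmbed_rep_ne_zero_iff y c e).1 hy
  have h1 := coordFrame_incidenceEmbed y hc he
  have h2 : Submodule.span ℂ (Set.range (coordFrame c e (incidenceEmbed y)).row) = y.1.1.1 := by
    rw [h1, span_normalFrame hc]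
  exact ⟨linearIndependent_of_span_eq h2, Subtype.ext h2.symm⟩

theorem morphAt_incidencePoint (q : (incidence k m).Pt) :
    MorphAt (incidence k m) (projectiveSpace (CayleyIndex (m + 1))) incidencePoint q := by
  obtain ⟨⟨c, e⟩, hz⟩ := exists_rep_ne_zero (incidenceEmbed q)
  refine morphAt_projectiveSpace (fun y => coordDist c e (incidenceEmbed y))
    (fun j => (morphAt_induced_dom incidenceEmbed q).regAt (regAt_coordDist hz j)) ?_
  filter_upwards [incidence_eventually hz] with y hy
  exact ⟨coordDist_ne_zero hy, (mk_coordDist_incidenceEmbed y hy).symm⟩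

/-! ### Ranks and kernels -/

theorem rank_le_of_le_ker (hkd : k + d = m) {Q : Matrix (Fin m) (Fin m) ℂ} (L : Subspaces k m)
    (h : ∀ v ∈ L.1, Q.mulVec v = 0) : Q.rank ≤ d := by
  have h1 : L.1 ≤ LinearMap.ker Q.mulVecLin := fun v hv => h v hv
  have h2 := Submodule.finrank_mono h1
  have h3 := LinearMap.finrank_range_add_finrank_ker Q.mulVecLin
  rw [L.2] at h2
  rw [Module.finrank_fin_fun] at h3
  change Module.finrank ℂ (LinearMap.range Q.mulVecLin) ≤ d
  omega

/-- By rank–nullity the kernel has dimension at least k. Together with `rank_le_of_le_ker` this says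
that the incidence variety maps onto the locus of rank at most d. -/
theorem exists_le_ker_of_rank_le (hkd : k + d = m) {Q : Matrix (Fin m) (Fin m) ℂ}
    (h : Q.rank ≤ d) : ∃ L : Subspaces k m, ∀ v ∈ L.1, Q.mulVec v = 0 := by
  have h3 := LinearMap.finrank_range_add_finrank_ker Q.mulVecLin
  rw [Module.finrank_fin_fun] at h3
  change Module.finrank ℂ (LinearMap.range Q.mulVecLin) ≤ d at h
  have hk : k ≤ Module.finrank ℂ (LinearMap.ker Q.mulVecLin) := by omega
  let b := Module.finBasis ℂ (LinearMap.ker Q.mulVecLin)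
  let v : Matrix (Fin k) (Fin m) ℂ := Matrix.of fun i => (b (Fin.castLE hk i)).1
  have hv : LinearIndependent ℂ v.row :=
    (b.linearIndependent.map' (LinearMap.ker Q.mulVecLin).subtype (Submodule.ker_subtype _)).comp
      (Fin.castLE hk) (Fin.castLE_injective hk)
  refine ⟨rowSpace v hv, fun w hw => ?_⟩
  have hle : Submodule.span ℂ (Set.range v.row) ≤ LinearMap.ker Q.mulVecLin := by
    rw [Submodule.span_le]
    rintro _ ⟨i, rfl⟩
    exact (b (Fin.castLE hk i)).2
  exact hle hw

theorem incidencePoint_mem (hkd : k + d = m) (q : (incidence k m).Pt) :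
    incidencePoint q ∈ cayleyMengerSet d (m + 1) :=
  mem_cayleyMengerSet_iff.2 (rank_le_of_le_ker hkd q.1.1 q.2)

/-- The map from the incidence variety to the Cayley–Menger variety. -/
def toCayleyMenger (hkd : k + d = m) (q : (incidence k m).Pt) : (cayleyMenger d (m + 1)).Pt :=
  ⟨incidencePoint q, incidencePoint_mem hkd q⟩

theorem morphAt_toCayleyMenger (hkd : k + d = m) (q : (incidence k m).Pt) :
    MorphAt (incidence k m) (cayleyMenger d (m + 1)) (toCayleyMenger hkd) q :=
  morphAt_restrict (morphAt_incidencePoint q)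

theorem exists_toCayleyMenger_eq (hkd : k + d = m) (x : (cayleyMenger d (m + 1)).Pt) :
    ∃ q : (incidence k m).Pt, toCayleyMenger hkd q = x := by
  obtain ⟨L, hL⟩ := exists_le_ker_of_rank_le hkd (mem_cayleyMengerSet_iff.1 x.2)
  exact ⟨⟨(L, x.1), hL⟩, rfl⟩

end Incidence

/-! ### Quadratic forms with a given kernel -/

section Chart

variable {k d m : ℕ}

/-- For a normalized frame `v`, the matrix of linear forms which vanish on the span of `v`. -/
def coframe (σ : Fin k ⊕ Fin d ≃ Fin m) (v : Matrix (Fin k) (Fin m) ℂ) :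
    Matrix (Fin d) (Fin m) ℂ :=
  Matrix.of fun a j => Sum.elim (fun i => -v i (σ (Sum.inr a)))
    (fun b => (1 : Matrix (Fin d) (Fin d) ℂ) a b) (σ.symm j)

theorem coframe_submatrix (σ : Fin k ⊕ Fin d ≃ Fin m) (v : Matrix (Fin k) (Fin m) ℂ) :
    (coframe σ v).submatrix id (fun a => σ (Sum.inr a)) = 1 := by
  ext a b
  simp [coframe]

theorem coframe_mul_transpose (σ : Fin k ⊕ Fin d ≃ Fin m) {v : Matrix (Fin k) (Fin m) ℂ}
    (hv : v.submatrix id (fun i => σ (Sum.inl i)) = 1) : coframe σ v * v.transpose = 0 := by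
  ext a i
  have h1 : ∀ i', v i (σ (Sum.inl i')) = (1 : Matrix (Fin k) (Fin k) ℂ) i i' := fun i' =>
    congrFun (congrFun hv i) i'
  rw [Matrix.mul_apply, ← σ.sum_comp, Fintype.sum_sum_type]
  simp [coframe, h1, Matrix.one_apply]

/-- Since the pivot columns of `v` form the identity, Q vᵀ = 0 solves for the pivot columns of `Q`
in terms of the remaining ones, with the coefficients collected in `coframe`. -/
theorem eq_mul_coframe (σ : Fin k ⊕ Fin d ≃ Fin m) {v : Matrix (Fin k) (Fin m) ℂ}
    (hv : v.submatrix id (fun i => σ (Sum.inl i)) = 1) {Q : Matrix (Fin m) (Fin m) ℂ}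
    (h : Q * v.transpose = 0) :
    Q = Q.submatrix id (fun a => σ (Sum.inr a)) * coframe σ v := by
  ext l j
  obtain ⟨j, rfl⟩ := σ.surjective j
  rcases j with i | b
  · have h1 : ∀ i', v i (σ (Sum.inl i')) = (1 : Matrix (Fin k) (Fin k) ℂ) i i' := fun i' =>
      congrFun (congrFun hv i) i'
    have h2 := congrFun (congrFun h l) i
    rw [Matrix.mul_apply, ← σ.sum_comp, Fintype.sum_sum_type] at h2
    simp only [Matrix.transpose_apply, h1, Matrix.one_apply, mul_ite, mul_one, mul_zero,
      Finset.sum_ite_eq, Finset.mem_univ, if_true, Matrix.zero_apply] at h2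
    rw [Matrix.mul_apply]
    simp only [coframe, Matrix.submatrix_apply, id, Matrix.of_apply, Equiv.symm_apply_apply,
      Sum.elim_inl, mul_neg, Finset.sum_neg_distrib]
    exact eq_neg_of_add_eq_zero_left h2
  · rw [Matrix.mul_apply]
    simp [coframe, Matrix.one_apply]

/-- Applying `eq_mul_coframe` to columns and, by symmetry, to rows shows that a symmetric form
killing the span of `v` is determined by its block on the d complementary coordinates. With
`submatrix_coframe_mul_mul` this identifies the fibre over a subspace with the forms in d variables.
-/
theorem eq_coframe_mul_mul (σ : Fin k ⊕ Fin d ≃ Fin m) {v : Matrix (Fin k) (Fin m) ℂ}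
    (hv : v.submatrix id (fun i => σ (Sum.inl i)) = 1) {Q : Matrix (Fin m) (Fin m) ℂ}
    (hQ : Q.transpose = Q) (h : Q * v.transpose = 0) :
    Q = (coframe σ v).transpose *
      Q.submatrix (fun a => σ (Sum.inr a)) (fun a => σ (Sum.inr a)) * coframe σ v := by
  have h1 := eq_mul_coframe σ hv h
  have h2 : Q = (coframe σ v).transpose * Q.submatrix (fun a => σ (Sum.inr a)) id := by
    have := congrArg Matrix.transpose h1
    rw [hQ, Matrix.transpose_mul, Matrix.transpose_submatrix, hQ] at this
    exact this
  have h3 : Q.submatrix id (fun a => σ (Sum.inr a)) = (coframe σ v).transpose *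
      Q.submatrix (fun a => σ (Sum.inr a)) (fun a => σ (Sum.inr a)) := by
    conv_lhs => rw [h2]
    rfl
  rw [← h3]
  exact h1

theorem submatrix_coframe_mul_mul (σ : Fin k ⊕ Fin d ≃ Fin m) (v : Matrix (Fin k) (Fin m) ℂ)
    (S : Matrix (Fin d) (Fin d) ℂ) :
    ((coframe σ v).transpose * S * coframe σ v).submatrix
      (fun a => σ (Sum.inr a)) (fun a => σ (Sum.inr a)) = S := by
  have h1 : ((coframe σ v).transpose * S * coframe σ v).submatrix
      (fun a => σ (Sum.inr a)) (fun a => σ (Sum.inr a)) =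
      ((coframe σ v).submatrix id (fun a => σ (Sum.inr a))).transpose * S *
        (coframe σ v).submatrix id (fun a => σ (Sum.inr a)) := rfl
  rw [h1, coframe_submatrix]
  simp

theorem mul_transpose_eq_zero_iff {Q : Matrix (Fin m) (Fin m) ℂ}
    {v : Matrix (Fin k) (Fin m) ℂ} : Q * v.transpose = 0 ↔
      ∀ w ∈ Submodule.span ℂ (Set.range v.row), Q.mulVec w = 0 := by
  constructor
  · intro h w hw
    have hle : Submodule.span ℂ (Set.range v.row) ≤ LinearMap.ker Q.mulVecLin := by
      rw [Submodule.span_le]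
      rintro _ ⟨j, rfl⟩
      exact funext fun i => congrFun (congrFun h i) j
    exact hle hw
  · intro h
    ext i j
    exact congrFun (h (v.row j) (Submodule.subset_span ⟨j, rfl⟩)) i

/-- The squared distances of the quadratic form on `ℂ^m` with the span of `v` in its kernel, which
is given on the other coordinates. -/
noncomputable def extendDist (σ : Fin k ⊕ Fin d ≃ Fin m) (v : Matrix (Fin k) (Fin m) ℂ)
    (t : CayleyIndex (d + 1) → ℂ) : CayleyIndex (m + 1) → ℂ :=
  distOf ((coframe σ v).transpose * gram t * coframe σ v)

/-- The squared distances of the restriction of a quadratic form to a coordinate subspace. -/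
noncomputable def restrictDist (σ : Fin k ⊕ Fin d ≃ Fin m) (s : CayleyIndex (m + 1) → ℂ) :
    CayleyIndex (d + 1) → ℂ :=
  distOf ((gram s).submatrix (fun a => σ (Sum.inr a)) (fun a => σ (Sum.inr a)))

theorem gram_extendDist (σ : Fin k ⊕ Fin d ≃ Fin m) (v : Matrix (Fin k) (Fin m) ℂ)
    (t : CayleyIndex (d + 1) → ℂ) :
    gram (extendDist σ v t) = (coframe σ v).transpose * gram t * coframe σ v :=
  gram_distOf (by simp only [Matrix.transpose_mul, Matrix.transpose_transpose, gram_transpose,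
    Matrix.mul_assoc])

theorem gram_restrictDist (σ : Fin k ⊕ Fin d ≃ Fin m) (s : CayleyIndex (m + 1) → ℂ) :
    gram (restrictDist σ s) =
      (gram s).submatrix (fun a => σ (Sum.inr a)) (fun a => σ (Sum.inr a)) :=
  gram_distOf (by rw [Matrix.transpose_submatrix, gram_transpose])

theorem restrictDist_extendDist (σ : Fin k ⊕ Fin d ≃ Fin m) (v : Matrix (Fin k) (Fin m) ℂ)
    (t : CayleyIndex (d + 1) → ℂ) : restrictDist σ (extendDist σ v t) = t := by
  rw [restrictDist, gram_extendDist, submatrix_coframe_mul_mul, distOf_gram]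

theorem extendDist_restrictDist (σ : Fin k ⊕ Fin d ≃ Fin m) {v : Matrix (Fin k) (Fin m) ℂ}
    (hv : v.submatrix id (fun i => σ (Sum.inl i)) = 1) {s : CayleyIndex (m + 1) → ℂ}
    (h : gram s * v.transpose = 0) : extendDist σ v (restrictDist σ s) = s := by
  rw [extendDist, gram_restrictDist, ← eq_coframe_mul_mul σ hv (gram_transpose s) h, distOf_gram]

theorem extendDist_smul (σ : Fin k ⊕ Fin d ≃ Fin m) (v : Matrix (Fin k) (Fin m) ℂ) (a : ℂ)
    (t : CayleyIndex (d + 1) → ℂ) : extendDist σ v (a • t) = a • extendDist σ v t := by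
  rw [extendDist, gram_smul, Matrix.mul_smul, Matrix.smul_mul, distOf_smul, extendDist]

theorem restrictDist_smul (σ : Fin k ⊕ Fin d ≃ Fin m) (a : ℂ) (s : CayleyIndex (m + 1) → ℂ) :
    restrictDist σ (a • s) = a • restrictDist σ s := by
  rw [restrictDist, gram_smul, restrictDist, ← distOf_smul]
  rfl

theorem extendDist_zero (σ : Fin k ⊕ Fin d ≃ Fin m) (v : Matrix (Fin k) (Fin m) ℂ) :
    extendDist σ v 0 = 0 := by
  simpa using extendDist_smul σ v 0 0

theorem restrictDist_zero (σ : Fin k ⊕ Fin d ≃ Fin m) :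
    restrictDist σ (0 : CayleyIndex (m + 1) → ℂ) = 0 := by
  simpa using restrictDist_smul σ 0 0

theorem extendDist_ne_zero (σ : Fin k ⊕ Fin d ≃ Fin m) (v : Matrix (Fin k) (Fin m) ℂ)
    {t : CayleyIndex (d + 1) → ℂ} (ht : t ≠ 0) : extendDist σ v t ≠ 0 := fun h =>
  ht (by rw [← restrictDist_extendDist σ v t, h, restrictDist_zero])

theorem restrictDist_ne_zero (σ : Fin k ⊕ Fin d ≃ Fin m) {v : Matrix (Fin k) (Fin m) ℂ}
    (hv : v.submatrix id (fun i => σ (Sum.inl i)) = 1) {s : CayleyIndex (m + 1) → ℂ}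
    (h : gram s * v.transpose = 0) (hs : s ≠ 0) : restrictDist σ s ≠ 0 := fun h0 =>
  hs (by rw [← extendDist_restrictDist σ hv h, h0, extendDist_zero])

theorem gram_extendDist_mul_transpose (σ : Fin k ⊕ Fin d ≃ Fin m)
    {v : Matrix (Fin k) (Fin m) ℂ} (hv : v.submatrix id (fun i => σ (Sum.inl i)) = 1)
    (t : CayleyIndex (d + 1) → ℂ) : gram (extendDist σ v t) * v.transpose = 0 := by
  rw [gram_extendDist, Matrix.mul_assoc, coframe_mul_transpose σ hv, Matrix.mul_zero]

theorem regAt_extendDist {X : FunctionSpace} {x : X.Pt} (σ : Fin k ⊕ Fin d ≃ Fin m)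
    {v : X.Pt → Matrix (Fin k) (Fin m) ℂ} {t : X.Pt → CayleyIndex (d + 1) → ℂ}
    (hv : ∀ i j, X.RegAt x (fun y => v y i j)) (ht : ∀ e, X.RegAt x (fun y => t y e))
    (e : CayleyIndex (m + 1)) : X.RegAt x (fun y => extendDist σ (v y) (t y) e) := by
  have hW : ∀ a j, X.RegAt x (fun y => coframe σ (v y) a j) := by
    intro a j
    obtain ⟨j, rfl⟩ := σ.surjective j
    rcases j with i | b
    · exact (RegAt.fun_neg (hv i (σ (Sum.inr a)))).of_eq fun y => by simp [coframe]
    · exact (X.const x ((1 : Matrix (Fin d) (Fin d) ℂ) a b)).of_eq fun y => by simp [coframe]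
  exact regAt_distOf (RegAt.matrix_mul (RegAt.matrix_mul (fun i j => hW j i) (regAt_gram ht)) hW) e

theorem regAt_restrictDist {X : FunctionSpace} {x : X.Pt} (σ : Fin k ⊕ Fin d ≃ Fin m)
    {s : X.Pt → CayleyIndex (m + 1) → ℂ} (hs : ∀ e, X.RegAt x (fun y => s y e))
    (e : CayleyIndex (d + 1)) : X.RegAt x (fun y => restrictDist σ (s y) e) :=
  regAt_distOf (fun _ _ => regAt_gram hs _ _) e

/-- The point of the incidence variety given by a normalized frame and a quadratic form on the
remaining coordinates. -/
noncomputable def chartPoint (σ : Fin k ⊕ Fin d ≃ Fin m) (v : Matrix (Fin k) (Fin m) ℂ)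
    (hv : v.submatrix id (fun i => σ (Sum.inl i)) = 1) (t : CayleyIndex (d + 1) → ℂ)
    (ht : t ≠ 0) : (incidence k m).Pt :=
  ⟨(rowSpace v (linearIndependent_of_submatrix_eq_one hv),
    Projectivization.mk ℂ (extendDist σ v t) (extendDist_ne_zero σ v ht)), by
    obtain ⟨a, ha, h⟩ := rep_mk_eq (extendDist σ v t) (extendDist_ne_zero σ v ht)
    intro w hw
    have h1 := mul_transpose_eq_zero_iff.1 (gram_extendDist_mul_transpose σ hv t) w hw
    dsimp only
    rw [h, gram_smul, Matrix.smul_mulVec, h1, smul_zero]⟩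

theorem IncidencePt.gram_mul_normalFrame (q : IncidencePt k m) {c : Fin k → Fin m}
    (hc : InChart c q.1.1) : gram q.1.2.rep * (normalFrame c q.1.1).transpose = 0 :=
  mul_transpose_eq_zero_iff.2 (by rw [span_normalFrame hc]; exact q.2)

theorem IncidencePt.restrictDist_ne_zero (q : IncidencePt k m) {σ : Fin k ⊕ Fin d ≃ Fin m}
    (hc : InChart (fun i => σ (Sum.inl i)) q.1.1) : restrictDist σ q.1.2.rep ≠ 0 :=
  _root_.restrictDist_ne_zero σ (normalFrame_submatrix hc) (q.gram_mul_normalFrame hc)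
    q.1.2.rep_nonzero

theorem chartPoint_eq (q : IncidencePt k m) {σ : Fin k ⊕ Fin d ≃ Fin m}
    (hc : InChart (fun i => σ (Sum.inl i)) q.1.1) {v : Matrix (Fin k) (Fin m) ℂ}
    (hv : v.submatrix id (fun i => σ (Sum.inl i)) = 1) (hvq : v = normalFrame (fun i => σ (Sum.inl i)) q.1.1)
    {t : CayleyIndex (d + 1) → ℂ} (ht : t ≠ 0) {a : ℂ} (hta : t = a • restrictDist σ q.1.2.rep) :
    chartPoint σ v hv t ht = q := by
  subst hvq
  refine Subtype.ext (Prod.ext (rowSpace_normalFrame hc) ?_)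
  refine Eq.trans ?_ (Projectivization.mk_rep q.1.2)
  refine (Projectivization.mk_eq_mk_iff' ℂ _ _ _ _).2 ⟨a, ?_⟩
  rw [hta, extendDist_smul, extendDist_restrictDist σ hv (q.gram_mul_normalFrame hc)]

theorem exists_chart (hkd : k + d = m) (L : Subspaces k m) :
    ∃ σ : Fin k ⊕ Fin d ≃ Fin m, InChart (fun i => σ (Sum.inl i)) L := by
  obtain ⟨c, hc, h⟩ := exists_inChart L
  obtain ⟨σ, hσ⟩ := exists_equiv_comp_inl_eq hkd hc
  exact ⟨σ, by rwa [(funext hσ : (fun i => σ (Sum.inl i)) = c)]⟩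

/-! ### Local triviality -/

theorem morphAt_projectiveSpace_of_ne_zero {ι : Type} {X : FunctionSpace}
    {φ : X.Pt → (projectiveSpace ι).Pt} {x : X.Pt} (f : X.Pt → ι → ℂ)
    (hf : ∀ i, X.RegAt x (fun y => f y i)) (h0 : f x ≠ 0)
    (h : ∀ᶠ y in 𝓝 x, ∀ h : f y ≠ 0, φ y = Projectivization.mk ℂ (f y) h) :
    MorphAt X (projectiveSpace ι) φ x := by
  obtain ⟨i, hi⟩ := Function.ne_iff.1 h0
  refine morphAt_projectiveSpace f hf ?_
  filter_upwards [h, X.ne_zero (hf i) hi] with y h1 h2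
  have h3 : f y ≠ 0 := fun h => h2 (congrFun h i)
  exact ⟨h3, h1 h3⟩

open Classical in
/-- The restriction of a quadratic form, up to scalars, to a coordinate subspace. -/
noncomputable def fibrePoint (σ : Fin k ⊕ Fin d ≃ Fin m) (x₀ : ℙ ℂ (CayleyIndex (d + 1) → ℂ))
    (q : (incidence k m).Pt) : (projectiveSpace (CayleyIndex (d + 1))).Pt :=
  if h : restrictDist σ q.1.2.rep ≠ 0 then Projectivization.mk ℂ _ h else x₀

theorem fibrePoint_eq {σ : Fin k ⊕ Fin d ≃ Fin m} {x₀ : ℙ ℂ (CayleyIndex (d + 1) → ℂ)}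
    {q : (incidence k m).Pt} (h : restrictDist σ q.1.2.rep ≠ 0) :
    fibrePoint σ x₀ q = Projectivization.mk ℂ _ h := dif_pos h

theorem morphAt_fibrePoint (σ : Fin k ⊕ Fin d ≃ Fin m) (x₀ : ℙ ℂ (CayleyIndex (d + 1) → ℂ))
    {q : (incidence k m).Pt} (hq : InChart (fun i => σ (Sum.inl i)) (incidenceBase q)) :
    MorphAt (incidence k m) (projectiveSpace (CayleyIndex (d + 1))) (fibrePoint σ x₀) q := by
  obtain ⟨e, he⟩ := exists_rep_ne_zero (incidencePoint q)
  have heq : ∀ y : (incidence k m).Pt, (fun e' => Projectivization.rep (incidencePoint y) e' /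
      Projectivization.rep (incidencePoint y) e) =
      (Projectivization.rep (incidencePoint y) e)⁻¹ • Projectivization.rep (incidencePoint y) :=
    fun y => funext fun e' => div_eq_inv_mul _ _
  -- The representative is divided by its e-th coordinate to get regular entries. This rescales the
  -- vector and leaves the projective point unchanged.
  refine morphAt_projectiveSpace_of_ne_zero (fun y => restrictDist σ
    fun e' => Projectivization.rep (incidencePoint y) e' /
      Projectivization.rep (incidencePoint y) e) (regAt_restrictDist σ fun e' =>
        (morphAt_incidencePoint q).regAt (regAt_coord_div e e' _ he)) ?_ ?_
  · rw [heq, restrictDist_smul]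
    exact smul_ne_zero (inv_ne_zero he) (IncidencePt.restrictDist_ne_zero q hq)
  · refine Filter.Eventually.of_forall fun y hy => ?_
    have h1 := hy
    rw [heq, restrictDist_smul] at h1
    refine (fibrePoint_eq (right_ne_zero_of_smul h1)).trans ?_
    refine Eq.symm ((Projectivization.mk_eq_mk_iff' ℂ _ _ _ _).2
      ⟨(Projectivization.rep (incidencePoint y) e)⁻¹, ?_⟩)
    rw [heq, restrictDist_smul]
    rfl

open Classical in
/-- The inverse of the local trivialization. -/
noncomputable def trivInv (σ : Fin k ⊕ Fin d ≃ Fin m) (q₀ : (incidence k m).Pt)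
    (p : ((grassmannian k m).prod (projectiveSpace (CayleyIndex (d + 1)))).Pt) :
    (incidence k m).Pt :=
  if h : InChart (fun i => σ (Sum.inl i)) p.1 then
    chartPoint σ _ (normalFrame_submatrix h) (Projectivization.rep p.2)
      (Projectivization.rep_nonzero p.2)
  else q₀

theorem trivInv_eq {σ : Fin k ⊕ Fin d ≃ Fin m} {q₀ : (incidence k m).Pt}
    {p : ((grassmannian k m).prod (projectiveSpace (CayleyIndex (d + 1)))).Pt}
    (h : InChart (fun i => σ (Sum.inl i)) p.1) : trivInv σ q₀ p =
      chartPoint σ _ (normalFrame_submatrix h) (Projectivization.rep p.2)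
        (Projectivization.rep_nonzero p.2) := dif_pos h

theorem incidenceBase_trivInv {σ : Fin k ⊕ Fin d ≃ Fin m} {q₀ : (incidence k m).Pt}
    {p : ((grassmannian k m).prod (projectiveSpace (CayleyIndex (d + 1)))).Pt}
    (h : InChart (fun i => σ (Sum.inl i)) p.1) : incidenceBase (trivInv σ q₀ p) = p.1 := by
  rw [trivInv_eq h]
  exact rowSpace_normalFrame h

theorem fibrePoint_trivInv {σ : Fin k ⊕ Fin d ≃ Fin m} {q₀ : (incidence k m).Pt}
    {x₀ : ℙ ℂ (CayleyIndex (d + 1) → ℂ)}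
    {p : ((grassmannian k m).prod (projectiveSpace (CayleyIndex (d + 1)))).Pt}
    (h : InChart (fun i => σ (Sum.inl i)) p.1) : fibrePoint σ x₀ (trivInv σ q₀ p) = p.2 := by
  have h1 : InChart (fun i => σ (Sum.inl i)) (incidenceBase (trivInv σ q₀ p)) := by
    rwa [incidenceBase_trivInv h]
  refine (fibrePoint_eq (IncidencePt.restrictDist_ne_zero _ h1)).trans
    (Eq.trans ?_ (Projectivization.mk_rep p.2))
  obtain ⟨a, ha, h2⟩ := rep_mk_eq
    (extendDist σ (normalFrame (fun i => σ (Sum.inl i)) p.1) (Projectivization.rep p.2))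
    (extendDist_ne_zero σ _ (Projectivization.rep_nonzero p.2))
  refine (Projectivization.mk_eq_mk_iff' ℂ _ _ _ _).2 ⟨a, ?_⟩
  rw [trivInv_eq h]
  refine Eq.trans ?_ (congrArg (restrictDist σ) h2.symm)
  rw [restrictDist_smul, restrictDist_extendDist]

theorem trivInv_fibrePoint {σ : Fin k ⊕ Fin d ≃ Fin m} {q₀ : (incidence k m).Pt}
    {x₀ : ℙ ℂ (CayleyIndex (d + 1) → ℂ)} {q : (incidence k m).Pt}
    (h : InChart (fun i => σ (Sum.inl i)) (incidenceBase q)) :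
    trivInv σ q₀ (incidenceBase q, fibrePoint σ x₀ q) = q := by
  have h1 := IncidencePt.restrictDist_ne_zero q h
  obtain ⟨a, ha, h2⟩ := rep_mk_eq (restrictDist σ q.1.2.rep) h1
  refine (trivInv_eq h).trans (chartPoint_eq q h _ rfl _ (a := a) ?_)
  rw [fibrePoint_eq h1]
  exact h2

theorem morphAt_trivInv (σ : Fin k ⊕ Fin d ≃ Fin m) (q₀ : (incidence k m).Pt)
    {p : ((grassmannian k m).prod (projectiveSpace (CayleyIndex (d + 1)))).Pt}
    (h : InChart (fun i => σ (Sum.inl i)) p.1) :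
    MorphAt ((grassmannian k m).prod (projectiveSpace (CayleyIndex (d + 1)))) (incidence k m)
      (trivInv σ q₀) p := by
  obtain ⟨e, he⟩ := exists_rep_ne_zero p.2
  have hv := fun i j => (morphAt_fst p).regAt (regAt_normalFrame h i j)
  refine morphAt_incidence (fun y => normalFrame (fun i => σ (Sum.inl i)) y.1)
    (fun y => extendDist σ (normalFrame (fun i => σ (Sum.inl i)) y.1)
      (fun e' => Projectivization.rep y.2 e' / Projectivization.rep y.2 e)) hv
    (regAt_extendDist σ hv fun e' => (morphAt_snd p).regAt (regAt_coord_div e e' _ he)) ?_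
  filter_upwards [(morphAt_fst p).tendsto.eventually ((isOpen_inChart _).mem_nhds h),
    (morphAt_snd p).tendsto.eventually ((isOpen_coord_ne_zero e).mem_nhds he)] with y hy1 hy2
  have heq : (fun e' => Projectivization.rep y.2 e' / Projectivization.rep y.2 e) =
      (Projectivization.rep y.2 e)⁻¹ • Projectivization.rep y.2 :=
    funext fun e' => div_eq_inv_mul _ _
  rw [trivInv_eq hy1, heq, extendDist_smul]
  refine ⟨rfl, smul_ne_zero (inv_ne_zero hy2)
    (extendDist_ne_zero σ _ (Projectivization.rep_nonzero y.2)), ?_⟩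
  refine Eq.symm ((Projectivization.mk_eq_mk_iff' ℂ _ _ _ _).2 ⟨_, rfl⟩)

theorem card_cayleyIndex (n : ℕ) : Fintype.card (CayleyIndex n) = n.choose 2 := by
  have h : ∀ j : Fin n, ∑ i : Fin n, (if i < j then 1 else 0) = (j : ℕ) := by
    intro j
    rw [← Finset.card_filter, Finset.filter_gt_eq_Iio, Fin.card_Iio]
  rw [Fintype.card_subtype, Finset.card_filter, Fintype.sum_prod_type_right]
  simp only [h]
  rw [Fin.sum_univ_eq_sum_range (fun i => i), Finset.sum_range_id, Nat.choose_two_right]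

/-- Over the chart of σ, (L, [s]) corresponds to L and the restriction of the form to the
coordinates outside the pivots, up to scalars. `card_cayleyIndex` supplies the dimension of the
fibre. -/
theorem isProjectiveSpaceBundle_incidence (hd : 1 ≤ d) (hkd : k + d = m) :
    IsProjectiveSpaceBundle ((d + 1).choose 2 - 1) (incidence k m) (grassmannian k m)
      incidenceBase := by
  refine ⟨isMorphism_iff.2 morphAt_incidenceBase, fun L => ?_⟩
  obtain ⟨σ, hσ⟩ := exists_chart hkd L
  have hpos : 0 < (d + 1).choose 2 := Nat.choose_pos (by omega)
  let e : CayleyIndex (d + 1) ≃ Fin ((d + 1).choose 2 - 1 + 1) :=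
    Fintype.equivFinOfCardEq (by rw [card_cayleyIndex]; omega)
  -- Any nonzero vector would do: `x₀` and `q₀` are only default values of the two maps outside the
  -- chart.
  let t₀ : CayleyIndex (d + 1) → ℂ := fun _ => 1
  have ht₀ : t₀ ≠ 0 := fun h => one_ne_zero (congrFun h (e.symm 0))
  let x₀ : ℙ ℂ (CayleyIndex (d + 1) → ℂ) := Projectivization.mk ℂ t₀ ht₀
  let q₀ : (incidence k m).Pt := chartPoint σ _ (normalFrame_submatrix hσ) t₀ ht₀
  let U : Set (grassmannian k m).Pt := {L | InChart (fun i => σ (Sum.inl i)) L}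
  let G : (((grassmannian k m).restrict U).prod
      (projectiveSpaceN ((d + 1).choose 2 - 1))).Pt →
      ((grassmannian k m).prod (projectiveSpace (CayleyIndex (d + 1)))).Pt :=
    fun p => (p.1.1, reindex e.symm p.2)
  refine ⟨U, isOpen_inChart _, hσ, fun q => (⟨incidenceBase q.1, q.2⟩,
    reindex e (fibrePoint σ x₀ q.1)), ⟨isMorphism_iff.2 fun q => ?_,
    fun p => ⟨trivInv σ q₀ (G p), ?_⟩,
    isMorphism_iff.2 fun p => ?_, fun q => ?_, fun p => ?_⟩, fun _ => rfl⟩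
  · exact morphAt_prod (morphAt_restrict ((morphAt_incidenceBase q.1).trans (morphAt_val _ q)))
      ((morphAt_reindex e _).trans ((morphAt_fibrePoint σ x₀ q.2).trans (morphAt_val _ q)))
  · have h := incidenceBase_trivInv (q₀ := q₀) (p := G p) p.1.2
    change incidenceBase _ ∈ U
    rw [h]
    exact p.1.2
  · refine morphAt_restrict (MorphAt.trans (φ := G)
      (morphAt_trivInv (p := G p) σ q₀ p.1.2) (morphAt_prod ?_ ?_))
    · exact (morphAt_val U p.1).trans (morphAt_fst p)
    · exact (morphAt_reindex e.symm p.2).trans (morphAt_snd p)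
  · refine Subtype.ext ?_
    exact (congrArg (fun z => trivInv σ q₀ (incidenceBase q.1, z))
      (reindex_symm_reindex e _)).trans (trivInv_fibrePoint q.2)
  · refine Prod.ext (Subtype.ext ?_) ?_
    · exact incidenceBase_trivInv (p := G p) p.1.2
    · have h := fibrePoint_trivInv (q₀ := q₀) (x₀ := x₀)
        (p := G p) p.1.2
      exact (congrArg (reindex e) h).trans (reindex_symm_reindex e.symm p.2)

/-- Combines the local trivialization with the affine charts of the Grassmannian and of projective
space. Both nonsingularity and rationality rest on it. -/
theorem exists_locIso_incidence (hkd : k + d = m) (q : (incidence k m).Pt) :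
    ∃ (ι : Type) (_ : Fintype ι) (a : (affineSpace ι).Pt),
      LocIso (incidence k m) (affineSpace ι) q a := by
  obtain ⟨σ, hσ⟩ := exists_chart hkd (incidenceBase q)
  have hr := IncidencePt.restrictDist_ne_zero q hσ
  let x₀ : ℙ ℂ (CayleyIndex (d + 1) → ℂ) := Projectivization.mk ℂ _ hr
  have h1 : LocIso (incidence k m) ((grassmannian k m).prod (projectiveSpace (CayleyIndex (d + 1))))
      q (incidenceBase q, fibrePoint σ x₀ q) := by
    refine ⟨fun q => (incidenceBase q, fibrePoint σ x₀ q), trivInv σ q, rfl,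
      trivInv_fibrePoint hσ, ?_, ?_⟩
    · filter_upwards [(morphAt_incidenceBase q).tendsto.eventually
        ((isOpen_inChart _).mem_nhds hσ)] with y hy
      exact ⟨morphAt_prod (morphAt_incidenceBase y) (morphAt_fibrePoint σ x₀ hy),
        trivInv_fibrePoint hy⟩
    · filter_upwards [(morphAt_fst _).tendsto.eventually ((isOpen_inChart _).mem_nhds hσ)]
        with p hp
      exact ⟨morphAt_trivInv σ q hp, Prod.ext (incidenceBase_trivInv hp) (fibrePoint_trivInv hp)⟩
  obtain ⟨b, h2⟩ := locIso_grassmannian σ hσ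
  obtain ⟨e, he⟩ := exists_rep_ne_zero (fibrePoint σ x₀ q)
  have h3 := locIso_projectiveSpace e (fibrePoint σ x₀ q) he
  exact ⟨_, inferInstance, _, (h1.trans (h2.prod h3)).trans (locIso_affineSpace_sum _)⟩

theorem nonsingular_incidence (hkd : k + d = m) (q : (incidence k m).Pt) :
    (incidence k m).Nonsingular q := by
  obtain ⟨ι, _, a, h⟩ := exists_locIso_incidence hkd q
  exact h.nonsingular (nonsingular_affineSpace a)

/-! ### Irreducibility -/

theorem inChart_chartPoint (σ : Fin k ⊕ Fin d ≃ Fin m) (v : Matrix (Fin k) (Fin m) ℂ)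
    (hv : v.submatrix id (fun i => σ (Sum.inl i)) = 1) (t : CayleyIndex (d + 1) → ℂ) (ht : t ≠ 0) :
    InChart (fun i => σ (Sum.inl i)) (incidenceBase (chartPoint σ v hv t ht)) :=
  inChart_of_submatrix_eq_one (v := v) hv rfl

/-- The chart is the continuous image of an open subset of an affine space: arbitrary normal frame
entries and a nonzero form in d variables. -/
theorem isIrreducible_chart (hd : 1 ≤ d) (σ : Fin k ⊕ Fin d ≃ Fin m) :
    IsIrreducible {q : (incidence k m).Pt | InChart (fun i => σ (Sum.inl i)) (incidenceBase q)} := by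
  classical
  let ι : Type := (Fin k × Fin d) ⊕ CayleyIndex (d + 1)
  -- For d ≥ 1 there is a pair of distinct indices, so a nonzero form exists.
  let e₀ : CayleyIndex (d + 1) := ⟨(0, Fin.last d), by
    rw [Fin.lt_def]
    exact hd⟩
  let t₀ : CayleyIndex (d + 1) → ℂ := Pi.single e₀ 1
  have ht₀ : t₀ ≠ 0 := fun h => by simpa [t₀] using congrFun h e₀
  let V : Set (affineSpace ι).Pt := {a | (fun e => a (Sum.inr e)) ≠ (0 : CayleyIndex (d + 1) → ℂ)}
  let F : (affineSpace ι).Pt → (incidence k m).Pt := fun a =>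
    if h : (fun e => a (Sum.inr e)) ≠ (0 : CayleyIndex (d + 1) → ℂ) then
      chartPoint σ _ (chartFrame_submatrix σ fun e => a (Sum.inl e)) (fun e => a (Sum.inr e)) h
    else chartPoint σ _ (chartFrame_submatrix σ 0) t₀ ht₀
  have hF : ∀ a (h : a ∈ V), F a = chartPoint σ _
      (chartFrame_submatrix σ fun e => a (Sum.inl e)) (fun e => a (Sum.inr e)) h := fun a h =>
    dif_pos h
  have hVnear : ∀ a ∈ V, ∀ᶠ b in 𝓝 a, b ∈ V := by
    intro a ha
    obtain ⟨e, he⟩ := Function.ne_iff.1 ha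
    filter_upwards [FunctionSpace.ne_zero _ (regAt_affineSpace_coord (Sum.inr e) a) he] with b hb
    exact fun h => hb (congrFun h e)
  have hVopen : IsOpen V := isOpen_iff_mem_nhds.2 hVnear
  have hVirr : IsIrreducible V := by
    refine ⟨⟨Sum.elim 0 t₀, ht₀⟩, ?_⟩
    exact (PreirreducibleSpace.isPreirreducible_univ (X := (affineSpace ι).Pt)).open_subset
      hVopen (Set.subset_univ _)
  have hcont : ContinuousOn F V := by
    intro a ha
    refine ContinuousAt.continuousWithinAt (MorphAt.tendsto (X := affineSpace ι)
      (Y := incidence k m) ?_)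
    have hv : ∀ i j, (affineSpace ι).RegAt a
        (fun b => chartFrame σ (fun e => b (Sum.inl e)) i j) := by
      intro i j
      obtain ⟨j, rfl⟩ := σ.surjective j
      rcases j with j | j
      · exact (FunctionSpace.const _ _ ((1 : Matrix (Fin k) (Fin k) ℂ) i j)).of_eq fun b => by
          simp [chartFrame]
      · exact (regAt_affineSpace_coord (Sum.inl (i, j)) _).of_eq fun b =>
          (chartFrame_inr σ (fun e => b (Sum.inl e)) i j).symm
    refine morphAt_incidence (fun b => chartFrame σ fun e => b (Sum.inl e))
      (fun b => extendDist σ (chartFrame σ fun e => b (Sum.inl e)) fun e => b (Sum.inr e)) hv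
      (regAt_extendDist σ hv fun e => regAt_affineSpace_coord (Sum.inr e) a) ?_
    filter_upwards [hVnear a ha] with b hb
    rw [hF b hb]
    exact ⟨rfl, extendDist_ne_zero σ _ hb, rfl⟩
  have himage : F '' V =
      {q : (incidence k m).Pt | InChart (fun i => σ (Sum.inl i)) (incidenceBase q)} := by
    refine Set.Subset.antisymm ?_ ?_
    · rintro _ ⟨a, ha, rfl⟩
      rw [hF a ha]
      exact inChart_chartPoint σ _ _ _ _
    · intro q hq
      let a : (affineSpace ι).Pt := Sum.elim
        (fun e => normalFrame (fun i => σ (Sum.inl i)) (incidenceBase q) e.1 (σ (Sum.inr e.2)))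
        (restrictDist σ q.1.2.rep)
      have ha : a ∈ V := IncidencePt.restrictDist_ne_zero q hq
      refine ⟨a, ha, (hF a ha).trans ?_⟩
      exact chartPoint_eq q hq _ (chartFrame_eq σ (normalFrame_submatrix hq)) _ (a := 1)
        (one_smul _ _).symm
  rw [← himage]
  exact hVirr.image F hcont

/-- The two maximal minors are nonzero polynomials in the entries of a frame, so their product is
nonzero at some frame. -/
theorem exists_inChart_inChart (σ τ : Fin k ⊕ Fin d ≃ Fin m) : ∃ L : Subspaces k m,
    InChart (fun i => σ (Sum.inl i)) L ∧ InChart (fun i => τ (Sum.inl i)) L := by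
  let P : (Fin k ⊕ Fin d ≃ Fin m) → MvPolynomial (Fin k × Fin m) ℂ := fun σ =>
    Matrix.det (Matrix.of fun i j => MvPolynomial.X (i, σ (Sum.inl j)))
  have hP : ∀ σ (v : Fin k × Fin m → ℂ), MvPolynomial.eval v (P σ) =
      ((Matrix.of fun i j => v (i, j)).submatrix id (fun i => σ (Sum.inl i))).det := by
    intro σ v
    rw [RingHom.map_det]
    congr 1
    ext i j
    simp
  have hP0 : ∀ σ, P σ ≠ 0 := by
    intro σ h
    have h1 := hP σ fun e => chartFrame σ 0 e.1 e.2
    have h2 : (Matrix.of fun i j => (fun e : Fin k × Fin m => chartFrame σ 0 e.1 e.2) (i, j)) =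
      chartFrame σ 0 := rfl
    rw [h, map_zero, h2, chartFrame_submatrix, Matrix.det_one] at h1
    exact zero_ne_one h1
  obtain ⟨v, hv⟩ := exists_eval_ne_zero (mul_ne_zero (hP0 σ) (hP0 τ))
  rw [map_mul, hP, hP] at hv
  have h1 := left_ne_zero_of_mul hv
  have h2 := right_ne_zero_of_mul hv
  refine ⟨rowSpace (Matrix.of fun i j => v (i, j))
    (linearIndependent_of_submatrix_det_ne_zero h1), ?_, ?_⟩
  · exact (inChart_iff (v := Matrix.of fun i j => v (i, j)) rfl).2 h1
  · exact (inChart_iff (v := Matrix.of fun i j => v (i, j)) rfl).2 h2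

theorem irreducibleSpace_incidence (hd : 1 ≤ d) (hkd : k + d = m) :
    IrreducibleSpace (incidence k m).Pt := by
  have hopen : ∀ σ : Fin k ⊕ Fin d ≃ Fin m, IsOpen {q : (incidence k m).Pt |
      InChart (fun i => σ (Sum.inl i)) (incidenceBase q)} := fun σ =>
    (isOpen_inChart _).preimage (isMorphism_iff.2 morphAt_incidenceBase).continuous
  obtain ⟨σ⟩ : Nonempty (Fin k ⊕ Fin d ≃ Fin m) := ⟨finSumFinEquiv.trans (finCongr hkd)⟩
  refine { toNonempty := ⟨(isIrreducible_chart hd σ).1.some⟩, isPreirreducible_univ := ?_ }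
  rintro U₁ U₂ h₁ h₂ ⟨q₁, -, hq₁⟩ ⟨q₂, -, hq₂⟩
  obtain ⟨σ₁, hσ₁⟩ := exists_chart hkd (incidenceBase q₁)
  obtain ⟨σ₂, hσ₂⟩ := exists_chart hkd (incidenceBase q₂)
  obtain ⟨L, hL₁, hL₂⟩ := exists_inChart_inChart σ₁ σ₂
  have hr := IncidencePt.restrictDist_ne_zero q₁ hσ₁
  let q : (incidence k m).Pt := chartPoint σ₁ _ (normalFrame_submatrix hL₁) _ hr
  have hq : incidenceBase q = L := rowSpace_normalFrame hL₁
  -- Inside the irreducible first chart, U₁ meets the second chart, because the two charts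
  -- intersect. Irreducibility of the second chart then makes U₁ meet U₂.
  obtain ⟨y, hy, hy1, hy2⟩ := (isIrreducible_chart hd σ₁).2 U₁ _ h₁ (hopen σ₂) ⟨q₁, hσ₁, hq₁⟩
    ⟨q, by change InChart _ (incidenceBase q); rw [hq]; exact hL₁,
      by change InChart _ (incidenceBase q); rw [hq]; exact hL₂⟩
  obtain ⟨z, hz, hz1, hz2⟩ := (isIrreducible_chart hd σ₂).2 U₁ U₂ h₁ h₂ ⟨y, hy2, hy1⟩
    ⟨q₂, hσ₂, hq₂⟩
  exact ⟨z, trivial, hz1, hz2⟩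

theorem isProjectiveVariety_incidence (hd : 1 ≤ d) (hkd : k + d = m) :
    IsProjectiveVariety (incidence k m) := by
  have hirr := irreducibleSpace_incidence hd hkd
  have hne : Nonempty (incidence k m).Pt := hirr.toNonempty
  obtain ⟨z, -⟩ := exists_rep_ne_zero (incidenceEmbed hne.some)
  have : Nonempty (PluckerIndex k m) := ⟨z⟩
  exact isProjectiveVariety_induced incidenceEmbed incidenceEmbed_injective
    isClosed_range_incidenceEmbed hirr

end Chart

/-! ### The kernel of a quadratic form -/

section Kernel

variable {k d m : ℕ}

/-- A frame of the kernel of a matrix of rank `d` with the given invertible principal minor. -/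
noncomputable def kernelFrame (σ : Fin k ⊕ Fin d ≃ Fin m) (Q : Matrix (Fin m) (Fin m) ℂ) :
    Matrix (Fin k) (Fin m) ℂ :=
  chartFrame σ fun e => -((Q.submatrix (fun a => σ (Sum.inr a)) (fun a => σ (Sum.inr a)))⁻¹ *
    Q.submatrix (fun a => σ (Sum.inr a)) (fun i => σ (Sum.inl i))) e.2 e.1

/-- The rows of Q w = 0 outside the pivots read B x + A y = 0 with A invertible, so y = -A⁻¹ B x and
w is determined by its pivot coordinates x. -/
theorem eq_vecMul_kernelFrame (σ : Fin k ⊕ Fin d ≃ Fin m) {Q : Matrix (Fin m) (Fin m) ℂ}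
    (hdet : (Q.submatrix (fun a => σ (Sum.inr a)) (fun a => σ (Sum.inr a))).det ≠ 0)
    {w : Fin m → ℂ} (hw : Q.mulVec w = 0) :
    w = Matrix.vecMul (fun i => w (σ (Sum.inl i))) (kernelFrame σ Q) := by
  set A := Q.submatrix (fun a => σ (Sum.inr a)) (fun a => σ (Sum.inr a)) with hA
  set B := Q.submatrix (fun a => σ (Sum.inr a)) (fun i => σ (Sum.inl i)) with hB
  have h1 : B.mulVec (fun i => w (σ (Sum.inl i))) + A.mulVec (fun a => w (σ (Sum.inr a))) = 0 := by
    ext a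
    have h := congrFun hw (σ (Sum.inr a))
    rw [Matrix.mulVec, dotProduct, ← σ.sum_comp, Fintype.sum_sum_type] at h
    exact h
  have h2 : (fun a => w (σ (Sum.inr a))) = -(A⁻¹ * B).mulVec (fun i => w (σ (Sum.inl i))) := by
    rw [← Matrix.mulVec_mulVec, eq_neg_of_add_eq_zero_left h1, Matrix.mulVec_neg, neg_neg,
      Matrix.mulVec_mulVec, Matrix.nonsing_inv_mul _ (isUnit_iff_ne_zero.2 hdet),
      Matrix.one_mulVec]
  ext j
  obtain ⟨j, rfl⟩ := σ.surjective j
  rcases j with i | a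
  · rw [Matrix.vecMul, dotProduct]
    simp [kernelFrame, chartFrame, Matrix.one_apply]
  · refine (congrFun h2 a).trans ?_
    rw [Matrix.vecMul, dotProduct, Pi.neg_apply, Matrix.mulVec, dotProduct,
      ← Finset.sum_neg_distrib]
    refine Finset.sum_congr rfl fun i _ => ?_
    rw [kernelFrame, chartFrame_inr, mul_neg, mul_comm]

/-- `L` lies in the span of the k independent rows and has dimension k. So `L` is determined by Q,
with a frame whose entries are rational in Q. -/
theorem span_kernelFrame (σ : Fin k ⊕ Fin d ≃ Fin m) {Q : Matrix (Fin m) (Fin m) ℂ}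
    (hdet : (Q.submatrix (fun a => σ (Sum.inr a)) (fun a => σ (Sum.inr a))).det ≠ 0)
    (L : Subspaces k m) (hL : ∀ w ∈ L.1, Q.mulVec w = 0) :
    Submodule.span ℂ (Set.range (kernelFrame σ Q).row) = L.1 := by
  refine (Submodule.eq_of_le_of_finrank_eq (fun w hw => ?_) ?_).symm
  · rw [eq_vecMul_kernelFrame σ hdet (hL w hw), Matrix.vecMul_eq_sum]
    exact Submodule.sum_mem _ fun i _ => Submodule.smul_mem _ _ (Submodule.subset_span ⟨i, rfl⟩)
  · have h : LinearIndependent ℂ (kernelFrame σ Q).row :=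
      linearIndependent_of_submatrix_eq_one (chartFrame_submatrix σ _)
    rw [L.2, finrank_span_eq_card h, Fintype.card_fin]

theorem regAt_kernelFrame {X : FunctionSpace} {x : X.Pt} (σ : Fin k ⊕ Fin d ≃ Fin m)
    {Q : X.Pt → Matrix (Fin m) (Fin m) ℂ} (hQ : ∀ i j, X.RegAt x (fun y => Q y i j))
    (hdet : ((Q x).submatrix (fun a => σ (Sum.inr a)) (fun a => σ (Sum.inr a))).det ≠ 0)
    (i : Fin k) (j : Fin m) : X.RegAt x (fun y => kernelFrame σ (Q y) i j) := by
  obtain ⟨j, rfl⟩ := σ.surjective j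
  rcases j with j | a
  · exact (X.const x ((1 : Matrix (Fin k) (Fin k) ℂ) i j)).of_eq fun y => by
      simp [kernelFrame, chartFrame]
  · refine (RegAt.fun_neg (RegAt.matrix_mul (RegAt.matrix_inv
      (A := fun y => (Q y).submatrix (fun a => σ (Sum.inr a)) (fun a => σ (Sum.inr a)))
      (fun a b => hQ _ _) hdet)
      (B := fun y => (Q y).submatrix (fun a => σ (Sum.inr a)) (fun i => σ (Sum.inl i)))
      (fun a b => hQ _ _) a i)).of_eq fun y => ?_
    rw [kernelFrame, chartFrame_inr]

/-- Q factors through its d × d block by `eq_coframe_mul_mul`, so the block has rank at least d.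
Hence pivots of the kernel leave a complementary principal minor that is nonzero. -/
theorem det_submatrix_ne_zero_of_le_rank (σ : Fin k ⊕ Fin d ≃ Fin m)
    {v : Matrix (Fin k) (Fin m) ℂ} (hv : v.submatrix id (fun i => σ (Sum.inl i)) = 1)
    {Q : Matrix (Fin m) (Fin m) ℂ} (hQ : Q.transpose = Q) (h : Q * v.transpose = 0)
    (hr : d ≤ Q.rank) :
    (Q.submatrix (fun a => σ (Sum.inr a)) (fun a => σ (Sum.inr a))).det ≠ 0 := by
  set A := Q.submatrix (fun a => σ (Sum.inr a)) (fun a => σ (Sum.inr a)) with hA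
  have h1 : d ≤ A.rank := by
    rw [eq_coframe_mul_mul σ hv hQ h] at hr
    exact hr.trans ((Matrix.rank_mul_le_left _ _).trans (Matrix.rank_mul_le_right _ _))
  have h2 : LinearIndependent ℂ A.row := by
    rw [linearIndependent_iff_card_le_finrank_span, Fintype.card_fin, Set.finrank,
      ← Matrix.rank_eq_finrank_span_row]
    exact h1
  exact IsUnit.ne_zero ((Matrix.isUnit_iff_isUnit_det _).1
    (Matrix.linearIndependent_rows_iff_isUnit.1 h2))

end Kernel

/-! ### The resolution of the Cayley–Menger variety -/

section Resolution

variable {k d m : ℕ}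

/-- The quadratic form of `x` determines the points of the incidence variety over `x`. -/
def IsNondegenerate (k : ℕ) {d m : ℕ} (x : (cayleyMenger d (m + 1)).Pt) : Prop :=
  k = 0 ∨ ∃ σ : Fin k ⊕ Fin d ≃ Fin m, ((gram (Projectivization.rep x.1)).submatrix
    (fun a => σ (Sum.inr a)) (fun a => σ (Sum.inr a))).det ≠ 0

/-- Coordinates of the points of the Cayley–Menger variety, normalized by `s_e = 1`. -/
noncomputable def normalizedDist (e : CayleyIndex (m + 1)) (x : (cayleyMenger d (m + 1)).Pt) :
    CayleyIndex (m + 1) → ℂ :=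
  fun e' => Projectivization.rep x.1 e' / Projectivization.rep x.1 e

theorem normalizedDist_eq (e : CayleyIndex (m + 1)) (x : (cayleyMenger d (m + 1)).Pt) :
    normalizedDist e x = (Projectivization.rep x.1 e)⁻¹ • Projectivization.rep x.1 :=
  funext fun _ => div_eq_inv_mul _ _

theorem regAt_normalizedDist {e : CayleyIndex (m + 1)} {x : (cayleyMenger d (m + 1)).Pt}
    (he : Projectivization.rep x.1 e ≠ 0) (e' : CayleyIndex (m + 1)) :
    (cayleyMenger d (m + 1)).RegAt x (fun y => normalizedDist e y e') :=
  (morphAt_val _ x).regAt (regAt_coord_div e e' x.1 he)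

theorem cayleyMenger_eventually {e : CayleyIndex (m + 1)} {x : (cayleyMenger d (m + 1)).Pt}
    (he : Projectivization.rep x.1 e ≠ 0) :
    ∀ᶠ y : (cayleyMenger d (m + 1)).Pt in 𝓝 x, Projectivization.rep y.1 e ≠ 0 :=
  (morphAt_val _ x).tendsto.eventually ((isOpen_coord_ne_zero e).mem_nhds he)

theorem det_gram_normalizedDist_ne_zero_iff {e : CayleyIndex (m + 1)}
    {x : (cayleyMenger d (m + 1)).Pt} (he : Projectivization.rep x.1 e ≠ 0)
    (c : Fin d → Fin m) : ((gram (normalizedDist e x)).submatrix c c).det ≠ 0 ↔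
      ((gram (Projectivization.rep x.1)).submatrix c c).det ≠ 0 := by
  have h : (gram (normalizedDist e x)).submatrix c c =
      (Projectivization.rep x.1 e)⁻¹ • (gram (Projectivization.rep x.1)).submatrix c c := by
    rw [normalizedDist_eq, gram_smul]
    rfl
  rw [h, Matrix.det_smul]
  simp [he]

theorem eventually_det_ne_zero {x : (cayleyMenger d (m + 1)).Pt} {c : Fin d → Fin m}
    (h : ((gram (Projectivization.rep x.1)).submatrix c c).det ≠ 0) :
    ∀ᶠ y : (cayleyMenger d (m + 1)).Pt in 𝓝 x,
      ((gram (Projectivization.rep y.1)).submatrix c c).det ≠ 0 := by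
  obtain ⟨e, he⟩ := exists_rep_ne_zero x.1
  have hreg : (cayleyMenger d (m + 1)).RegAt x
      (fun y => ((gram (normalizedDist e y)).submatrix c c).det) :=
    RegAt.det fun i j => regAt_gram (regAt_normalizedDist he) _ _
  filter_upwards [cayleyMenger_eventually he, FunctionSpace.ne_zero _ hreg
    ((det_gram_normalizedDist_ne_zero_iff he c).2 h)] with y h1 h2
  exact (det_gram_normalizedDist_ne_zero_iff h1 c).1 h2

theorem IsNondegenerate.eventually {x : (cayleyMenger d (m + 1)).Pt} (h : IsNondegenerate k x) :
    ∀ᶠ y : (cayleyMenger d (m + 1)).Pt in 𝓝 x, IsNondegenerate k y := by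
  rcases h with h | ⟨σ, h⟩
  · exact Filter.Eventually.of_forall fun _ => Or.inl h
  · filter_upwards [eventually_det_ne_zero h] with y hy
    exact Or.inr ⟨σ, hy⟩

theorem Subspaces.eq_bot {L : Subspaces 0 m} : L.1 = ⊥ := Submodule.finrank_eq_zero.1 L.2

theorem IsNondegenerate.eq {hkd : k + d = m} {q q' : (incidence k m).Pt}
    (h : IsNondegenerate k (toCayleyMenger hkd q))
    (hq : toCayleyMenger hkd q' = toCayleyMenger hkd q) : q' = q := by
  have h2 : q'.1.2 = q.1.2 := congrArg Subtype.val hq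
  refine Subtype.ext (Prod.ext (Subtype.ext ?_) h2)
  rcases h with rfl | ⟨σ, h⟩
  · exact (Subspaces.eq_bot (L := q'.1.1)).trans (Subspaces.eq_bot (L := q.1.1)).symm
  · refine (span_kernelFrame σ h q'.1.1 ?_).symm.trans (span_kernelFrame σ h q.1.1 q.2)
    have h3 := q'.2
    rw [h2] at h3
    exact h3

/-- A section of the map from the incidence variety to the Cayley–Menger variety. -/
noncomputable def cayleyMengerLift (hkd : k + d = m) (x : (cayleyMenger d (m + 1)).Pt) :
    (incidence k m).Pt := (exists_toCayleyMenger_eq hkd x).choose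

theorem toCayleyMenger_lift (hkd : k + d = m) (x : (cayleyMenger d (m + 1)).Pt) :
    toCayleyMenger hkd (cayleyMengerLift hkd x) = x := (exists_toCayleyMenger_eq hkd x).choose_spec

theorem IsNondegenerate.lift_toCayleyMenger {hkd : k + d = m} {q : (incidence k m).Pt}
    (h : IsNondegenerate k (toCayleyMenger hkd q)) :
    cayleyMengerLift hkd (toCayleyMenger hkd q) = q := h.eq (toCayleyMenger_lift hkd _)

theorem cayleyMengerLift_snd (hkd : k + d = m) (x : (cayleyMenger d (m + 1)).Pt) :
    (cayleyMengerLift hkd x).1.2 = x.1 := congrArg Subtype.val (toCayleyMenger_lift hkd x)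

theorem gram_mulVec_of_mem_lift (hkd : k + d = m) (x : (cayleyMenger d (m + 1)).Pt)
    {w : Fin m → ℂ} (hw : w ∈ (cayleyMengerLift hkd x).1.1.1) :
    (gram (Projectivization.rep x.1)).mulVec w = 0 := by
  have h := (cayleyMengerLift hkd x).2
  rw [cayleyMengerLift_snd] at h
  exact h w hw

/-- The lift is made by choice, but near a nondegenerate point its subspace is forced: it is zero if
k = 0, and otherwise spanned by `kernelFrame`, whose entries are regular. -/
theorem IsNondegenerate.morphAt_lift (hkd : k + d = m) {x : (cayleyMenger d (m + 1)).Pt}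
    (h : IsNondegenerate k x) :
    MorphAt (cayleyMenger d (m + 1)) (incidence k m) (cayleyMengerLift hkd) x := by
  obtain ⟨e, he⟩ := exists_rep_ne_zero x.1
  have hpt : ∀ y : (cayleyMenger d (m + 1)).Pt, Projectivization.rep y.1 e ≠ 0 →
      ∃ h : normalizedDist e y ≠ 0,
        (cayleyMengerLift hkd y).1.2 = Projectivization.mk ℂ (normalizedDist e y) h := by
    intro y hy
    refine ⟨fun h0 => one_ne_zero ((div_self hy).symm.trans (congrFun h0 e)), ?_⟩
    refine (cayleyMengerLift_snd hkd y).trans ((Projectivization.mk_rep _).symm.trans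
      (Eq.symm ((Projectivization.mk_eq_mk_iff' ℂ _ _ _ _).2
        ⟨(Projectivization.rep y.1 e)⁻¹, (normalizedDist_eq e y).symm⟩)))
  rcases h with rfl | ⟨σ, h⟩
  · refine morphAt_incidence (fun _ => 0) (normalizedDist e) (fun i => i.elim0)
      (regAt_normalizedDist he) ?_
    filter_upwards [cayleyMenger_eventually he] with y hy
    refine ⟨?_, hpt y hy⟩
    rw [Subspaces.eq_bot, Submodule.span_eq_bot]
    rintro _ ⟨i, rfl⟩
    exact i.elim0
  · refine morphAt_incidence (fun y => kernelFrame σ (gram (normalizedDist e y)))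
      (normalizedDist e) (regAt_kernelFrame σ (regAt_gram (regAt_normalizedDist he))
        ((det_gram_normalizedDist_ne_zero_iff he _).2 h)) (regAt_normalizedDist he) ?_
    filter_upwards [cayleyMenger_eventually he, eventually_det_ne_zero h] with y hy hdet
    refine ⟨span_kernelFrame σ ((det_gram_normalizedDist_ne_zero_iff hy _).2 hdet) _
      fun w hw => ?_, hpt y hy⟩
    rw [normalizedDist_eq, gram_smul, Matrix.smul_mulVec, gram_mulVec_of_mem_lift hkd y hw,
      smul_zero]

theorem IsNondegenerate.locIso (hkd : k + d = m) {x : (cayleyMenger d (m + 1)).Pt}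
    (h : IsNondegenerate k x) :
    LocIso (cayleyMenger d (m + 1)) (incidence k m) x (cayleyMengerLift hkd x) := by
  refine ⟨cayleyMengerLift hkd, toCayleyMenger hkd, rfl, toCayleyMenger_lift hkd x, ?_, ?_⟩
  · filter_upwards [h.eventually] with y hy
    exact ⟨hy.morphAt_lift hkd, toCayleyMenger_lift hkd y⟩
  · have h1 := (morphAt_toCayleyMenger hkd (cayleyMengerLift hkd x)).tendsto
    rw [toCayleyMenger_lift hkd x] at h1
    filter_upwards [h1.eventually h.eventually] with q hq
    exact ⟨morphAt_toCayleyMenger hkd q, hq.lift_toCayleyMenger⟩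

theorem IsNondegenerate.nonsingular (hkd : k + d = m) {x : (cayleyMenger d (m + 1)).Pt}
    (h : IsNondegenerate k x) : (cayleyMenger d (m + 1)).Nonsingular x :=
  (h.locIso hkd).nonsingular (nonsingular_incidence hkd _)

theorem isNondegenerate_of_le_rank (hkd : k + d = m) {x : (cayleyMenger d (m + 1)).Pt}
    (h : d ≤ (gram (Projectivization.rep x.1)).rank) : IsNondegenerate k x := by
  obtain ⟨σ, hσ⟩ := exists_chart hkd (cayleyMengerLift hkd x).1.1
  refine Or.inr ⟨σ, det_submatrix_ne_zero_of_le_rank σ (normalFrame_submatrix hσ)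
    (gram_transpose _) (mul_transpose_eq_zero_iff.2 ?_) h⟩
  rw [span_normalFrame hσ]
  exact fun w hw => gram_mulVec_of_mem_lift hkd x hw

/-- For k = 0 the variety is the whole projective space and points of low rank are nonsingular as
well, which is why `IsNondegenerate` has a separate alternative. For k ≥ 1 low rank means singular.
-/
theorem isNondegenerate_of_nonsingular (hkd : k + d = m) {x : (cayleyMenger d (m + 1)).Pt}
    (h : (cayleyMenger d (m + 1)).Nonsingular x) : IsNondegenerate k x := by
  rcases Nat.eq_zero_or_pos k with hk | hk
  · exact Or.inl hk
  · refine isNondegenerate_of_le_rank hkd ?_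
    by_contra! hlt
    exact singular_of_rank_lt (by omega) x hlt h

theorem isIsoOver_toCayleyMenger (hkd : k + d = m) {U : Set (cayleyMenger d (m + 1)).Pt}
    (hU : ∀ x ∈ U, IsNondegenerate k x) :
    IsIsoOver (incidence k m) (cayleyMenger d (m + 1)) (toCayleyMenger hkd) U := by
  refine isIso_restrict (S := toCayleyMenger hkd ⁻¹' U) (T := U) (toCayleyMenger hkd)
    (cayleyMengerLift hkd) (fun q hq => ⟨hq, morphAt_toCayleyMenger hkd q,
      (hU _ hq).lift_toCayleyMenger⟩) fun x hx => ⟨?_, (hU x hx).morphAt_lift hkd,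
      toCayleyMenger_lift hkd x⟩
  change toCayleyMenger hkd _ ∈ U
  rwa [toCayleyMenger_lift hkd x]

/-- Witness: the identity form on the last d coordinates, extended by zero, whose complementary
principal minor is 1 up to scaling. -/
theorem exists_isNondegenerate (hd : 1 ≤ d) (hkd : k + d = m) :
    ∃ x : (cayleyMenger d (m + 1)).Pt, IsNondegenerate k x := by
  let σ : Fin k ⊕ Fin d ≃ Fin m := finSumFinEquiv.trans (finCongr hkd)
  let e₀ : CayleyIndex (d + 1) := ⟨(0, Fin.last d), by
    rw [Fin.lt_def]
    exact hd⟩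
  let t : CayleyIndex (d + 1) → ℂ := distOf 1
  have ht : t ≠ 0 := fun h => distOf_one_ne_zero e₀ (congrFun h e₀)
  refine ⟨toCayleyMenger hkd (chartPoint σ _ (chartFrame_submatrix σ 0) t ht), Or.inr ⟨σ, ?_⟩⟩
  obtain ⟨a, ha, h⟩ := rep_mk_eq (extendDist σ (chartFrame σ 0) t) (extendDist_ne_zero σ _ ht)
  change ((gram (Projectivization.rep (Projectivization.mk ℂ (extendDist σ (chartFrame σ 0) t) _)
    )).submatrix _ _).det ≠ 0
  have h1 : ∀ (Q : Matrix (Fin m) (Fin m) ℂ) (c : Fin d → Fin m),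
      (a • Q).submatrix c c = a • Q.submatrix c c := fun _ _ => rfl
  rw [h, gram_smul, gram_extendDist, h1, Matrix.det_smul, submatrix_coframe_mul_mul,
    gram_distOf Matrix.transpose_one, Matrix.det_one, mul_one]
  exact pow_ne_zero _ ha

/-- A nonzero (d+1)-minor of the normalized Gram matrix is a regular function near the point, so
rank greater than d is an open condition. -/
theorem isClosed_cayleyMengerSet :
    IsClosed (X := (projectiveSpace (CayleyIndex (m + 1))).Pt) (cayleyMengerSet d (m + 1)) := by
  refine isOpen_compl_iff.1 (isOpen_iff_mem_nhds.2 fun x hx => ?_)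
  have hr : d + 1 ≤ (gram (Projectivization.rep x)).rank := by
    by_contra! h
    exact hx (mem_cayleyMengerSet_iff.2 (Nat.lt_succ_iff.1 h))
  obtain ⟨e, he⟩ := exists_rep_ne_zero x
  have hr' : ∀ y : (projectiveSpace (CayleyIndex (m + 1))).Pt, Projectivization.rep y e ≠ 0 →
      (gram (fun e' => Projectivization.rep y e' / Projectivization.rep y e)).rank =
        (gram (Projectivization.rep y)).rank := by
    intro y hy
    refine Eq.trans ?_ (rank_gram_smul (inv_ne_zero hy) _)
    exact congrArg (fun s => (gram s).rank) (funext fun _ => div_eq_inv_mul _ _)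
  obtain ⟨a, b, hab⟩ := exists_minor_ne_zero_of_lt_rank _ (hr.trans_eq (hr' x he).symm)
  have hreg : (projectiveSpace (CayleyIndex (m + 1))).RegAt x (fun y => ((gram (fun e' =>
      Projectivization.rep y e' / Projectivization.rep y e)).submatrix a b).det) :=
    RegAt.det fun i j => regAt_gram (fun e' => regAt_coord_div e e' x he) _ _
  filter_upwards [(isOpen_coord_ne_zero e).mem_nhds he, FunctionSpace.ne_zero _ hreg hab]
    with y hy hdet hmem
  exact hdet (det_submatrix_eq_zero_of_rank_le
    ((hr' y hy).trans_le (mem_cayleyMengerSet_iff.1 hmem)) a b)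

theorem irreducibleSpace_cayleyMenger (hd : 1 ≤ d) (hkd : k + d = m) :
    IrreducibleSpace (cayleyMenger d (m + 1)).Pt := by
  have h := irreducibleSpace_incidence hd hkd
  have hc := (isMorphism_iff.2 (morphAt_toCayleyMenger hkd)).continuous
  exact Function.Surjective.irreducibleSpace hc (exists_toCayleyMenger_eq hkd)

theorem isProjectiveVariety_cayleyMenger (hd : 1 ≤ d) (hkd : k + d = m) :
    IsProjectiveVariety (cayleyMenger d (m + 1)) := by
  have hirr := irreducibleSpace_cayleyMenger hd hkd
  obtain ⟨e, -⟩ := exists_rep_ne_zero hirr.toNonempty.some.1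
  have : Nonempty (CayleyIndex (m + 1)) := ⟨e⟩
  refine isProjectiveVariety_induced Subtype.val Subtype.val_injective ?_ hirr
  have h : Set.range (Subtype.val : cayleyMengerSet d (m + 1) → _) = cayleyMengerSet d (m + 1) :=
    Subtype.range_val
  exact h.symm ▸ isClosed_cayleyMengerSet

theorem isResolution_toCayleyMenger (hd : 1 ≤ d) (hkd : k + d = m) :
    IsResolution (incidence k m) (cayleyMenger d (m + 1)) (toCayleyMenger hkd) where
  source := isProjectiveVariety_incidence hd hkd
  target := isProjectiveVariety_cayleyMenger hd hkd
  nonsingular := nonsingular_incidence hkd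
  morphism := isMorphism_iff.2 (morphAt_toCayleyMenger hkd)
  surjective := exists_toCayleyMenger_eq hkd
  birational := ⟨{x | IsNondegenerate k x}, isOpen_iff_mem_nhds.2 fun _ hx => hx.eventually,
    exists_isNondegenerate hd hkd, isIsoOver_toCayleyMenger hkd fun _ hx => hx⟩
  iso := isIsoOver_toCayleyMenger hkd fun _ hx =>
    isNondegenerate_of_nonsingular hkd (not_not.1 hx)

/-! ### Rationality -/

theorem locIso_affineSpace_reindex {ι κ : Type} (e : ι ≃ κ) (a : (affineSpace ι).Pt) :
    LocIso (affineSpace ι) (affineSpace κ) a (fun j => a (e.symm j)) := by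
  refine ⟨fun b j => b (e.symm j), fun b i => b (e i), rfl, funext fun i => by simp,
    Filter.Eventually.of_forall fun b => ⟨morphAt_affineSpace fun j =>
      regAt_affineSpace_coord _ b, funext fun i => by simp⟩,
    Filter.Eventually.of_forall fun b => ⟨morphAt_affineSpace fun i =>
      regAt_affineSpace_coord _ b, funext fun i => by simp⟩⟩

theorem exists_locIso_projectiveSpaceN {ι : Type} [Fintype ι] (a : (affineSpace ι).Pt) :
    ∃ y : (projectiveSpaceN (Fintype.card ι)).Pt,
      LocIso (affineSpace ι) (projectiveSpaceN (Fintype.card ι)) a y := by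
  classical
  let r := Fintype.card ι
  let e : ι ≃ {j : Fin (r + 1) // j ≠ 0} := Fintype.equivOfCardEq (by
    rw [Fintype.card_subtype_compl]; simp [r])
  let b : (affineSpace {j : Fin (r + 1) // j ≠ 0}).Pt := fun j => a (e.symm j)
  let y : (projectiveSpace (Fin (r + 1))).Pt :=
    Projectivization.mk ℂ (affineLift 0 b) (affineLift_ne_zero _ _)
  have h := locIso_projectiveSpace 0 y (rep_mk_affineLift_ne_zero 0 b)
  have hb : affineCoord 0 y = b := affineCoord_mk 0 b
  rw [hb] at h
  exact ⟨y, (locIso_affineSpace_reindex e a).trans h.symm⟩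

/-- At a nondegenerate point the variety is locally the incidence variety, which is locally an
affine space, hence locally a projective space. -/
theorem isRational_cayleyMenger (hd : 1 ≤ d) (hkd : k + d = m) :
    IsRational (cayleyMenger d (m + 1)) := by
  refine ⟨irreducibleSpace_cayleyMenger hd hkd, ?_⟩
  obtain ⟨x, hx⟩ := exists_isNondegenerate hd hkd
  obtain ⟨ι, _, a, h⟩ := exists_locIso_incidence hkd (cayleyMengerLift hkd x)
  obtain ⟨y, hy⟩ := exists_locIso_projectiveSpaceN a
  obtain ⟨U, V, hU, hxU, hV, hyV, h⟩ := (((hx.locIso hkd).trans h).trans hy).exists_isIso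
  exact ⟨_, U, V, hU, ⟨x, hxU⟩, hV, ⟨y, hyV⟩, h⟩

/-! ### The singular locus -/

/-- Rank d points are nondegenerate, hence nonsingular. Points of smaller rank are singular because
k ≥ 1 gives d < m. -/
theorem cayleyMengerSingularSet_eq (hd : 1 ≤ d) (hkd : k + d = m) (hk : 1 ≤ k) :
    cayleyMengerSingularSet d (m + 1) = cayleyMengerSet (d - 1) (m + 1) := by
  ext x
  rw [mem_cayleyMengerSet_iff]
  constructor
  · rintro ⟨hx, hs⟩
    by_contra! h
    exact hs ((isNondegenerate_of_le_rank hkd (x := ⟨x, hx⟩)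
      (show d ≤ (gram x.rep).rank by omega)).nonsingular hkd)
  · intro h
    exact ⟨mem_cayleyMengerSet_iff.2 (by omega), singular_of_rank_lt (by omega) _
      (show (gram x.rep).rank < d by omega)⟩

end Resolution

theorem proposition4p5 (d n : ℕ) (hd : 1 ≤ d) (hdn : d + 1 ≤ n) :
    (d + 2 ≤ n → cayleyMengerSingularSet d n = cayleyMengerSet (d - 1) n) ∧
    (∃ (X : FunctionSpace) (π : X.Pt → (cayleyMenger d n).Pt)
        (p : X.Pt → (FunctionSpace.grassmannian (n - d - 1) (n - 1)).Pt),
      FunctionSpace.IsResolution X (cayleyMenger d n) π ∧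
      FunctionSpace.IsProjectiveSpaceBundle ((d + 1).choose 2 - 1) X
        (FunctionSpace.grassmannian (n - d - 1) (n - 1)) p) ∧
    FunctionSpace.IsRational (cayleyMenger d n) := by
  -- Here k is the dimension of the subspaces in the Grassmannian, m = n - 1 is k + d, and the
  -- condition d + 2 ≤ n becomes k ≥ 1.
  obtain ⟨k, rfl⟩ : ∃ k, n = k + d + 1 := ⟨n - d - 1, by omega⟩
  have h1 : k + d + 1 - d - 1 = k := by omega
  have h2 : k + d + 1 - 1 = k + d := by omega
  rw [h1, h2]
  exact ⟨fun h => cayleyMengerSingularSet_eq (k := k) hd rfl (by omega),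
    ⟨incidence k (k + d), toCayleyMenger rfl, incidenceBase, isResolution_toCayleyMenger hd rfl,
      isProjectiveSpaceBundle_incidence hd rfl⟩,
    isRational_cayleyMenger (k := k) hd rfl⟩
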